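/- **Setting.** There are $N$ agents. Agent $i$ has a closed convex action set $\mathcal X_i\subseteq\mathbb R^{d_i}$ ($d_i\ge 1$) of diameter at most $D_x$; put $\mathcal X=\prod_i\mathcal X_i$. Its cost is $J_i(x,\xi_i)$, $x=(x_i,x_{-i})\in\mathcal X$, where $\xi_i\in\Xi_i$ is a random variable with a fixed law and $J_i(x,\cdot)$ is measurable; its risk level is $\alpha_i\in(0,1]$. Let $F_i^x(y)=\mathbb P\{J_i(x,\xi_i)\le y\}$. The conditional value at risk of a distribution function $F$ is $\mathrm{CVaR}_\alpha[F]=\inf_{z\in\mathbb R}\{z+\frac1\alpha\int_z^\infty(1-F(y))\,dy\}$, i.e. $\inf_z\{z+\frac1\alpha\mathbb E[(Z-z)^+]\}$ for $Z\sim F$, and $C_i(x)=\mathrm{CVaR}_{\alpha_i}[F_i^x]$. Let $S(\alpha)=\sum_{i=1}^N\alpha_i^{-2}$. Norms are Euclidean. Assume, for all $i$: 1. $J_i(x_i,x_{-i},\xi_i)$ is convex in $x_i\in\mathcal X_i$ for all $x_{-i}$ and $\xi_i$, and $|J_i|\le U$ on $\mathcal X\times\Xi_i$; 2. $x\mapsto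 J_i(x,\xi_i)$ is $L_0$-Lipschitz on $\mathcal X$ for every $\xi_i$; 3. $\sup_y|F_i^w(y)-F_i^v(y)|\le C_0\|w-v\|$ for all $w,v\in\mathcal X$. **Algorithm.** Given $T$, $a\in(0,1)$ and $b>0$, let $n_t=\lceil bU^2(T-t+1)^a\rceil$, $\eta_i=\frac{D_x}{d_iL_0N}T^{-3a/4}$, $\delta=\frac{D_x}{N^{1/6}}T^{-a/4}$, $\beta=\frac1{U^2T^{a/4}}$ and $\mathcal X_i^\delta=\{x\in\mathcal X_i:\mathrm{dist}(x,\partial\mathcal X_i)\ge\delta\}$. Start from any $x_{i,1}\in\mathcal X_i^\delta$ (in particular $\mathcal X_i^\delta\neq\emptyset$) and any initial CVaR values $c_{i,0}\in[-U,U]$. In episode $t=1,\dots,T$ each agent draws $u_{i,t}$ uniformly from the unit sphere of $\mathbb R^{d_i}$ and plays $\hat x_{i,t}=x_{i,t}+\delta u_{i,t}$ in $n_t$ rounds; it observes the costs $J_i(\hat x_t,\xi_{i,t}^j)$, $j=1,\dots,n_t$, and forms $$\hat F_{i,t}(y)=\frac1{n_t}\sum_{j=1}^{n_t}\mathbf 1\{J_i(\hat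 x_t,\xi_{i,t}^j)\le y\},\qquad \bar F_{i,1}=\hat F_{i,1},\qquad \bar F_{i,t}=\beta\bar F_{i,t-1}+(1-\beta)\hat F_{i,t}\ (t\ge2),$$ $$c_{i,t}=\mathrm{CVaR}_{\alpha_i}[\bar F_{i,t}],\qquad \bar g_{i,t}=\frac{d_i}\delta\,(c_{i,t}-c_{i,t-1})\,u_{i,t},\qquad x_{i,t+1}=\mathcal P_{\mathcal X_i^\delta}(x_{i,t}-\eta_i\bar g_{i,t}),$$ where $\mathcal P$ is the Euclidean projection. (The formulas are applied also for the finitely many $T$ with $\beta\ge1$.) The directions $u_{i,t}$ are independent over $i$ and $t$; each $\xi_{i,t}^j$ has the law of $\xi_i$; the vectors $(\xi_{i,t}^j)_{i=1}^N$ are independent over $(t,j)$; directions and samples are independent of each other. The regret of agent $i$ is $$\mathrm R_{C_i}(T)=\sum_{t=1}^TC_i(\hat x_{i,t},\hat x_{-i,t})-\min_{\tilde x_i\in\mathcal X_i}\sum_{t=1}^TC_i(\tilde x_i,\hat x_{-i,t}).$$ **Theorem.** Let $a\in(0,1)$ and $b,U,C_0,\ell,\rho>0$. There is a constant $K>0$,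 depending only on $a,b,U,C_0,\ell,\rho$, such that the following holds for all $L_0\ge\ell$ and $D_x\ge\ell$, all $N$, and every game as above in which each $\mathcal X_i$ contains a closed ball of radius $D_x/\rho$. For every integer $T\ge(8N^{2/3})^{1/a}$, every $\gamma\in(0,1)$ and every run of the algorithm as above, with probability at least $1-\gamma$, simultaneously for all agents $i$, $$\mathrm R_{C_i}(T)\le K\,D_x\,d_i\,L_0\,N\,S(\alpha)\,\ln(T/\gamma)\,T^{1-a/4}.$$ -/

import Mathlib

open MeasureTheory ProbabilityTheory

noncomputable section

/-- The action space `ℝ^n` of one agent, with its Euclidean norm. -/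
abbrev Act (n : ℕ) : Type := EuclideanSpace ℝ (Fin n)

/-- The space of action profiles: concatenated vectors with the Euclidean norm. -/
abbrev Profile {N : ℕ} (d : Fin N → ℕ) : Type := PiLp 2 (fun i => Act (d i))

/-- The profile in which agent `i` plays `y` and all the others play as in `x`. -/
def replaceAction {N : ℕ} {d : Fin N → ℕ} (x : Profile d) (i : Fin N) (y : Act (d i)) :
    Profile d :=
  WithLp.toLp 2 (Function.update (fun k => x k) i y)

/-- Conditional value at risk at level `α` of a cost with distribution function `F`, by the
Rockafellar–Uryasev formula `inf_z (z + E[(Z - z)⁺] / α)`, where `E[(Z - z)⁺] = ∫_z^∞ (1 - F)`. -/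
def cvar (α : ℝ) (F : ℝ → ℝ) : ℝ :=
  ⨅ z : ℝ, (z + α⁻¹ * ∫ y in Set.Ioi z, (1 - F y))

/-- The points of `X` at distance at least `δ` from the boundary of `X`. -/
def shrink {n : ℕ} (X : Set (Act n)) (δ : ℝ) : Set (Act n) :=
  {x ∈ X | δ ≤ Metric.infDist x (frontier X)}

open Classical in
/-- Euclidean projection onto `S`: a nearest point of `S`
(it exists and is unique for `S` nonempty, closed and convex; the value `x` is a dummy otherwise). -/
def nearestPoint {n : ℕ} (S : Set (Act n)) (x : Act n) : Act n :=
  if h : ∃ p ∈ S, ∀ q ∈ S, dist x p ≤ dist x q then h.choose else x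

/-- The uniform probability distribution on the unit sphere of `ℝ^n` (for `n ≥ 1`). -/
def uniformSphere (n : ℕ) : Measure (Act n) :=
  (((volume : Measure (Act n)).toSphere Set.univ)⁻¹ • (volume : Measure (Act n)).toSphere).map
    Subtype.val

/-- The data of a game with `N` risk-averse agents: agent `i` chooses actions in
`X i ⊆ ℝ^(d i)`, has noise `ξ_i` in `Ξ i` with distribution `law i`, cost `J i x ξ_i`
and risk level `α i`. -/
structure RiskGame (N : ℕ) where
  d : Fin N → ℕ
  X : (i : Fin N) → Set (Act (d i))
  Ξ : Fin N → Type*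
  ms : (i : Fin N) → MeasurableSpace (Ξ i)
  law : (i : Fin N) → Measure (Ξ i)
  J : (i : Fin N) → Profile d → Ξ i → ℝ
  α : Fin N → ℝ

attribute [instance] RiskGame.ms

namespace RiskGame

variable {N : ℕ} (G : RiskGame N)

/-- The joint action space. -/
def joint : Set (Profile G.d) := {x | ∀ i, x i ∈ G.X i}

/-- The distribution function of the cost of agent `i` at the profile `x`. -/
def cdf (i : Fin N) (x : Profile G.d) (y : ℝ) : ℝ :=
  (G.law i).real {ξ | G.J i x ξ ≤ y}

/-- The risk-averse objective `C_i(x) = CVaR_{α_i}[J_i(x, ξ_i)]`. -/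
def C (i : Fin N) (x : Profile G.d) : ℝ := cvar (G.α i) (G.cdf i x)

/-- `S(α) = ∑_i 1 / α_i²`. -/
def S : ℝ := ∑ i, 1 / G.α i ^ 2

/-- Standing conventions: positive dimensions, risk levels in `(0, 1]`, closed convex action sets of
diameter at most `Dx`, random noise, and costs that are random variables. -/
structure Standing (Dx : ℝ) : Prop where
  dim_pos : ∀ i, 0 < G.d i
  level_pos : ∀ i, 0 < G.α i
  level_le_one : ∀ i, G.α i ≤ 1
  convex : ∀ i, Convex ℝ (G.X i)
  closed : ∀ i, IsClosed (G.X i)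
  diam_le : ∀ i, ∀ x ∈ G.X i, ∀ y ∈ G.X i, dist x y ≤ Dx
  law_prob : ∀ i, IsProbabilityMeasure (G.law i)
  measurable_cost : ∀ i, ∀ x ∈ G.joint, Measurable (G.J i x)

/-- Each cost is convex in the agent's own action and bounded by `U`. -/
def ConvexBounded (U : ℝ) : Prop :=
  ∀ i, ∀ ξ : G.Ξ i,
    (∀ x ∈ G.joint, ConvexOn ℝ (G.X i) (fun y => G.J i (replaceAction x i y) ξ)) ∧
    ∀ x ∈ G.joint, |G.J i x ξ| ≤ U

/-- Each cost is `L₀`-Lipschitz in the action profile. -/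
def LipschitzCost (L₀ : ℝ) : Prop :=
  ∀ i, ∀ ξ : G.Ξ i, ∀ x ∈ G.joint, ∀ y ∈ G.joint, |G.J i x ξ - G.J i y ξ| ≤ L₀ * ‖x - y‖

/-- The distribution functions of the costs are `C₀`-Lipschitz in the action profile, uniformly. -/
def LipschitzCDF (C₀ : ℝ) : Prop :=
  ∀ i, ∀ w ∈ G.joint, ∀ v ∈ G.joint, ∀ y : ℝ, |G.cdf i w y - G.cdf i v y| ≤ C₀ * ‖w - v‖

end RiskGame

/-- The number `n_t = ⌈b U² (T - t + 1)^a⌉` of samples in episode `t ∈ {1, …, T}`. -/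
def sampleSize (a b U : ℝ) (T t : ℕ) : ℕ := ⌈b * U ^ 2 * ((T : ℝ) - t + 1) ^ a⌉₊

/-- The parameters of the algorithm: sample sizes `n t`, step sizes `η i` of the agents, size `δ` of
the perturbation, momentum `β`. -/
structure Params (N : ℕ) where
  n : ℕ → ℕ
  η : Fin N → ℝ
  δ : ℝ
  β : ℝ

/-- The parameter choice `n_t = ⌈b U² (T - t + 1)^a⌉`, `η_i = D_x / (d_i L₀ N) T^(-3a/4)`,
`δ = D_x / N^(1/6) T^(-a/4)`, `β = 1 / (U² T^(a/4))`. -/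
def tunedParams {N : ℕ} (d : Fin N → ℕ) (a b U L₀ Dx : ℝ) (T : ℕ) : Params N where
  n := sampleSize a b U T
  η := fun i => Dx / ((d i : ℝ) * L₀ * N) * (T : ℝ) ^ (-(3 * a / 4))
  δ := Dx / (N : ℝ) ^ (1 / 6 : ℝ) * (T : ℝ) ^ (-(a / 4))
  β := 1 / (U ^ 2 * (T : ℝ) ^ (a / 4))

/-- What the agents carry from one episode to the next. After episode `t` these are the actions
`x_{i,t+1}`, the distribution estimates `F̄_{i,t}` and the CVaR estimates `CVaR_{α_i}[F̄_{i,t}]`. -/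
structure AlgState {N : ℕ} (d : Fin N → ℕ) where
  x : Profile d
  Fbar : Fin N → ℝ → ℝ
  est : Fin N → ℝ

namespace RiskGame

variable {N : ℕ} (G : RiskGame N) (p : Params N)

/-- The played profile `x̂ = x + δ u`. -/
def perturb (x : Profile G.d) (u : (i : Fin N) → Act (G.d i)) : Profile G.d :=
  WithLp.toLp 2 (fun i => x i + p.δ • u i)

/-- The empirical distribution function of the costs of agent `i` at the played profile `xhat`
from `n` samples. -/
def edf (i : Fin N) (n : ℕ) (xhat : Profile G.d) (ξ : ℕ → G.Ξ i) (y : ℝ) : ℝ :=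
  (1 / (n : ℝ)) * ∑ j ∈ Finset.range n, Set.indicator {c : ℝ | c ≤ y} 1 (G.J i xhat (ξ j))

/-- The distribution estimate of agent `i` in episode `t`: the empirical distribution function for
`t = 1`, and with the momentum term for `t ≥ 2`. -/
def momentumEdf (t : ℕ) (s : AlgState G.d) (u : (i : Fin N) → Act (G.d i))
    (ξ : (i : Fin N) → ℕ → G.Ξ i) (i : Fin N) (y : ℝ) : ℝ :=
  if t = 1 then G.edf i (p.n t) (G.perturb p s.x u) (ξ i) y
  else p.β * s.Fbar i y + (1 - p.β) * G.edf i (p.n t) (G.perturb p s.x u) (ξ i) y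

/-- The gradient estimate of agent `i` in episode `t`, with residual feedback. -/
def gradEstimate (t : ℕ) (s : AlgState G.d) (u : (i : Fin N) → Act (G.d i))
    (ξ : (i : Fin N) → ℕ → G.Ξ i) (i : Fin N) : Act (G.d i) :=
  ((G.d i : ℝ) / p.δ * (cvar (G.α i) (G.momentumEdf p t s u ξ i) - s.est i)) • u i

/-- Episode `t` of the algorithm, with directions `u i` and samples `ξ i j`. -/
def episode (t : ℕ) (s : AlgState G.d) (u : (i : Fin N) → Act (G.d i))
    (ξ : (i : Fin N) → ℕ → G.Ξ i) : AlgState G.d where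
  x := WithLp.toLp 2 (fun i =>
    nearestPoint (shrink (G.X i) p.δ) (s.x i - p.η i • G.gradEstimate p t s u ξ i))
  Fbar := G.momentumEdf p t s u ξ
  est := fun i => cvar (G.α i) (G.momentumEdf p t s u ξ i)

/-- The state after `t` episodes, from the initial actions `x₁` and the values `v₀ i` that stand for
`CVaR_{α_i}[F̄_{i,0}]`. The directions and samples of episode `t` are `u i t` and
`ξ i t 0, ξ i t 1, …`. The initial `Fbar` is a dummy: episode `1` does not use it. -/
def state (x₁ : Profile G.d) (v₀ : Fin N → ℝ) (u : (i : Fin N) → ℕ → Act (G.d i))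
    (ξ : (i : Fin N) → ℕ → ℕ → G.Ξ i) : ℕ → AlgState G.d
  | 0 => ⟨x₁, fun _ _ => 0, v₀⟩
  | t + 1 => G.episode p (t + 1) (state x₁ v₀ u ξ t) (fun i => u i (t + 1)) (fun i => ξ i (t + 1))

/-- The profile `x̂_t` played in episode `t ≥ 1`. -/
def played (x₁ : Profile G.d) (v₀ : Fin N → ℝ) (u : (i : Fin N) → ℕ → Act (G.d i))
    (ξ : (i : Fin N) → ℕ → ℕ → G.Ξ i) (t : ℕ) : Profile G.d :=
  G.perturb p (G.state p x₁ v₀ u ξ (t - 1)).x (fun i => u i t)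

/-- The regret of agent `i` over episodes `1, …, T` for the sequence `xhat` of played profiles. -/
def regret (i : Fin N) (T : ℕ) (xhat : ℕ → Profile G.d) : ℝ :=
  ∑ t ∈ Finset.Icc 1 T, G.C i (xhat t) -
    ⨅ y : G.X i, ∑ t ∈ Finset.Icc 1 T, G.C i (replaceAction (xhat t) i y)

/-- The randomness of the algorithm: the directions `u i t` are independent and uniform on the unit
spheres, the samples `ξ i t j` have the distribution of `ξ_i`, the noise vectors
`(ξ i t j)_i` are independent over `(t, j)` (the agents' components of one vector may be
dependent), and directions and samples are independent of each other. -/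
structure IsSampling {Ω : Type*} [MeasurableSpace Ω] (μ : Measure Ω)
    (u : (i : Fin N) → ℕ → Ω → Act (G.d i)) (ξ : (i : Fin N) → ℕ → ℕ → Ω → G.Ξ i) : Prop where
  measurable_dir : ∀ i t, Measurable (u i t)
  measurable_noise : ∀ i t j, Measurable (ξ i t j)
  law_dir : ∀ i t, μ.map (u i t) = uniformSphere (G.d i)
  law_noise : ∀ i t j, μ.map (ξ i t j) = G.law i
  indep_dir : iIndepFun (fun (k : Fin N × ℕ) ω => u k.1 k.2 ω) μ
  indep_noise : iIndepFun (fun (q : ℕ × ℕ) ω => (fun i => ξ i q.1 q.2 ω)) μ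
  indep_dir_noise : IndepFun (fun ω => (fun (k : Fin N × ℕ) => u k.1 k.2 ω))
    (fun ω => (fun (q : ℕ × ℕ) (i : Fin N) => ξ i q.1 q.2 ω)) μ

end RiskGame

end

/-! The conditional value at risk of a bounded cost inherits what is needed from the cost: `C_i` is
bounded by `U`, `L₀`-Lipschitz, and convex in agent `i`'s own action. As a functional of the
distribution function it is `1/α_i`-Lipschitz for the `L¹` distance
(`IsCostCDF.abs_cvar_sub_cvar_le`). So each agent runs projected online gradient descent on convex
Lipschitz losses, using loss values whose error is governed by the `L¹` error of the distribution
estimate.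

Fix an agent `i` and an episode. Let `q` be the profile in which the others play their perturbed
actions and agent `i` its unperturbed `x`. The spherical mean `g = (d/δ) E[C_i(x + δb, q_{-i}) b]`
is a subgradient up to `2 L₀ δ` (`sub_le_integral_uniformSphere`); this is integration by parts for
a Lipschitz convex function. Write `g` as the gradient estimate used by the algorithm, plus a noise,
plus `(d/δ)(C_i(x̂_t) - c_{i,t}) u_{i,t}`. The noise has conditional mean zero because the residual
`c_{i,t-1}` is determined before `u_{i,t}` is drawn and `u_{i,t}` is centred. Pairing with `x - y`
gives three sums.

Gradient estimates: the usual descent bound `D²/(2η) + η T B²/2`.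

Noise: the best comparator `y` depends on the whole run, so `⟨noise, x - y⟩` is not a martingale
increment. A ghost descent `z` driven by the noise itself splits it into `⟨noise, z - y⟩`, which the
descent bound controls for all `y` at once, and `⟨noise, x - z⟩`, a martingale increment free of
`y`, which Azuma controls.

Estimation error: the `L¹` tracking error contracts by `β`, drifts by `β` times the change of the
true distribution (assumption on `C₀`), and gains the fresh sampling error
(`RiskGame.sum_trackingError_le`). The sampling error has conditional mean at most `2U/√n_t`, and
Azuma again controls the centred sum.

Up to factors in `N`, `d_i` and constants, the terms are `T^(3a/4)` and `T^(1-a/4)` from descent,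
`T^(1/2+a/4)` from both Azuma bounds, `T^(a/4) T^(1-a/2)` from sampling, `T β` from drift (its `δ`
cancels), and `T δ` from smoothing. All are at most `T^(1-a/4)` since `a < 1`. If `β > 1/2` or `δ ρ
> D_x`, then `T^(a/4)` is bounded by a constant and the trivial bound `2 U T` suffices. -/

noncomputable section

/-! ### CVaR as a functional of the distribution function -/

/-- `F` has the properties of a distribution function of a cost in `[-U, U]` that the estimates for
the conditional value at risk use; monotonicity is not among them. -/
structure IsCostCDF (U : ℝ) (F : ℝ → ℝ) : Prop where
  measurable : Measurable F
  nonneg : ∀ y, 0 ≤ F y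
  le_one : ∀ y, F y ≤ 1
  eq_zero : ∀ y, y < -U → F y = 0
  eq_one : ∀ y, U ≤ y → F y = 1

namespace IsCostCDF

variable {U α : ℝ} {F F' : ℝ → ℝ}

lemma integrableOn_one_sub (hF : IsCostCDF U F) (z : ℝ) :
    IntegrableOn (fun y => 1 - F y) (Set.Ioi z) := by
  have hi : IntegrableOn ((Set.Iic U).indicator fun _ => (1 : ℝ)) (Set.Ioi z) := by
    rw [IntegrableOn, integrable_indicator_iff measurableSet_Iic, IntegrableOn,
      Measure.restrict_restrict measurableSet_Iic]
    refine integrable_const_iff.2 (.inr ⟨?_⟩)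
    rw [Measure.restrict_apply_univ, Set.inter_comm, Set.Ioi_inter_Iic]
    exact measure_Ioc_lt_top
  refine hi.mono' (measurable_const.sub hF.measurable).aestronglyMeasurable
    (.of_forall fun y => ?_)
  by_cases hy : y ≤ U
  · rw [Set.indicator_of_mem (by exact hy), Real.norm_eq_abs, abs_le]
    constructor <;> linarith [hF.nonneg y, hF.le_one y]
  · rw [Set.indicator_of_notMem (by exact hy), hF.eq_one y (not_le.1 hy).le]; simp

lemma integral_one_sub_nonneg (hF : IsCostCDF U F) (z : ℝ) :
    0 ≤ ∫ y in Set.Ioi z, (1 - F y) :=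
  integral_nonneg fun y => sub_nonneg.2 (hF.le_one y)

lemma integrable_sub (hF : IsCostCDF U F) (hF' : IsCostCDF U F') :
    Integrable fun y => F y - F' y := by
  have hi : Integrable ((Set.Icc (-U) U).indicator fun _ => (1 : ℝ)) :=
    (integrable_indicator_iff measurableSet_Icc).2 (integrableOn_const measure_Icc_lt_top.ne)
  refine hi.mono' (hF.measurable.sub hF'.measurable).aestronglyMeasurable
    (.of_forall fun y => ?_)
  by_cases hy : y ∈ Set.Icc (-U) U
  · rw [Set.indicator_of_mem hy, Real.norm_eq_abs, abs_le]
    constructor <;> linarith [hF.nonneg y, hF.le_one y, hF'.nonneg y, hF'.le_one y]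
  · rw [Set.indicator_of_notMem hy]
    rcases lt_or_ge y (-U) with h | h
    · simp [hF.eq_zero y h, hF'.eq_zero y h]
    · have : U ≤ y := (not_le.1 fun h' => hy ⟨h, h'⟩).le
      simp [hF.eq_one y this, hF'.eq_one y this]

lemma integral_abs_sub_le (hU : 0 ≤ U) (hF : IsCostCDF U F) (hF' : IsCostCDF U F') {c : ℝ}
    (hc : ∀ y, |F y - F' y| ≤ c) : ∫ y, |F y - F' y| ≤ 2 * U * c := by
  have h1 : ∫ y, |F y - F' y| ≤ ∫ y, (Set.Icc (-U) U).indicator (fun _ => c) y := by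
    refine integral_mono (hF.integrable_sub hF').abs ((integrable_indicator_iff
      measurableSet_Icc).2 (integrableOn_const measure_Icc_lt_top.ne)) fun y => ?_
    by_cases hy : y ∈ Set.Icc (-U) U
    · rw [Set.indicator_of_mem hy]; exact hc y
    · rw [Set.indicator_of_notMem hy]
      rcases lt_or_ge y (-U) with h | h
      · simp [hF.eq_zero y h, hF'.eq_zero y h]
      · have : U ≤ y := (not_le.1 fun h' => hy ⟨h, h'⟩).le
        simp [hF.eq_one y this, hF'.eq_one y this]
  refine h1.trans_eq ?_
  rw [integral_indicator measurableSet_Icc, setIntegral_const, Real.volume_real_Icc, smul_eq_mul,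
    max_eq_left (by linarith)]
  ring

lemma abs_sub_le_one (hF : IsCostCDF U F) (hF' : IsCostCDF U F') (y : ℝ) :
    |F y - F' y| ≤ 1 := by
  rw [abs_le]
  constructor <;> linarith [hF.nonneg y, hF.le_one y, hF'.nonneg y, hF'.le_one y]

lemma combination (hF : IsCostCDF U F) (hF' : IsCostCDF U F') {β : ℝ} (h0 : 0 ≤ β) (h1 : β ≤ 1) :
    IsCostCDF U fun y => β * F y + (1 - β) * F' y where
  measurable := (hF.measurable.const_mul _).add (hF'.measurable.const_mul _)
  nonneg y := add_nonneg (mul_nonneg h0 (hF.nonneg y)) (mul_nonneg (by linarith) (hF'.nonneg y))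
  le_one y := by
    have := mul_le_mul_of_nonneg_left (hF.le_one y) h0
    have := mul_le_mul_of_nonneg_left (hF'.le_one y) (sub_nonneg.2 h1)
    linarith
  eq_zero y hy := by rw [hF.eq_zero y hy, hF'.eq_zero y hy]; ring
  eq_one y hy := by rw [hF.eq_one y hy, hF'.eq_one y hy]; ring

/-- For `z < -U` the integrand is `1` up to `-U`, and since `α⁻¹ ≥ 1` the integral gains at least
what `z` loses. -/
lemma neg_le_cvar_objective (hF : IsCostCDF U F) (h0 : 0 < α) (h1 : α ≤ 1) (z : ℝ) :
    -U ≤ z + α⁻¹ * ∫ y in Set.Ioi z, (1 - F y) := by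
  have hα : 1 ≤ α⁻¹ := (one_le_inv₀ h0).2 h1
  have hn := hF.integral_one_sub_nonneg z
  rcases le_or_gt (-U) z with h | h
  · have := mul_nonneg (inv_nonneg.2 h0.le) hn
    linarith
  · have h2 : -U - z ≤ ∫ y in Set.Ioi z, (1 - F y) := by
      have : ∫ y in Set.Ioo z (-U), (1 - F y) ≤ ∫ y in Set.Ioi z, (1 - F y) :=
        setIntegral_mono_set (hF.integrableOn_one_sub z)
          (.of_forall fun y => sub_nonneg.2 (hF.le_one y)) Set.Ioo_subset_Ioi_self.eventuallyLE
      refine le_trans (le_of_eq ?_) this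
      rw [setIntegral_congr_fun measurableSet_Ioo (g := fun _ => (1 : ℝ))
        fun y hy => by simp [hF.eq_zero y hy.2]]
      rw [setIntegral_const, Real.volume_real_Ioo, smul_eq_mul, mul_one, max_eq_left (by linarith)]
    nlinarith

lemma bddBelow_cvar (hF : IsCostCDF U F) (h0 : 0 < α) (h1 : α ≤ 1) :
    BddBelow (Set.range fun z : ℝ => z + α⁻¹ * ∫ y in Set.Ioi z, (1 - F y)) :=
  ⟨-U, by rintro _ ⟨z, rfl⟩; exact hF.neg_le_cvar_objective h0 h1 z⟩

lemma abs_cvar_le (hF : IsCostCDF U F) (h0 : 0 < α) (h1 : α ≤ 1) : |cvar α F| ≤ U := by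
  rw [abs_le]
  -- The upper bound is the objective at `z = U`, where the tail integral vanishes.
  refine ⟨le_ciInf fun z => hF.neg_le_cvar_objective h0 h1 z,
    (ciInf_le (hF.bddBelow_cvar h0 h1) U).trans_eq ?_⟩
  rw [setIntegral_congr_fun measurableSet_Ioi (g := fun _ => (0 : ℝ))
    fun y hy => by simp [hF.eq_one y (le_of_lt hy)]]
  simp

/-- For each fixed `z` the two objectives differ by at most `α⁻¹` times the `L¹` distance, and a
bound uniform in `z` passes to the infima. -/
lemma cvar_le_cvar_add (hF : IsCostCDF U F) (hF' : IsCostCDF U F') (h0 : 0 < α) (h1 : α ≤ 1) :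
    cvar α F ≤ cvar α F' + α⁻¹ * ∫ y, |F y - F' y| := by
  rw [← sub_le_iff_le_add]
  refine le_ciInf fun z => ?_
  rw [sub_le_iff_le_add]
  refine (ciInf_le (hF.bddBelow_cvar h0 h1) z).trans ?_
  have h2 : ∫ y in Set.Ioi z, (1 - F y) ≤
      (∫ y in Set.Ioi z, (1 - F' y)) + ∫ y, |F y - F' y| := by
    rw [← sub_le_iff_le_add', ← integral_sub (hF.integrableOn_one_sub z)
      (hF'.integrableOn_one_sub z)]
    refine le_trans ?_ (setIntegral_le_integral (s := Set.Ioi z) (hF.integrable_sub hF').abs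
      (.of_forall fun y => abs_nonneg _))
    refine integral_mono ((hF.integrableOn_one_sub z).sub (hF'.integrableOn_one_sub z))
      (hF.integrable_sub hF').abs.integrableOn fun y => ?_
    have := neg_abs_le (F y - F' y)
    simp only [sub_sub_sub_cancel_left]
    linarith
  have := mul_le_mul_of_nonneg_left h2 (inv_nonneg.2 h0.le)
  linarith

lemma abs_cvar_sub_cvar_le (hF : IsCostCDF U F) (hF' : IsCostCDF U F') (h0 : 0 < α)
    (h1 : α ≤ 1) : |cvar α F - cvar α F'| ≤ α⁻¹ * ∫ y, |F y - F' y| := by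
  have a1 := hF.cvar_le_cvar_add hF' h0 h1
  have a2 := hF'.cvar_le_cvar_add hF h0 h1
  simp_rw [abs_sub_comm (F' _) (F _)] at a2
  rw [abs_le]
  constructor <;> linarith

end IsCostCDF

/-! ### CVaR of a random cost: monotonicity, translation, convexity -/

section Expectation

variable {Ξ : Type*} [MeasurableSpace Ξ] {P : Measure Ξ} [IsProbabilityMeasure P] {U : ℝ}
  {Z Z' : Ξ → ℝ}

lemma isCostCDF_measureReal (hU : ∀ ξ, |Z ξ| ≤ U) :
    IsCostCDF U fun y => P.real {ξ | Z ξ ≤ y} where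
  measurable := by
    refine Monotone.measurable fun a b hab => measureReal_mono fun ξ hξ => ?_
    exact le_trans hξ hab
  nonneg y := measureReal_nonneg
  le_one y := measureReal_le_one
  eq_zero y hy := by
    have : {ξ | Z ξ ≤ y} = ∅ := by
      ext ξ
      simp only [Set.mem_ofPred_eq, Set.mem_empty_iff_false, iff_false, not_le]
      linarith [(abs_le.1 (hU ξ)).1]
    rw [this]; simp
  eq_one y hy := by
    have : {ξ | Z ξ ≤ y} = Set.univ := by
      ext ξ
      simp only [Set.mem_ofPred_eq, Set.mem_univ, iff_true]
      linarith [(abs_le.1 (hU ξ)).2]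
    rw [this]; simp

lemma integrable_posPart_sub (hZ : Measurable Z) (hU : ∀ ξ, |Z ξ| ≤ U) (z : ℝ) :
    Integrable (fun ξ => max (Z ξ - z) 0) P := by
  refine Integrable.of_bound (by fun_prop) (U + |z|) (.of_forall fun ξ => ?_)
  have h1 := abs_le.1 (hU ξ)
  have h2 := neg_abs_le z
  have h3 := (abs_nonneg _).trans (hU ξ)
  rw [Real.norm_of_nonneg (le_max_right _ _)]
  exact max_le (by linarith) (by positivity)

/-- Layer-cake formula for the positive part, after translating the half-line by `z`. It turns the
objective into an expectation, where pointwise inequalities between costs apply. -/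
lemma integral_one_sub_cdf (hZ : Measurable Z) (hU : ∀ ξ, |Z ξ| ≤ U) (z : ℝ) :
    ∫ y in Set.Ioi z, (1 - P.real {ξ | Z ξ ≤ y}) = ∫ ξ, max (Z ξ - z) 0 ∂P := by
  rw [(integrable_posPart_sub hZ hU z).integral_eq_integral_meas_lt
    (.of_forall fun ξ => le_max_right _ _)]
  have h1 := (measurePreserving_add_right volume z).setIntegral_preimage_emb
    (measurableEmbedding_addRight z) (fun y => 1 - P.real {ξ | Z ξ ≤ y}) (Set.Ioi z)
  rw [Set.preimage_add_const_Ioi, sub_self] at h1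
  rw [← h1]
  refine setIntegral_congr_fun measurableSet_Ioi fun s hs => ?_
  have hs : 0 < s := hs
  have : {ξ | s < max (Z ξ - z) 0} = {ξ | Z ξ ≤ s + z}ᶜ := by
    ext ξ
    simp only [Set.mem_ofPred_eq, Set.mem_compl_iff, not_le, lt_max_iff]
    constructor
    · rintro (h | h) <;> linarith
    · intro h; left; linarith
  simp only [this]
  rw [probReal_compl_eq_one_sub (measurableSet_le hZ measurable_const)]

lemma cvar_cdf_le (hZ : Measurable Z) (hU : ∀ ξ, |Z ξ| ≤ U) {α : ℝ} (h0 : 0 < α) (h1 : α ≤ 1)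
    (z : ℝ) :
    cvar α (fun y => P.real {ξ | Z ξ ≤ y}) ≤ z + α⁻¹ * ∫ ξ, max (Z ξ - z) 0 ∂P := by
  rw [← integral_one_sub_cdf hZ hU]
  exact ciInf_le ((isCostCDF_measureReal hU).bddBelow_cvar h0 h1) z

/-- Shifting the auxiliary variable by `c` absorbs the difference of the costs. With `c = L₀ ‖x -
y‖` this makes `C_i` Lipschitz with constant `L₀`, without a factor `1/α`. -/
lemma cvar_cdf_le_add (hZ : Measurable Z) (hU : ∀ ξ, |Z ξ| ≤ U) (hZ' : Measurable Z')
    (hU' : ∀ ξ, |Z' ξ| ≤ U) {α : ℝ} (h0 : 0 < α) (h1 : α ≤ 1) {c : ℝ}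
    (hc : ∀ ξ, Z ξ ≤ Z' ξ + c) :
    cvar α (fun y => P.real {ξ | Z ξ ≤ y}) ≤ cvar α (fun y => P.real {ξ | Z' ξ ≤ y}) + c := by
  rw [← sub_le_iff_le_add]
  refine le_ciInf fun z => ?_
  rw [sub_le_iff_le_add, integral_one_sub_cdf hZ' hU']
  refine (cvar_cdf_le hZ hU h0 h1 (z + c)).trans ?_
  have : ∫ ξ, max (Z ξ - (z + c)) 0 ∂P ≤ ∫ ξ, max (Z' ξ - z) 0 ∂P :=
    integral_mono (integrable_posPart_sub hZ hU _) (integrable_posPart_sub hZ' hU' _)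
      fun ξ => max_le_max (by linarith [hc ξ]) le_rfl
  have := mul_le_mul_of_nonneg_left this (inv_nonneg.2 h0.le)
  linarith

/-- The objective is jointly convex in the cost and in `z`, and partial minimisation keeps
convexity: the point `p * z₁ + q * z₂` is tested on the left. -/
lemma cvar_cdf_le_combination {Z₁ Z₂ : Ξ → ℝ} (hZ : Measurable Z) (hU : ∀ ξ, |Z ξ| ≤ U)
    (hZ₁ : Measurable Z₁) (hU₁ : ∀ ξ, |Z₁ ξ| ≤ U) (hZ₂ : Measurable Z₂) (hU₂ : ∀ ξ, |Z₂ ξ| ≤ U)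
    {α : ℝ} (h0 : 0 < α) (h1 : α ≤ 1) {p q : ℝ} (hp : 0 ≤ p) (hq : 0 ≤ q)
    (hc : ∀ ξ, Z ξ ≤ p * Z₁ ξ + q * Z₂ ξ) :
    cvar α (fun y => P.real {ξ | Z ξ ≤ y}) ≤ p * cvar α (fun y => P.real {ξ | Z₁ ξ ≤ y}) +
      q * cvar α (fun y => P.real {ξ | Z₂ ξ ≤ y}) := by
  have key : ∀ z₁ z₂ : ℝ, cvar α (fun y => P.real {ξ | Z ξ ≤ y}) ≤
      p * (z₁ + α⁻¹ * ∫ y in Set.Ioi z₁, (1 - P.real {ξ | Z₁ ξ ≤ y})) +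
      q * (z₂ + α⁻¹ * ∫ y in Set.Ioi z₂, (1 - P.real {ξ | Z₂ ξ ≤ y})) := by
    intro z₁ z₂
    rw [integral_one_sub_cdf hZ₁ hU₁, integral_one_sub_cdf hZ₂ hU₂]
    refine (cvar_cdf_le hZ hU h0 h1 (p * z₁ + q * z₂)).trans ?_
    have i1 := (integrable_posPart_sub (P := P) hZ₁ hU₁ z₁).const_mul p
    have i2 := (integrable_posPart_sub (P := P) hZ₂ hU₂ z₂).const_mul q
    have : ∫ ξ, max (Z ξ - (p * z₁ + q * z₂)) 0 ∂P ≤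
        p * (∫ ξ, max (Z₁ ξ - z₁) 0 ∂P) + q * ∫ ξ, max (Z₂ ξ - z₂) 0 ∂P := by
      rw [← integral_const_mul, ← integral_const_mul, ← integral_add i1 i2]
      refine integral_mono (integrable_posPart_sub hZ hU _) (i1.add i2) fun ξ => ?_
      have a1 := mul_le_mul_of_nonneg_left (le_max_left (Z₁ ξ - z₁) 0) hp
      have a2 := mul_le_mul_of_nonneg_left (le_max_left (Z₂ ξ - z₂) 0) hq
      have a3 := mul_nonneg hp (le_max_right (Z₁ ξ - z₁) 0)
      have a4 := mul_nonneg hq (le_max_right (Z₂ ξ - z₂) 0)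
      refine max_le ?_ (add_nonneg a3 a4)
      linarith [hc ξ]
    have := mul_le_mul_of_nonneg_left this (inv_nonneg.2 h0.le)
    linarith
  set V := cvar α (fun y => P.real {ξ | Z ξ ≤ y})
  -- A bound valid for every `z` passes to the infimum; this is used for `z₁` and then for `z₂`.
  have step : ∀ {r c V : ℝ} {g : ℝ → ℝ}, 0 ≤ r → (∀ z, V ≤ r * g z + c) →
      V ≤ r * (⨅ z, g z) + c := by
    intro r c V g hr h
    rw [Real.mul_iInf_of_nonneg hr, ← sub_le_iff_le_add]
    exact le_ciInf fun z => by linarith [h z]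
  refine step hp fun z₁ => ?_
  rw [add_comm]
  refine step hq fun z₂ => ?_
  rw [add_comm]
  exact key z₁ z₂

end Expectation

/-! ### Regularity of the risk-averse objectives -/

namespace RiskGame

variable {N : ℕ} {G : RiskGame N} {Dx U L₀ : ℝ}

@[simp] lemma replaceAction_same {d : Fin N → ℕ} (x : Profile d) (i : Fin N) (y : Act (d i)) :
    replaceAction x i y i = y := by
  simp [replaceAction]

lemma replaceAction_of_ne {d : Fin N → ℕ} (x : Profile d) {i k : Fin N} (h : k ≠ i)
    (y : Act (d i)) : replaceAction x i y k = x k := by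
  simp [replaceAction, h]

lemma replaceAction_self {d : Fin N → ℕ} (x : Profile d) (i : Fin N) :
    replaceAction x i (x i) = x := by
  ext k : 1
  by_cases h : k = i
  · subst h; simp
  · rw [replaceAction_of_ne _ h]

lemma norm_replaceAction_sub {d : Fin N → ℕ} (x : Profile d) (i : Fin N) (y y' : Act (d i)) :
    ‖replaceAction x i y - replaceAction x i y'‖ = ‖y - y'‖ := by
  have h : replaceAction x i y - replaceAction x i y' =
      PiLp.single 2 (β := fun k => Act (d k)) i (y - y') := by
    ext k : 1
    by_cases h : k = i
    · subst h; simp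
    · simp [replaceAction_of_ne, h]
  rw [h, PiLp.norm_single]

lemma replaceAction_mem_joint {x : Profile G.d} (hx : x ∈ G.joint) {i : Fin N} {y : Act (G.d i)}
    (hy : y ∈ G.X i) : replaceAction x i y ∈ G.joint := by
  intro k
  by_cases h : k = i
  · subst h; simpa using hy
  · rw [replaceAction_of_ne _ h]; exact hx k

lemma isCostCDF_cdf (hS : G.Standing Dx) (hJ : G.ConvexBounded U) (i : Fin N) {x : Profile G.d}
    (hx : x ∈ G.joint) : IsCostCDF U (G.cdf i x) := by
  have := hS.law_prob i
  exact isCostCDF_measureReal fun ξ => (hJ i ξ).2 x hx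

lemma abs_C_le (hS : G.Standing Dx) (hJ : G.ConvexBounded U) (i : Fin N) {x : Profile G.d}
    (hx : x ∈ G.joint) : |G.C i x| ≤ U :=
  (isCostCDF_cdf hS hJ i hx).abs_cvar_le (hS.level_pos i) (hS.level_le_one i)

lemma abs_C_sub_C_le (hS : G.Standing Dx) (hJ : G.ConvexBounded U) (hL : G.LipschitzCost L₀)
    (i : Fin N) {x y : Profile G.d} (hx : x ∈ G.joint) (hy : y ∈ G.joint) :
    |G.C i x - G.C i y| ≤ L₀ * ‖x - y‖ := by
  have := hS.law_prob i
  have key : ∀ {x y : Profile G.d}, x ∈ G.joint → y ∈ G.joint →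
      G.C i x ≤ G.C i y + L₀ * ‖x - y‖ := fun {x y} hx hy =>
    cvar_cdf_le_add (hS.measurable_cost i x hx) (fun ξ => (hJ i ξ).2 x hx)
      (hS.measurable_cost i y hy) (fun ξ => (hJ i ξ).2 y hy) (hS.level_pos i) (hS.level_le_one i)
      fun ξ => by linarith [(abs_le.1 (hL i ξ x hx y hy)).2]
  have h1 := key hx hy
  have h2 := key hy hx
  rw [norm_sub_rev] at h2
  rw [abs_le]
  constructor <;> linarith

lemma convexOn_C (hS : G.Standing Dx) (hJ : G.ConvexBounded U) (i : Fin N) {x : Profile G.d}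
    (hx : x ∈ G.joint) : ConvexOn ℝ (G.X i) fun y => G.C i (replaceAction x i y) := by
  have := hS.law_prob i
  refine ⟨hS.convex i, fun y₁ h₁ y₂ h₂ p q hp hq hpq => ?_⟩
  have hy := hS.convex i h₁ h₂ hp hq hpq
  have m := fun {y} (hy : y ∈ G.X i) => hS.measurable_cost i _ (replaceAction_mem_joint hx hy)
  have b := fun {y} (hy : y ∈ G.X i) => fun ξ => (hJ i ξ).2 _ (replaceAction_mem_joint hx hy)
  exact cvar_cdf_le_combination (m hy) (b hy) (m h₁) (b h₁) (m h₂) (b h₂) (hS.level_pos i)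
    (hS.level_le_one i) hp hq fun ξ => ((hJ i ξ).1 x hx).2 h₁ h₂ hp hq hpq

end RiskGame

/-! ### Shrunken action sets, projection, projected gradient descent -/

section Projection

open Metric
open scoped Pointwise

variable {n : ℕ} {X S : Set (Act n)} {δ : ℝ}

/-- The segment from `x` to a point `y` outside `X` would meet the frontier, by connectedness. The
meeting point has distance at least `δ ≥ dist x y` from `x`, so it is `y` itself, which lies in the
closed set `X`. -/
lemma closedBall_subset_of_mem_shrink (hX : IsClosed X) {x : Act n}
    (hx : x ∈ shrink X δ) : closedBall x δ ⊆ X := by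
  intro y hy
  by_contra hyX
  obtain ⟨p, hp, hpX⟩ : (segment ℝ x y ∩ frontier X).Nonempty := by
    by_contra hne
    have h_int : ∀ z ∈ segment ℝ x y, z ∈ X → z ∈ interior X := fun z hz hzX => by
      by_contra h
      exact hne ⟨z, hz, subset_closure hzX, h⟩
    obtain ⟨z, -, hz1, hz2⟩ := (convex_segment x y).isPreconnected _ _ isOpen_interior
      hX.isOpen_compl (fun z hz => (em (z ∈ X)).imp (h_int z hz) id)
      ⟨x, left_mem_segment ℝ x y, h_int x (left_mem_segment ℝ x y) hx.1⟩
      ⟨y, right_mem_segment ℝ x y, hyX⟩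
    exact hz2 (interior_subset hz1)
  have h1 : δ ≤ dist x p := hx.2.trans (infDist_le_dist_of_mem hpX)
  have h2 : dist x p + dist p y = dist x y := dist_add_dist_of_mem_segment hp
  rw [mem_closedBall, dist_comm] at hy
  have h3 : dist p y = 0 := le_antisymm (by linarith) dist_nonneg
  rw [dist_eq_zero] at h3
  exact hyX (h3 ▸ hX.frontier_subset hpX)

/-- `Metric.infDist` to the empty set is `0`, so one point of the shrunken set excludes the
degenerate case that would spoil the converse inclusion below. -/
lemma frontier_nonempty_of_mem_shrink (hδ : 0 < δ) {x : Act n} (hx : x ∈ shrink X δ) :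
    (frontier X).Nonempty := by
  by_contra h
  rw [Set.not_nonempty_iff_eq_empty] at h
  have := hx.2
  rw [h, infDist_empty] at this
  linarith

lemma mem_shrink_of_closedBall_subset (hδ : 0 < δ) (hne : (frontier X).Nonempty) {x : Act n}
    (hx : closedBall x δ ⊆ X) : x ∈ shrink X δ := by
  refine ⟨hx (mem_closedBall_self hδ.le), (le_infDist hne).2 fun p hp => ?_⟩
  by_contra h
  refine hp.2 (mem_interior.2 ⟨ball x δ, ball_subset_closedBall.trans hx, isOpen_ball, ?_⟩)
  rw [mem_ball, dist_comm]
  exact not_le.1 h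

/-- A Minkowski combination of balls is the ball with the combined centre and radius. Equal radii
give convexity of the shrunken set; radii `0` and `Dx / ρ` give the approximation of an arbitrary
action from inside it. -/
lemma closedBall_combination_subset (hX : Convex ℝ X) {x y : Act n} {r s p q : ℝ} (hr : 0 ≤ r)
    (hs : 0 ≤ s) (hx : closedBall x r ⊆ X) (hy : closedBall y s ⊆ X) (hp : 0 ≤ p) (hq : 0 ≤ q)
    (hpq : p + q = 1) : closedBall (p • x + q • y) (p * r + q * s) ⊆ X := by
  have h : closedBall (p • x + q • y) (p * r + q * s) =
      p • closedBall x r + q • closedBall y s := by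
    rw [smul_closedBall p x hr, smul_closedBall q y hs, closedBall_add_closedBall (by positivity)
      (by positivity), Real.norm_of_nonneg hp, Real.norm_of_nonneg hq]
  rw [h]
  rintro _ ⟨_, ⟨a, ha, rfl⟩, _, ⟨b, hb, rfl⟩, rfl⟩
  exact hX (hx ha) (hy hb) hp hq hpq

lemma convex_shrink (hX : Convex ℝ X) (hc : IsClosed X) (hδ : 0 < δ) :
    Convex ℝ (shrink X δ) := by
  intro x hx y hy p q hp hq hpq
  refine mem_shrink_of_closedBall_subset hδ (frontier_nonempty_of_mem_shrink hδ hx) ?_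
  have := closedBall_combination_subset hX hδ.le hδ.le (closedBall_subset_of_mem_shrink hc hx)
    (closedBall_subset_of_mem_shrink hc hy) hp hq hpq
  rwa [← add_mul, hpq, one_mul] at this

lemma isClosed_shrink (hc : IsClosed X) : IsClosed (shrink X δ) :=
  hc.inter (isClosed_le continuous_const (continuous_infDist_pt _))

lemma nearestPoint_spec (hne : S.Nonempty) (hc : IsClosed S) (x : Act n) :
    nearestPoint S x ∈ S ∧ ∀ q ∈ S, dist x (nearestPoint S x) ≤ dist x q := by
  have h : ∃ p ∈ S, ∀ q ∈ S, dist x p ≤ dist x q := by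
    obtain ⟨p, hp, h⟩ := hc.exists_infDist_eq_dist hne x
    exact ⟨p, hp, fun q hq => h ▸ infDist_le_dist_of_mem hq⟩
  rw [nearestPoint, dif_pos h]
  exact h.choose_spec

lemma inner_sub_nearestPoint_le (hne : S.Nonempty) (hc : IsClosed S) (hS : Convex ℝ S)
    (x : Act n) {q : Act n} (hq : q ∈ S) :
    inner ℝ (x - nearestPoint S x) (q - nearestPoint S x) ≤ 0 := by
  obtain ⟨h1, h2⟩ := nearestPoint_spec hne hc x
  refine (norm_eq_iInf_iff_real_inner_le_zero hS h1).1 ?_ q hq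
  have : Nonempty S := ⟨⟨_, h1⟩⟩
  refine le_antisymm (le_ciInf fun w => ?_) (ciInf_le ⟨0, ?_⟩ (⟨_, h1⟩ : S))
  · simpa [dist_eq_norm] using h2 w w.2
  · rintro _ ⟨w, rfl⟩; exact norm_nonneg _

lemma norm_nearestPoint_sub_nearestPoint_le (hne : S.Nonempty) (hc : IsClosed S)
    (hS : Convex ℝ S) (x y : Act n) :
    ‖nearestPoint S x - nearestPoint S y‖ ≤ ‖x - y‖ := by
  set p := nearestPoint S x
  set q := nearestPoint S y
  have h1 := inner_sub_nearestPoint_le hne hc hS x (nearestPoint_spec hne hc y).1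
  have h2 := inner_sub_nearestPoint_le hne hc hS y (nearestPoint_spec hne hc x).1
  have h3 : ‖p - q‖ * ‖p - q‖ ≤ ‖x - y‖ * ‖p - q‖ := by
    rw [← real_inner_self_eq_norm_mul_norm]
    refine le_trans ?_ (real_inner_le_norm (x - y) (p - q))
    have e : inner ℝ (x - y) (p - q) - inner ℝ (p - q) (p - q) =
        - (inner ℝ (x - p) (q - p) + inner ℝ (y - q) (p - q)) := by
      simp only [inner_sub_left, inner_sub_right]; ring
    have : inner ℝ (x - p) (q - p) ≤ 0 := h1
    have : inner ℝ (y - q) (p - q) ≤ 0 := h2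
    linarith
  rcases (norm_nonneg (p - q)).eq_or_lt with h | h
  · rw [← h]; exact norm_nonneg _
  · exact le_of_mul_le_mul_right h3 h

lemma nearestPoint_eq_self (hne : S.Nonempty) (hc : IsClosed S) {x : Act n} (hx : x ∈ S) :
    nearestPoint S x = x := by
  have := (nearestPoint_spec hne hc x).2 x hx
  rw [dist_self] at this
  exact (dist_le_zero.1 this).symm

lemma norm_nearestPoint_sub_le (hne : S.Nonempty) (hc : IsClosed S) (hS : Convex ℝ S)
    (x : Act n) {q : Act n} (hq : q ∈ S) : ‖nearestPoint S x - q‖ ≤ ‖x - q‖ := by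
  have := norm_nearestPoint_sub_nearestPoint_le hne hc hS x q
  rwa [nearestPoint_eq_self hne hc hq] at this

lemma continuous_nearestPoint (hne : S.Nonempty) (hc : IsClosed S) (hS : Convex ℝ S) :
    Continuous (nearestPoint S) := by
  refine LipschitzWith.continuous (K := 1) (LipschitzWith.of_dist_le_mul fun x y => ?_)
  simpa [dist_eq_norm] using norm_nearestPoint_sub_nearestPoint_le hne hc hS x y

/-- Regret bound of projected online gradient descent. -/
lemma sum_inner_le_of_projected_steps (hne : S.Nonempty) (hc : IsClosed S) (hS : Convex ℝ S)
    {x g : ℕ → Act n} {η D B : ℝ} (hη : 0 < η) (T : ℕ)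
    (hstep : ∀ t < T, x (t + 1) = nearestPoint S (x t - η • g t))
    (hg : ∀ t < T, ‖g t‖ ≤ B) {y : Act n} (hy : y ∈ S) (hD : ‖x 0 - y‖ ≤ D) :
    ∑ t ∈ Finset.range T, inner ℝ (g t) (x t - y) ≤ D ^ 2 / (2 * η) + η * T * B ^ 2 / 2 := by
  -- The squared distance to `y` is the potential that telescopes.
  have key : ∀ m ≤ T, 2 * η * ∑ t ∈ Finset.range m, inner ℝ (g t) (x t - y) ≤
      ‖x 0 - y‖ ^ 2 - ‖x m - y‖ ^ 2 + η ^ 2 * m * B ^ 2 := by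
    intro m
    induction m with
    | zero => intro _; simp
    | succ m ih =>
      intro hm
      have h1 := ih (by omega)
      have h2 : ‖x (m + 1) - y‖ ^ 2 ≤ ‖x m - η • g m - y‖ ^ 2 := by
        rw [hstep m (by omega)]
        exact pow_le_pow_left₀ (norm_nonneg _) (norm_nearestPoint_sub_le hne hc hS _ hy) 2
      have h3 : ‖x m - η • g m - y‖ ^ 2 =
          ‖x m - y‖ ^ 2 - 2 * η * inner ℝ (g m) (x m - y) + η ^ 2 * ‖g m‖ ^ 2 := by
        rw [show x m - η • g m - y = (x m - y) - η • g m by abel, norm_sub_sq_real,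
          inner_smul_right, norm_smul, mul_pow, Real.norm_eq_abs, sq_abs, real_inner_comm]
        ring
      have h4 : ‖g m‖ ^ 2 ≤ B ^ 2 := pow_le_pow_left₀ (norm_nonneg _) (hg m (by omega)) 2
      have h5 := mul_le_mul_of_nonneg_left h4 (sq_nonneg η)
      rw [Finset.sum_range_succ]
      push_cast
      nlinarith
  have h1 := key T le_rfl
  have h2 : ‖x 0 - y‖ ^ 2 ≤ D ^ 2 := pow_le_pow_left₀ (norm_nonneg _) hD 2
  have h3 : 2 * η * ∑ t ∈ Finset.range T, inner ℝ (g t) (x t - y) ≤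
      D ^ 2 + η ^ 2 * T * B ^ 2 := by nlinarith [sq_nonneg ‖x T - y‖]
  rw [← mul_le_mul_iff_of_pos_left (show 0 < 2 * η by positivity)]
  refine h3.trans_eq ?_
  field_simp

end Projection

/-! ### Azuma–Hoeffding inequality -/

section Azuma

/-- The convex exponential lies below its chord over `[-l c, l c]`. -/
lemma exp_mul_le_cosh_add_sinh {x c l : ℝ} (hc : 0 < c) (hx : |x| ≤ c) :
    Real.exp (l * x) ≤ Real.cosh (l * c) + x / c * Real.sinh (l * c) := by
  obtain ⟨h1, h2⟩ := abs_le.1 hx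
  have hp : 0 ≤ (c + x) / (2 * c) := div_nonneg (by linarith) (by linarith)
  have hq : 0 ≤ (c - x) / (2 * c) := div_nonneg (by linarith) (by linarith)
  have hpq : (c + x) / (2 * c) + (c - x) / (2 * c) = 1 := by field_simp; ring
  have := convexOn_exp.2 (Set.mem_univ (l * c)) (Set.mem_univ (-(l * c))) hp hq hpq
  simp only [smul_eq_mul] at this
  have e : (c + x) / (2 * c) * (l * c) + (c - x) / (2 * c) * -(l * c) = l * x := by
    field_simp; ring
  rw [e] at this
  refine this.trans_eq ?_
  rw [Real.cosh_eq, Real.sinh_eq]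
  field_simp
  ring

variable {Ω : Type*} [MeasurableSpace Ω] {μ : Measure Ω} [IsProbabilityMeasure μ]

/-- Each increment multiplies the exponential moment by at most `cosh (l c) ≤ exp ((l c)² / 2)`; the
`sinh` term is linear in the increment and is dropped by the sign hypothesis `hV`. Only correlations
with the exponential of the past sum enter, so neither a filtration nor a conditional expectation is
needed. -/
lemma integral_exp_sum_le {V : ℕ → Ω → ℝ} {c l : ℝ} (hc : 0 < c) (hl : 0 < l) {T : ℕ}
    (hm : ∀ t < T, Measurable (V t)) (hb : ∀ t < T, ∀ ω, |V t ω| ≤ c)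
    (hV : ∀ t < T, ∫ ω, Real.exp (l * ∑ s ∈ Finset.range t, V s ω) * V t ω ∂μ ≤ 0) :
    ∀ m ≤ T, Integrable (fun ω => Real.exp (l * ∑ s ∈ Finset.range m, V s ω)) μ ∧
      ∫ ω, Real.exp (l * ∑ s ∈ Finset.range m, V s ω) ∂μ ≤ Real.exp (m * ((l * c) ^ 2 / 2)) := by
  have hmeas : ∀ m ≤ T, Measurable fun ω => Real.exp (l * ∑ s ∈ Finset.range m, V s ω) :=
    fun m hmT => ((Finset.measurable_fun_sum _ fun s hs =>
      hm s ((Finset.mem_range.1 hs).trans_le hmT)).const_mul l).exp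
  have h_int : ∀ m ≤ T, Integrable (fun ω => Real.exp (l * ∑ s ∈ Finset.range m, V s ω)) μ := by
    intro m hmT
    refine Integrable.of_bound (hmeas m hmT).aestronglyMeasurable (Real.exp (l * (m * c)))
      (.of_forall fun ω => ?_)
    rw [Real.norm_of_nonneg (Real.exp_pos _).le, Real.exp_le_exp]
    refine mul_le_mul_of_nonneg_left ?_ hl.le
    calc ∑ s ∈ Finset.range m, V s ω ≤ ∑ s ∈ Finset.range m, c :=
          Finset.sum_le_sum fun s hs =>
            (le_abs_self _).trans (hb s ((Finset.mem_range.1 hs).trans_le hmT) ω)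
      _ = m * c := by simp
  intro m hmT
  refine ⟨h_int m hmT, ?_⟩
  induction m with
  | zero => simp
  | succ m ih =>
    have hmT' : m < T := hmT
    have hi := h_int m hmT'.le
    have hi2 : Integrable (fun ω => Real.exp (l * ∑ s ∈ Finset.range m, V s ω) * V m ω) μ :=
      hi.mul_bdd (c := c) (hm m hmT').aestronglyMeasurable (.of_forall (hb m hmT'))
    have hs : 0 ≤ c⁻¹ * Real.sinh (l * c) :=
      mul_nonneg (inv_nonneg.2 hc.le) (Real.sinh_nonneg_iff.2 (by positivity))
    calc ∫ ω, Real.exp (l * ∑ s ∈ Finset.range (m + 1), V s ω) ∂μ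
        ≤ ∫ ω, (Real.cosh (l * c) * Real.exp (l * ∑ s ∈ Finset.range m, V s ω) +
          c⁻¹ * Real.sinh (l * c) *
            (Real.exp (l * ∑ s ∈ Finset.range m, V s ω) * V m ω)) ∂μ := by
          refine integral_mono (h_int (m + 1) hmT) ((hi.const_mul _).add (hi2.const_mul _))
            fun ω => ?_
          simp only
          rw [Finset.sum_range_succ, mul_add, Real.exp_add]
          refine (mul_le_mul_of_nonneg_left (exp_mul_le_cosh_add_sinh hc (hb m hmT' ω))
            (Real.exp_pos _).le).trans_eq ?_
          rw [div_eq_mul_inv]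
          ring
      _ = Real.cosh (l * c) * (∫ ω, Real.exp (l * ∑ s ∈ Finset.range m, V s ω) ∂μ) +
          c⁻¹ * Real.sinh (l * c) *
            ∫ ω, Real.exp (l * ∑ s ∈ Finset.range m, V s ω) * V m ω ∂μ := by
          rw [integral_add (hi.const_mul _) (hi2.const_mul _), integral_const_mul,
            integral_const_mul]
      _ ≤ Real.cosh (l * c) * (∫ ω, Real.exp (l * ∑ s ∈ Finset.range m, V s ω) ∂μ) := by
          have := mul_nonpos_of_nonneg_of_nonpos hs (hV m hmT')
          linarith
      _ ≤ Real.exp ((l * c) ^ 2 / 2) * Real.exp (m * ((l * c) ^ 2 / 2)) :=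
          mul_le_mul (Real.cosh_le_exp_half_sq _) (ih hmT'.le)
            (integral_nonneg fun ω => (Real.exp_pos _).le) (Real.exp_pos _).le
      _ = _ := by rw [← Real.exp_add]; push_cast; ring_nf

/-- Azuma–Hoeffding inequality for bounded increments whose correlation with the exponential of
the past sums is nonpositive. -/
lemma measure_sum_gt_le_of_bounded_increments {V : ℕ → Ω → ℝ} {c γ : ℝ} (hc : 0 < c) {T : ℕ}
    (hT : 0 < T) (hγ : 0 < γ) (hγ1 : γ < 1)
    (hm : ∀ t < T, Measurable (V t)) (hb : ∀ t < T, ∀ ω, |V t ω| ≤ c)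
    (hV : ∀ t < T, ∀ l : ℝ, 0 < l →
      ∫ ω, Real.exp (l * ∑ s ∈ Finset.range t, V s ω) * V t ω ∂μ ≤ 0) :
    μ {ω | c * √(2 * T * Real.log (1 / γ)) < ∑ s ∈ Finset.range T, V s ω} ≤ ENNReal.ofReal γ := by
  have hT' : (0 : ℝ) < T := by exact_mod_cast hT
  have hlog : 0 < Real.log (1 / γ) := Real.log_pos (by rw [lt_div_iff₀ hγ]; linarith)
  set R := √(2 * T * Real.log (1 / γ))
  have hR : 0 < R := Real.sqrt_pos.2 (by positivity)
  have hR2 : R ^ 2 = 2 * T * Real.log (1 / γ) := Real.sq_sqrt (by positivity)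
  -- Minimiser of the Chernoff exponent `-l c R + T (l c)² / 2`; the minimum is `-R² / (2T) = log
  -- γ`.
  set l : ℝ := R / (T * c)
  have hl : 0 < l := by positivity
  obtain ⟨hi, he⟩ := integral_exp_sum_le hc hl hm hb (fun t ht => hV t ht l hl) T le_rfl
  have h1 := measure_ge_le_exp_mul_mgf (μ := μ) (X := fun ω => ∑ s ∈ Finset.range T, V s ω)
    (t := l) (c * R) hl.le hi
  have h2 : Real.exp (-l * (c * R)) * mgf (fun ω => ∑ s ∈ Finset.range T, V s ω) μ l ≤ γ := by
    refine (mul_le_mul_of_nonneg_left he (Real.exp_pos _).le).trans_eq ?_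
    rw [← Real.exp_add]
    have : -l * (c * R) + T * ((l * c) ^ 2 / 2) = Real.log γ := by
      have e : -l * (c * R) + T * ((l * c) ^ 2 / 2) = - R ^ 2 / (2 * T) := by
        simp only [l]; field_simp; ring
      rw [e, hR2, Real.log_div one_ne_zero hγ.ne', Real.log_one]; field_simp; ring
    rw [this, Real.exp_log hγ]
  rw [← ENNReal.ofReal_toReal (measure_ne_top μ _)]
  refine ENNReal.ofReal_le_ofReal (le_trans ?_ (h1.trans h2))
  refine measureReal_mono fun ω hω => ?_
  rw [Set.mem_ofPred_eq] at hω ⊢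
  exact hω.le

end Azuma

/-! ### Independence and integration over fresh randomness -/

section Independence

variable {Ω : Type*} {mΩ : MeasurableSpace Ω} {μ : Measure Ω}

/-- A finite intersection splits into its two index types; independence between the families
separates the two factors, and independence within each factorises them further. It merges
directions and noise vectors into one independent family. -/
lemma iIndep_sumElim [IsProbabilityMeasure μ] {ι κ : Type*} {m : ι → MeasurableSpace Ω}
    {m' : κ → MeasurableSpace Ω}
    (h : iIndep m μ) (h' : iIndep m' μ) (hi : Indep (⨆ k, m k) (⨆ k, m' k) μ) :
    iIndep (Sum.elim m m') μ := by
  classical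
  rw [iIndep_iff] at h h' ⊢
  intro s f hf
  have hs : s = s.toLeft.disjSum s.toRight := s.toLeft_disjSum_toRight.symm
  have e : ⋂ k ∈ s, f k =
      (⋂ k ∈ s.toLeft, f (.inl k)) ∩ ⋂ k ∈ s.toRight, f (.inr k) := by
    ext ω
    simp only [Set.mem_iInter, Set.mem_inter_iff, Finset.mem_toLeft, Finset.mem_toRight,
      Sum.forall]
  have m1 : ∀ k ∈ s.toLeft, MeasurableSet[m k] (f (.inl k)) := fun k hk =>
    hf (.inl k) (by simpa using hk)
  have m2 : ∀ k ∈ s.toRight, MeasurableSet[m' k] (f (.inr k)) := fun k hk =>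
    hf (.inr k) (by simpa using hk)
  rw [e, (Indep_iff _ _ _).1 hi, h _ m1, h' _ m2]
  · conv_rhs => rw [hs]
    rw [Finset.prod_disjSum]
  · exact Finset.measurableSet_biInter _ fun k hk => le_iSup m k _ (m1 k hk)
  · exact Finset.measurableSet_biInter _ fun k hk => le_iSup m' k _ (m2 k hk)

/-- Fubini for the product law: freeze `A` and integrate over the independent `B`. This plays the
part of conditioning on the past. -/
lemma integral_nonpos_of_indepFun [IsProbabilityMeasure μ] {α β : Type*} [MeasurableSpace α]
    [MeasurableSpace β] {A : Ω → α} {B : Ω → β} (hA : Measurable A) (hB : Measurable B)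
    (h : IndepFun A B μ) {f : α → β → ℝ} (hf : Measurable (Function.uncurry f))
    (h_int : Integrable (fun ω => f (A ω) (B ω)) μ)
    (hle : ∀ ω, ∫ ω', f (A ω) (B ω') ∂μ ≤ 0) : ∫ ω, f (A ω) (B ω) ∂μ ≤ 0 := by
  have : IsProbabilityMeasure (μ.map A) := Measure.isProbabilityMeasure_map hA.aemeasurable
  have : IsProbabilityMeasure (μ.map B) := Measure.isProbabilityMeasure_map hB.aemeasurable
  have hAB : Measurable fun ω => (A ω, B ω) := hA.prodMk hB
  have hmap : μ.map (fun ω => (A ω, B ω)) = (μ.map A).prod (μ.map B) :=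
    (indepFun_iff_map_prod_eq_prod_map_map hA.aemeasurable hB.aemeasurable).1 h
  have h_int' : Integrable (Function.uncurry f) ((μ.map A).prod (μ.map B)) := by
    rw [← hmap, integrable_map_measure hf.aestronglyMeasurable hAB.aemeasurable]
    exact h_int
  have e1 : ∫ ω, f (A ω) (B ω) ∂μ = ∫ q, Function.uncurry f q ∂((μ.map A).prod (μ.map B)) := by
    rw [← hmap, integral_map hAB.aemeasurable hf.aestronglyMeasurable]
    rfl
  have hm := hf.stronglyMeasurable.integral_prod_right (ν := μ.map B)
  rw [e1, integral_prod _ h_int']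
  refine le_of_eq_of_le (integral_map hA.aemeasurable hm.aestronglyMeasurable) ?_
  refine integral_nonpos fun ω => ?_
  have hfa : Measurable fun b => f (A ω) b := hf.comp measurable_prodMk_left
  refine le_of_eq_of_le ?_ (hle ω)
  exact integral_map hB.aemeasurable hfa.aestronglyMeasurable

lemma indepFun_of_iIndep_of_measurable {ι : Type*} {m : ι → MeasurableSpace Ω}
    (hle : ∀ k, m k ≤ mΩ) (hm : iIndep m μ) {S S' : Set ι} (hd : Disjoint S S') {α β : Type*}
    [MeasurableSpace α] [MeasurableSpace β] {A : Ω → α} {B : Ω → β}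
    (hA : Measurable[⨆ k ∈ S, m k] A) (hB : Measurable[⨆ k ∈ S', m k] B) : IndepFun A B μ := by
  rw [IndepFun_iff_Indep]
  have h := indep_iSup_of_disjoint hle hm hd
  exact indep_of_indep_of_le_left (indep_of_indep_of_le_right h hB.comap_le) hA.comap_le

end Independence

/-! ### One-point gradient estimate on the sphere -/

section Sphere

open Metric Filter Topology
open scoped NNReal

variable {n : ℕ}

/-- In polar coordinates direction and radius separate, and the radial factor is identified by the
case `g = 1`. Averages over the sphere thus become volume integrals over thin shells, also in
dimension `1`. -/
lemma integral_shell_comp_direction [Nontrivial (Act n)] (g : Act n → ℝ) (r : ℝ) :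
    ∫ w : Act n, (Set.Ioo r 1).indicator (fun _ => g (‖w‖⁻¹ • w)) ‖w‖ =
      (∫ w : Act n, (Set.Ioo r 1).indicator (fun _ => (1 : ℝ)) ‖w‖) *
        ∫ u, g u ∂uniformSphere n := by
  set μ : Measure (Act n) := volume
  have key : ∀ g : Act n → ℝ,
      ∫ w : Act n, (Set.Ioo r 1).indicator (fun _ => g (‖w‖⁻¹ • w)) ‖w‖ ∂μ =
        (∫ u : sphere (0 : Act n) 1, g u ∂μ.toSphere) *
        ∫ t : Set.Ioi (0 : ℝ), (Set.Ioo r 1).indicator (fun _ => (1 : ℝ)) t.1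
          ∂(Measure.volumeIoiPow (Module.finrank ℝ (Act n) - 1)) := by
    intro g
    calc ∫ w : Act n, (Set.Ioo r 1).indicator (fun _ => g (‖w‖⁻¹ • w)) ‖w‖ ∂μ
        = ∫ w : ({(0)}ᶜ : Set (Act n)),
            (Set.Ioo r 1).indicator (fun _ => g (‖w.1‖⁻¹ • w.1)) ‖w.1‖ ∂(μ.comap (↑)) := by
          rw [integral_subtype_comap (measurableSet_singleton _).compl
            fun w => (Set.Ioo r 1).indicator (fun _ => g (‖w‖⁻¹ • w)) ‖w‖,
            restrict_compl_singleton]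
      _ = ∫ p, g p.1 * (Set.Ioo r 1).indicator (fun _ => (1 : ℝ)) p.2.1
            ∂μ.toSphere.prod (.volumeIoiPow (Module.finrank ℝ (Act n) - 1)) := by
          rw [← μ.measurePreserving_homeomorphUnitSphereProd.integral_comp
            (Homeomorph.measurableEmbedding _)]
          refine integral_congr_ae (.of_forall fun w => ?_)
          by_cases hw : ‖w.1‖ ∈ Set.Ioo r 1 <;> simp [hw]
      _ = _ := integral_prod_mul (fun u : sphere (0 : Act n) 1 => g u)
          (fun t : Set.Ioi (0 : ℝ) => (Set.Ioo r 1).indicator (fun _ => (1 : ℝ)) t.1)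
  have hone := key (fun _ => 1)
  have hpos : (μ.toSphere.real Set.univ) ≠ 0 := by
    rw [measureReal_def, ENNReal.toReal_ne_zero]
    exact ⟨by rw [Ne, Measure.measure_univ_eq_zero]; exact Measure.toSphere_ne_zero _,
      measure_ne_top _ _⟩
  have hmap : ∫ u, g u ∂uniformSphere n =
      (μ.toSphere.real Set.univ)⁻¹ * ∫ u : sphere (0 : Act n) 1, g u ∂μ.toSphere := by
    rw [uniformSphere, (MeasurableEmbedding.subtype_coe
      (isClosed_sphere (x := (0 : Act n)) (ε := 1)).measurableSet).integral_map,
      integral_smul_measure, ENNReal.toReal_inv]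
    rfl
  rw [key g, hone, hmap, integral_const]
  field_simp
  simp

instance isProbabilityMeasure_uniformSphere [Nontrivial (Act n)] :
    IsProbabilityMeasure (uniformSphere n) := by
  constructor
  rw [uniformSphere, Measure.map_apply measurable_subtype_coe MeasurableSet.univ, Set.preimage_univ,
    Measure.smul_apply, smul_eq_mul]
  refine ENNReal.inv_mul_cancel ?_ (measure_ne_top _ _)
  rw [Ne, Measure.measure_univ_eq_zero]
  exact Measure.toSphere_ne_zero _

lemma ae_uniformSphere_norm_eq_one : ∀ᵐ u ∂uniformSphere n, ‖u‖ = 1 := by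
  rw [uniformSphere, ae_map_iff measurable_subtype_coe.aemeasurable
    (measurableSet_eq_fun measurable_norm measurable_const)]
  exact .of_forall fun u => by simp

/-- The radial cutoff that is `1` for `‖w‖ ≤ 1 - ε`, `0` for `‖w‖ ≥ 1`, and affine in between. -/
def radialCutoff (ε : ℝ) (w : Act n) : ℝ := max 0 (min 1 (ε⁻¹ * (1 - ‖w‖)))

lemma radialCutoff_nonneg (ε : ℝ) (w : Act n) : 0 ≤ radialCutoff ε w := le_max_left _ _

lemma radialCutoff_le_one (ε : ℝ) (w : Act n) : radialCutoff ε w ≤ 1 :=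
  max_le zero_le_one (min_le_left _ _)

lemma radialCutoff_eq_zero {ε : ℝ} (hε : 0 < ε) {w : Act n} (hw : 1 ≤ ‖w‖) :
    radialCutoff ε w = 0 := by
  refine max_eq_left ((min_le_right _ _).trans ?_)
  exact mul_nonpos_of_nonneg_of_nonpos (inv_nonneg.2 hε.le) (by linarith)

lemma radialCutoff_eq_one {ε : ℝ} (hε : 0 < ε) {w : Act n} (hw : ‖w‖ ≤ 1 - ε) :
    radialCutoff ε w = 1 := by
  have : 1 ≤ ε⁻¹ * (1 - ‖w‖) := by
    rw [inv_mul_eq_div, le_div_iff₀ hε]; linarith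
  rw [radialCutoff, min_eq_left this, max_eq_right zero_le_one]

lemma radialCutoff_lipschitz {ε : ℝ} (hε : 0 < ε) :
    LipschitzWith (Real.toNNReal ε⁻¹) (radialCutoff (n := n) ε) := by
  have h1 : LipschitzWith (Real.toNNReal ε⁻¹) (fun w : Act n => ε⁻¹ * (1 - ‖w‖)) := by
    refine LipschitzWith.of_dist_le_mul fun x y => ?_
    rw [Real.dist_eq, ← mul_sub, abs_mul, abs_of_pos (inv_pos.2 hε),
      Real.coe_toNNReal _ (inv_nonneg.2 hε.le), dist_eq_norm]
    refine mul_le_mul_of_nonneg_left ?_ (inv_nonneg.2 hε.le)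
    rw [sub_sub_sub_cancel_left, abs_sub_comm]
    exact abs_norm_sub_norm_le x y
  exact (h1.const_min 1).const_max 0

lemma radialCutoff_hasCompactSupport {ε : ℝ} (hε : 0 < ε) :
    HasCompactSupport (radialCutoff (n := n) ε) := by
  refine HasCompactSupport.intro (isCompact_closedBall (0 : Act n) 1) fun w hw => ?_
  exact radialCutoff_eq_zero hε (by simpa using (not_le.1 fun h => hw (by simpa using h)).le)

lemma hasDerivAt_norm_add_smul {w : Act n} (hw : w ≠ 0) (v : Act n) :
    HasDerivAt (fun s : ℝ => ‖w + s • v‖) (inner ℝ (‖w‖⁻¹ • w) v) 0 := by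
  have h1 : HasDerivAt (fun s : ℝ => w + s • v) v 0 := by
    simpa using ((hasDerivAt_id (0 : ℝ)).smul_const v).const_add w
  have h2 := h1.norm_sq
  have h3 := h2.sqrt (by simpa using hw)
  have h4 : (fun s : ℝ => √(‖w + s • v‖ ^ 2)) = fun s : ℝ => ‖w + s • v‖ := by
    funext s; exact Real.sqrt_sq (norm_nonneg _)
  rw [h4] at h3
  convert h3 using 1
  simp only [zero_smul, add_zero, Real.sqrt_sq (norm_nonneg w), real_inner_smul_left]
  have : ‖w‖ ≠ 0 := by simpa using hw
  field_simp

/-- The cutoff is constant on either side of the shell and affine in the norm on it. The two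
excluded spheres are null sets. -/
lemma lineDeriv_radialCutoff {ε : ℝ} (hε : 0 < ε) (hε1 : ε < 1) (v : Act n) {w : Act n}
    (h1 : ‖w‖ ≠ 1) (h2 : ‖w‖ ≠ 1 - ε) :
    lineDeriv ℝ (radialCutoff ε) w (-v) =
      (Set.Ioo (1 - ε) 1).indicator (fun _ => ε⁻¹ * inner ℝ (‖w‖⁻¹ • w) v) ‖w‖ := by
  have hcont : ContinuousAt (fun s : ℝ => ‖w + s • -v‖) 0 := by fun_prop
  have h0 : ‖w + (0 : ℝ) • -v‖ = ‖w‖ := by simp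
  rw [lineDeriv]
  rcases lt_or_gt_of_ne h1 with h1 | h1
  · rcases lt_or_gt_of_ne h2 with h2 | h2
    · have : (fun s : ℝ => radialCutoff ε (w + s • -v)) =ᶠ[𝓝 0] fun _ => 1 := by
        filter_upwards [hcont.eventually_lt continuousAt_const (by rwa [h0])] with s hs
        exact radialCutoff_eq_one hε hs.le
      rw [this.deriv_eq, deriv_const, Set.indicator_of_notMem (fun h => by linarith [h.1])]
    · have hw : w ≠ 0 := by rintro rfl; simp at h2; linarith
      have : (fun s : ℝ => radialCutoff ε (w + s • -v)) =ᶠ[𝓝 0]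
          fun s => ε⁻¹ * (1 - ‖w + s • -v‖) := by
        filter_upwards [hcont.eventually_lt continuousAt_const (by rwa [h0]),
          continuousAt_const.eventually_lt hcont (by rwa [h0])] with s hs hs'
        rw [radialCutoff, min_eq_right, max_eq_right]
        · exact mul_nonneg (inv_nonneg.2 hε.le) (by linarith)
        · rw [inv_mul_eq_div, div_le_iff₀ hε]; linarith
      rw [this.deriv_eq, Set.indicator_of_mem (show ‖w‖ ∈ Set.Ioo (1 - ε) 1 from ⟨h2, h1⟩)]
      have := ((hasDerivAt_norm_add_smul hw (-v)).const_sub 1).const_mul ε⁻¹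
      rw [this.deriv]; simp
  · have : (fun s : ℝ => radialCutoff ε (w + s • -v)) =ᶠ[𝓝 0] fun _ => 0 := by
      filter_upwards [continuousAt_const.eventually_lt hcont (by rwa [h0])] with s hs
      exact radialCutoff_eq_zero hε hs.le
    rw [this.deriv_eq, deriv_const, Set.indicator_of_notMem (fun h => by linarith [h.2])]

/-- For `t ∈ (-1, 0)` the chord inequality bounds the difference quotient at `w` from below by `h w
- h (w - v)`; then let `t → 0⁻`. -/
lemma sub_le_lineDeriv_of_convex_segment {h : Act n → ℝ} {w v : Act n}
    (hd : LineDifferentiableAt ℝ h w v)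
    (hc : ∀ s ∈ Set.Icc (0 : ℝ) 1, h (w - s • v) ≤ (1 - s) * h w + s * h (w - v)) :
    h w - h (w - v) ≤ lineDeriv ℝ h w v := by
  have ht := hd.hasLineDerivAt.tendsto_slope_zero_left
  refine ge_of_tendsto ht ?_
  filter_upwards [Ioo_mem_nhdsLT (show (-1 : ℝ) < 0 by norm_num)] with t ht
  have := hc (-t) ⟨by linarith [ht.2], by linarith [ht.1]⟩
  rw [neg_smul, sub_neg_eq_add] at this
  rw [smul_eq_mul, inv_mul_eq_div, le_div_iff_of_neg ht.2]
  linarith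

lemma integrable_radialCutoff {ε : ℝ} (hε : 0 < ε) :
    Integrable (radialCutoff (n := n) ε) :=
  (radialCutoff_lipschitz hε).continuous.integrable_of_hasCompactSupport
    (radialCutoff_hasCompactSupport hε)

lemma measurable_shell_indicator {r : ℝ} {g : Act n → ℝ} (hg : Measurable g) :
    Measurable fun w : Act n => (Set.Ioo r 1).indicator (fun _ => g w) ‖w‖ :=
  hg.indicator (s := {w : Act n | ‖w‖ ∈ Set.Ioo r 1}) (measurable_norm measurableSet_Ioo)

lemma integrable_shell_indicator {r B : ℝ} {g : Act n → ℝ} (hg : Measurable g)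
    (hB : ∀ w : Act n, ‖w‖ < 1 → |g w| ≤ B) :
    Integrable fun w : Act n => (Set.Ioo r 1).indicator (fun _ => g w) ‖w‖ := by
  have hi : Integrable ((ball (0 : Act n) 1).indicator fun _ => B) :=
    (integrable_indicator_iff measurableSet_ball).2
      (integrableOn_const (measure_ball_lt_top.ne))
  refine hi.mono' (measurable_shell_indicator hg).aestronglyMeasurable (.of_forall fun w => ?_)
  by_cases hw : ‖w‖ ∈ Set.Ioo r 1
  · rw [Set.indicator_of_mem hw, Set.indicator_of_mem (by simpa using hw.2)]
    exact hB w hw.2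
  · rw [Set.indicator_of_notMem hw, norm_zero]
    refine Set.indicator_nonneg (fun w hw => ?_) _
    exact (abs_nonneg _).trans (hB w (by simpa using hw))

lemma norm_inv_norm_smul_le (w : Act n) : ‖‖w‖⁻¹ • w‖ ≤ 1 := by
  rw [norm_smul, norm_inv, norm_norm]; exact inv_mul_le_one

/-- Integrate the line derivative of `h` against the cutoff, by parts. On one side convexity bounds
the derivative below by `h w - h (w - v)`, and moving `w` to `0` costs `2 K`. On the other side the
derivative of the cutoff lives on the shell, where replacing `h w` by its value at the direction of
`w` costs `K ε`. -/
lemma radialCutoff_sphere_inequality [Nontrivial (Act n)] {K : ℝ≥0} {h : Act n → ℝ} {v : Act n}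
    (hL : LipschitzWith K h)
    (hc : ∀ w, ‖w‖ < 1 → ∀ s ∈ Set.Icc (0 : ℝ) 1,
      h (w - s • v) ≤ (1 - s) * h w + s * h (w - v)) {ε : ℝ} (hε : 0 < ε) (hε1 : ε < 1) :
    (∫ w : Act n, radialCutoff ε w) * (h 0 - h (-v) - 2 * K) ≤
      ε⁻¹ * (∫ w : Act n, (Set.Ioo (1 - ε) 1).indicator (fun _ => (1 : ℝ)) ‖w‖) *
        ((∫ u, inner ℝ u v * h u ∂uniformSphere n) + K * ε * ‖v‖) := by
  have hbd : ∀ u : Act n, ‖u‖ ≤ 1 → |h u| ≤ |h 0| + K := fun u hu => by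
    have := hL.dist_le_mul u 0
    rw [Real.dist_eq, dist_zero_right] at this
    have h2 : (K : ℝ) * ‖u‖ ≤ K := mul_le_of_le_one_right K.2 hu
    have h3 := abs_sub_abs_le_abs_sub (h u) (h 0)
    linarith
  have hin : ∀ u : Act n, ‖u‖ ≤ 1 → |inner ℝ u v| ≤ ‖v‖ := fun u hu =>
    (abs_real_inner_le_norm u v).trans (mul_le_of_le_one_left (norm_nonneg v) hu)
  have hcont := hL.continuous
  -- This majorant of the shell integrand depends on the direction only; the second summand pays for
  -- replacing `h w` by `h (‖w‖⁻¹ • w)`.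
  let g : Act n → ℝ := fun u => ε⁻¹ * (inner ℝ u v * h u + K * ε * ‖v‖)
  have hg : ∫ u, g u ∂uniformSphere n =
      ε⁻¹ * ((∫ u, inner ℝ u v * h u ∂uniformSphere n) + K * ε * ‖v‖) := by
    rw [integral_const_mul, integral_add _ (integrable_const _), integral_const]
    · simp
    · refine Integrable.of_bound (by fun_prop) (‖v‖ * (|h 0| + K)) ?_
      filter_upwards [ae_uniformSphere_norm_eq_one] with u hu
      rw [norm_mul]
      exact mul_le_mul (hin u hu.le) (hbd u hu.le) (abs_nonneg _) (norm_nonneg _)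
  calc (∫ w : Act n, radialCutoff ε w) * (h 0 - h (-v) - 2 * K)
      = ∫ w : Act n, (h 0 - h (-v) - 2 * K) * radialCutoff ε w := by
        rw [integral_const_mul, mul_comm]
    _ ≤ ∫ w, lineDeriv ℝ h w v * radialCutoff ε w := by
        refine integral_mono_ae ((integrable_radialCutoff hε).const_mul _) ?_ ?_
        · refine (integrable_radialCutoff hε).bdd_mul (c := K * ‖v‖)
            (aestronglyMeasurable_lineDeriv hcont _) (.of_forall fun w => ?_)
          exact norm_lineDeriv_le_of_lipschitz ℝ hL
        · filter_upwards [hL.ae_lineDifferentiableAt v] with w hw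
          rcases lt_or_ge ‖w‖ 1 with h1 | h1
          · refine mul_le_mul_of_nonneg_right ?_ (radialCutoff_nonneg _ _)
            have e1 := sub_le_lineDeriv_of_convex_segment hw (hc w h1)
            have e2 := (abs_le.1 (hL.dist_le_mul w 0)).1
            have e3 := (abs_le.1 (hL.dist_le_mul (w - v) (-v))).2
            rw [dist_eq_norm] at e2 e3
            rw [sub_zero] at e2
            rw [sub_neg_eq_add, sub_add_cancel] at e3
            have e4 : (K : ℝ) * ‖w‖ ≤ K := mul_le_of_le_one_right K.2 h1.le
            linarith
          · rw [radialCutoff_eq_zero hε h1, mul_zero, mul_zero]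
    _ = ∫ w, lineDeriv ℝ (radialCutoff ε) w (-v) * h w :=
        hL.integral_lineDeriv_mul_eq (radialCutoff_lipschitz hε)
          (radialCutoff_hasCompactSupport hε) v
    _ = ∫ w : Act n, (Set.Ioo (1 - ε) 1).indicator
          (fun _ => ε⁻¹ * inner ℝ (‖w‖⁻¹ • w) v * h w) ‖w‖ := by
        refine integral_congr_ae ?_
        have s1 : ∀ᵐ w : Act n, w ∉ sphere (0 : Act n) 1 :=
          measure_eq_zero_iff_ae_notMem.1 (Measure.addHaar_sphere _ _ _)
        have s2 : ∀ᵐ w : Act n, w ∉ sphere (0 : Act n) (1 - ε) :=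
          measure_eq_zero_iff_ae_notMem.1 (Measure.addHaar_sphere _ _ _)
        filter_upwards [s1, s2] with w h1 h2
        rw [lineDeriv_radialCutoff hε hε1 v (by simpa using h1) (by simpa using h2)]
        by_cases hw : ‖w‖ ∈ Set.Ioo (1 - ε) 1
        · simp only [Set.indicator_of_mem hw]
        · simp only [Set.indicator_of_notMem hw, zero_mul]
    _ ≤ ∫ w : Act n, (Set.Ioo (1 - ε) 1).indicator (fun _ => g (‖w‖⁻¹ • w)) ‖w‖ := by
        refine integral_mono (integrable_shell_indicator (B := ε⁻¹ * ‖v‖ * (|h 0| + K))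
          (by fun_prop) fun w hw => ?_)
          (integrable_shell_indicator (B := ε⁻¹ * (‖v‖ * (|h 0| + K) + K * ε * ‖v‖))
          (by fun_prop) fun w hw => ?_) fun w => ?_
        · rw [abs_mul, abs_mul, abs_of_pos (inv_pos.2 hε)]
          have := hin _ (norm_inv_norm_smul_le w)
          have := hbd w hw.le
          gcongr
        · have h1 := hin _ (norm_inv_norm_smul_le w)
          have h2 := hbd _ (norm_inv_norm_smul_le w)
          rw [abs_mul, abs_of_pos (inv_pos.2 hε)]
          refine mul_le_mul_of_nonneg_left ((abs_add_le _ _).trans ?_) (inv_nonneg.2 hε.le)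
          rw [abs_mul, abs_of_nonneg (show 0 ≤ (K : ℝ) * ε * ‖v‖ by positivity)]
          gcongr
        · refine Set.indicator_le_indicator' fun hw => ?_
          have hw0 : 0 < ‖w‖ := lt_trans (by linarith) hw.1
          have h1 := hin _ (norm_inv_norm_smul_le w)
          have h2 : |h w - h (‖w‖⁻¹ • w)| ≤ K * ε := by
            refine (hL.dist_le_mul w (‖w‖⁻¹ • w)).trans (mul_le_mul_of_nonneg_left ?_ K.2)
            have : w - ‖w‖⁻¹ • w = (1 - ‖w‖⁻¹) • w := by rw [sub_smul, one_smul]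
            rw [dist_eq_norm, this, norm_smul, Real.norm_eq_abs, ← abs_norm w, ← abs_mul, abs_norm,
              sub_mul, inv_mul_cancel₀ hw0.ne', abs_le]
            constructor <;> linarith [hw.1, hw.2]
          have h3 : |inner ℝ (‖w‖⁻¹ • w) v * (h w - h (‖w‖⁻¹ • w))| ≤ ‖v‖ * (K * ε) := by
            rw [abs_mul]; gcongr
          have h4 := (abs_le.1 h3).2
          simp only [g]
          rw [mul_assoc]
          refine mul_le_mul_of_nonneg_left ?_ (inv_nonneg.2 hε.le)
          linarith
    _ = _ := by
        rw [integral_shell_comp_direction, hg]; ring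

lemma integral_shell_eq [Nontrivial (Act n)] {ε : ℝ} (hε1 : ε < 1) (hε : 0 < ε) :
    ∫ w : Act n, (Set.Ioo (1 - ε) 1).indicator (fun _ => (1 : ℝ)) ‖w‖ =
      volume.real (ball (0 : Act n) 1) * (1 - (1 - ε) ^ n) := by
  have h1 : (fun w : Act n => (Set.Ioo (1 - ε) 1).indicator (fun _ => (1 : ℝ)) ‖w‖) =
      (ball (0 : Act n) 1 \ closedBall (0 : Act n) (1 - ε)).indicator 1 := by
    funext w
    by_cases hw : ‖w‖ ∈ Set.Ioo (1 - ε) 1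
    · rw [Set.indicator_of_mem hw, Set.indicator_of_mem, Pi.one_apply]
      simpa using ⟨hw.2, hw.1⟩
    · rw [Set.indicator_of_notMem hw, Set.indicator_of_notMem]
      simp only [Set.mem_sdiff, mem_ball_zero_iff, mem_closedBall_zero_iff, not_le]
      exact fun h => hw ⟨h.2, h.1⟩
  rw [h1, integral_indicator_one (measurableSet_ball.diff measurableSet_closedBall),
    measureReal_sdiff (closedBall_subset_ball (by linarith)) measurableSet_closedBall
      measure_ball_lt_top.ne, measureReal_def (s := closedBall _ _),
    Measure.addHaar_closedBall _ _ (by linarith : 0 ≤ 1 - ε), ENNReal.toReal_mul,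
    ENNReal.toReal_ofReal (by have : 0 ≤ 1 - ε := by linarith
                              positivity), finrank_euclideanSpace_fin, measureReal_def]
  ring

lemma integral_radialCutoff_le {ε : ℝ} (hε : 0 < ε) :
    ∫ w : Act n, radialCutoff ε w ≤ volume.real (ball (0 : Act n) 1) := by
  rw [← integral_indicator_one measurableSet_ball]
  refine integral_mono (integrable_radialCutoff hε) ((integrable_indicator_iff
    measurableSet_ball).2 (integrableOn_const measure_ball_lt_top.ne)) fun w => ?_
  by_cases hw : w ∈ ball (0 : Act n) 1
  · rw [Set.indicator_of_mem hw]; exact radialCutoff_le_one _ _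
  · rw [Set.indicator_of_notMem hw, radialCutoff_eq_zero hε (by simpa using hw)]

lemma le_integral_radialCutoff {ε : ℝ} (hε : 0 < ε) (hε1 : ε < 1) :
    volume.real (ball (0 : Act n) 1) * (1 - ε) ^ n ≤ ∫ w : Act n, radialCutoff ε w := by
  have : volume.real (ball (0 : Act n) 1) * (1 - ε) ^ n =
      volume.real (closedBall (0 : Act n) (1 - ε)) := by
    rw [measureReal_def (s := closedBall _ _),
      Measure.addHaar_closedBall _ _ (by linarith : 0 ≤ 1 - ε), ENNReal.toReal_mul,
      ENNReal.toReal_ofReal (by have : 0 ≤ 1 - ε := by linarith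
                                positivity), finrank_euclideanSpace_fin, measureReal_def, mul_comm]
  rw [this, ← integral_indicator_one measurableSet_closedBall]
  refine integral_mono ((integrable_indicator_iff measurableSet_closedBall).2
    (integrableOn_const measure_closedBall_lt_top.ne)) (integrable_radialCutoff hε) fun w => ?_
  by_cases hw : w ∈ closedBall (0 : Act n) (1 - ε)
  · rw [Set.indicator_of_mem hw, radialCutoff_eq_one hε (by simpa using hw), Pi.one_apply]
  · rw [Set.indicator_of_notMem hw]; exact radialCutoff_nonneg _ _

/-- Spherical one-point gradient inequality for a Lipschitz function that is convex along the
segments from the unit ball in direction `-v`. -/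
lemma sub_le_integral_sphere_of_convex_segment [Nontrivial (Act n)] {K : ℝ≥0} {h : Act n → ℝ}
    {v : Act n} (hL : LipschitzWith K h)
    (hc : ∀ w, ‖w‖ < 1 → ∀ s ∈ Set.Icc (0 : ℝ) 1,
      h (w - s • v) ≤ (1 - s) * h w + s * h (w - v)) :
    h 0 - h (-v) - 2 * K ≤ n * ∫ u, inner ℝ u v * h u ∂uniformSphere n := by
  set ω := volume.real (ball (0 : Act n) 1)
  set I := ∫ u, inner ℝ u v * h u ∂uniformSphere n
  have hω : 0 < ω := by
    refine ENNReal.toReal_pos ?_ measure_ball_lt_top.ne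
    exact (measure_ball_pos _ _ one_pos).ne'
  have hcontR : Tendsto (fun ε : ℝ => (∑ k ∈ Finset.range n, (1 - ε) ^ k) * (I + K * ε * ‖v‖))
      (𝓝[>] 0) (𝓝 ((∑ k ∈ Finset.range n, (1 - (0 : ℝ)) ^ k) * (I + K * 0 * ‖v‖))) :=
    ((by fun_prop : Continuous fun ε : ℝ =>
      (∑ k ∈ Finset.range n, (1 - ε) ^ k) * (I + K * ε * ‖v‖)).tendsto 0).mono_left
      nhdsWithin_le_nhds
  have hm : Tendsto (fun ε : ℝ => ω⁻¹ * ∫ w : Act n, radialCutoff ε w) (𝓝[>] 0) (𝓝 1) := by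
    have hlow : Tendsto (fun ε : ℝ => (1 - ε) ^ n) (𝓝[>] 0) (𝓝 1) := by
      have := ((by fun_prop : Continuous fun ε : ℝ => (1 - ε) ^ n).tendsto 0).mono_left
        (nhdsWithin_le_nhds (s := Set.Ioi 0))
      simpa using this
    refine tendsto_of_tendsto_of_tendsto_of_le_of_le' hlow tendsto_const_nhds ?_ ?_
    · filter_upwards [Ioo_mem_nhdsGT (zero_lt_one' ℝ)] with ε hε
      rw [inv_mul_eq_div, le_div_iff₀ hω, mul_comm]
      exact le_integral_radialCutoff hε.1 hε.2
    · filter_upwards [Ioo_mem_nhdsGT (zero_lt_one' ℝ)] with ε hε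
      rw [inv_mul_eq_div, div_le_one hω]
      exact integral_radialCutoff_le hε.1
  have hL' := hm.mul_const (h 0 - h (-v) - 2 * K)
  rw [one_mul] at hL'
  have hR' : (∑ k ∈ Finset.range n, (1 - (0 : ℝ)) ^ k) * (I + K * 0 * ‖v‖) = n * I := by simp
  rw [hR'] at hcontR
  refine le_of_tendsto_of_tendsto hL' hcontR ?_
  filter_upwards [Ioo_mem_nhdsGT (zero_lt_one' ℝ)] with ε hε
  have key := radialCutoff_sphere_inequality hL hc hε.1 hε.2
  rw [integral_shell_eq hε.2 hε.1] at key
  -- The shell volume divided by `ε` times the ball volume is a geometric sum of `n` terms that tend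
  -- to `1`; this produces the factor `n`.
  have hgeom : (∑ k ∈ Finset.range n, (1 - ε) ^ k) * ε = 1 - (1 - ε) ^ n := by
    have := geom_sum_mul_neg (1 - ε) n
    rwa [sub_sub_cancel] at this
  rw [← hgeom] at key
  have h2 := mul_le_mul_of_nonneg_left key (inv_nonneg.2 hω.le)
  have hε0 := hε.1.ne'
  have hω0 := hω.ne'
  calc _ = ω⁻¹ * ((∫ w : Act n, radialCutoff ε w) * (h 0 - h (-v) - 2 * K)) := by ring
    _ ≤ _ := h2
    _ = _ := by
      change ω⁻¹ * (ε⁻¹ * (ω * ((∑ k ∈ Finset.range n, (1 - ε) ^ k) * ε)) *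
        (I + K * ε * ‖v‖)) = _
      field_simp

/-- One-point gradient estimate: for a convex Lipschitz function, the spherical gradient estimate
at `x` is an approximate subgradient. -/
lemma sub_le_integral_uniformSphere (hn : 0 < n) {X : Set (Act n)} {f : Act n → ℝ} {L δ : ℝ}
    (hL0 : 0 ≤ L) (hδ : 0 < δ) (hf : ConvexOn ℝ X f)
    (hL : ∀ x ∈ X, ∀ y ∈ X, |f x - f y| ≤ L * ‖x - y‖) {x y : Act n}
    (hx : closedBall x δ ⊆ X) (hy : closedBall y δ ⊆ X) :
    f x - f y ≤ n / δ * (∫ u, f (x + δ • u) * inner ℝ u (x - y) ∂uniformSphere n) + 2 * L * δ := by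
  have : Nonempty (Fin n) := ⟨⟨0, hn⟩⟩
  have : Nontrivial (Act n) := inferInstance
  have hLip : LipschitzOnWith (Real.toNNReal L) f X := by
    refine LipschitzOnWith.of_dist_le_mul fun a ha b hb => ?_
    rw [Real.coe_toNNReal _ hL0, Real.dist_eq, dist_eq_norm]
    exact hL a ha b hb
  -- Integration by parts needs a function on the whole space, so `f` is replaced by a Lipschitz
  -- extension. The extension need not be convex; convexity is used only on segments inside `X`.
  obtain ⟨F, hF, hFf⟩ := hLip.extend_real
  have hmem : ∀ {p : Act n}, closedBall p δ ⊆ X → ∀ {w : Act n}, ‖w‖ ≤ 1 → p + δ • w ∈ X := by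
    intro p hp w hw
    refine hp ?_
    rw [mem_closedBall_iff_norm, add_sub_cancel_left, norm_smul, Real.norm_of_nonneg hδ.le]
    exact mul_le_of_le_one_right hδ.le hw
  let h : Act n → ℝ := fun w => F (x + δ • w)
  have hh : LipschitzWith (Real.toNNReal L * Real.toNNReal δ) h := by
    refine hF.comp (LipschitzWith.of_dist_le_mul fun a b => ?_)
    rw [dist_add_left, dist_smul₀, Real.norm_of_nonneg hδ.le, Real.coe_toNNReal _ hδ.le]
  -- With `v = δ⁻¹ • (x - y)`, the segment from `w` to `w - v` corresponds to the one from `x + δ •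
  -- w` to `y + δ • w`, whose ends lie in the two given balls.
  have hδv : ∀ s : ℝ, ∀ w : Act n, x + δ • (w - s • (δ⁻¹ • (x - y))) =
      (1 - s) • (x + δ • w) + s • (y + δ • w) := by
    intro s w
    have : δ • s • δ⁻¹ • (x - y) = s • (x - y) := by
      rw [smul_comm δ s, smul_smul δ δ⁻¹, mul_inv_cancel₀ hδ.ne', one_smul]
    rw [smul_sub, this]
    module
  have key := sub_le_integral_sphere_of_convex_segment (v := δ⁻¹ • (x - y)) hh ?_
  · have e0 : h 0 = f x := by
      simp only [h, smul_zero, add_zero]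
      exact (hFf (by simpa using hmem hx (w := 0) (by simp))).symm
    have e1 : h (-(δ⁻¹ • (x - y))) = f y := by
      have := hδv 1 0
      simp only [zero_sub, one_smul, sub_self, zero_smul, smul_zero, add_zero, zero_add] at this
      simp only [h, this]
      exact (hFf (by simpa using hmem hy (w := 0) (by simp))).symm
    have e2 : ∫ u, inner ℝ u (δ⁻¹ • (x - y)) * h u ∂uniformSphere n =
        δ⁻¹ * ∫ u, f (x + δ • u) * inner ℝ u (x - y) ∂uniformSphere n := by
      rw [← integral_const_mul]
      refine integral_congr_ae ?_
      filter_upwards [ae_uniformSphere_norm_eq_one] with u hu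
      simp only [h]
      rw [← hFf (hmem hx hu.le), real_inner_smul_right]
      ring
    rw [e0, e1, e2, NNReal.coe_mul, Real.coe_toNNReal _ hL0, Real.coe_toNNReal _ hδ.le] at key
    have : (n : ℝ) / δ * (∫ u, f (x + δ • u) * inner ℝ u (x - y) ∂uniformSphere n) =
      n * (δ⁻¹ * ∫ u, f (x + δ • u) * inner ℝ u (x - y) ∂uniformSphere n) := by
        rw [div_eq_mul_inv]; ring
    linarith
  · intro w hw s hs
    have m1 := hmem hx hw.le
    have m2 := hmem hy hw.le
    have e1 := hδv 1 w
    simp only [one_smul, sub_self, zero_smul, zero_add] at e1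
    have hcv := hf.2 m1 m2 (sub_nonneg.2 hs.2) hs.1 (by ring)
    have m3 := hf.1 m1 m2 (sub_nonneg.2 hs.2) hs.1 (by ring)
    simp only [h]
    rw [hδv s w, e1, ← hFf m1, ← hFf m2, ← hFf m3]
    simpa using hcv

end Sphere

/-! ### Retraction onto the joint action set and invariants of the run -/

namespace RiskGame

variable {N : ℕ} {G : RiskGame N} {Dx U L₀ C₀ : ℝ}

/-- The projection onto the joint action space. -/
def retract (G : RiskGame N) (x : Profile G.d) : Profile G.d :=
  WithLp.toLp 2 fun i => nearestPoint (G.X i) (x i)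

lemma retract_mem_joint (hS : G.Standing Dx) (hne : ∀ i, (G.X i).Nonempty) (x : Profile G.d) :
    G.retract x ∈ G.joint := fun i => (nearestPoint_spec (hne i) (hS.closed i) (x i)).1

/-- The costs are regular only on `G.joint`. Composing with the retraction makes them regular on all
profiles, and this identity shows that nothing changes along a run. -/
lemma retract_eq_self (hS : G.Standing Dx) {x : Profile G.d} (hx : x ∈ G.joint) :
    G.retract x = x := by
  ext i : 1
  exact nearestPoint_eq_self ⟨_, hx i⟩ (hS.closed i) (hx i)

lemma continuous_retract (hS : G.Standing Dx) (hne : ∀ i, (G.X i).Nonempty) :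
    Continuous G.retract := by
  refine (PiLp.continuous_toLp 2 _).comp (continuous_pi fun i => ?_)
  exact (continuous_nearestPoint (hne i) (hS.closed i) (hS.convex i)).comp
    (PiLp.continuous_apply 2 _ i)

lemma continuous_C_retract (hS : G.Standing Dx) (hne : ∀ i, (G.X i).Nonempty)
    (hJ : G.ConvexBounded U) (hL0 : 0 ≤ L₀) (hL : G.LipschitzCost L₀) (i : Fin N) :
    Continuous fun x => G.C i (G.retract x) := by
  have h : LipschitzOnWith (Real.toNNReal L₀) (G.C i) G.joint := by
    refine LipschitzOnWith.of_dist_le_mul fun a ha b hb => ?_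
    rw [Real.coe_toNNReal _ hL0, Real.dist_eq, dist_eq_norm]
    exact abs_C_sub_C_le hS hJ hL i ha hb
  exact h.continuousOn.comp_continuous (continuous_retract hS hne) (retract_mem_joint hS hne)

/-- A Carathéodory function, continuous in the profile and measurable in the noise, is jointly
measurable. -/
lemma measurable_J_retract (hS : G.Standing Dx) (hne : ∀ i, (G.X i).Nonempty)
    (hL0 : 0 ≤ L₀) (hL : G.LipschitzCost L₀) (i : Fin N) :
    Measurable fun q : Profile G.d × G.Ξ i => G.J i (G.retract q.1) q.2 := by
  refine measurable_uncurry_of_continuous_of_measurable (u := fun x ξ => G.J i (G.retract x) ξ)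
    (fun ξ => ?_) (fun x => hS.measurable_cost i _ (retract_mem_joint hS hne x))
  have h : LipschitzOnWith (Real.toNNReal L₀) (fun x => G.J i x ξ) G.joint := by
    refine LipschitzOnWith.of_dist_le_mul fun a ha b hb => ?_
    rw [Real.coe_toNNReal _ hL0, Real.dist_eq, dist_eq_norm]
    exact hL i ξ a ha b hb
  exact h.continuousOn.comp_continuous (continuous_retract hS hne) (retract_mem_joint hS hne)

lemma isCostCDF_edf (hJ : G.ConvexBounded U) (i : Fin N) {n : ℕ} (hn : 0 < n) {x : Profile G.d}
    (hx : x ∈ G.joint) (ξ : ℕ → G.Ξ i) : IsCostCDF U (G.edf i n x ξ) := by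
  have hn' : (0 : ℝ) < n := by exact_mod_cast hn
  have hind : ∀ j y, Set.indicator {c : ℝ | c ≤ y} (1 : ℝ → ℝ) (G.J i x (ξ j)) =
      Set.indicator (Set.Ici (G.J i x (ξ j))) (1 : ℝ → ℝ) y := fun j y => by
    simp [Set.indicator_apply]
  refine ⟨?_, fun y => ?_, fun y => ?_, fun y hy => ?_, fun y hy => ?_⟩
  · unfold RiskGame.edf
    simp_rw [hind]
    exact (Finset.measurable_fun_sum _ fun j _ =>
      measurable_one.indicator measurableSet_Ici).const_mul _
  · exact mul_nonneg (by positivity)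
      (Finset.sum_nonneg fun j _ => Set.indicator_nonneg (fun _ _ => zero_le_one) _)
  · rw [RiskGame.edf, one_div, inv_mul_eq_div, div_le_one hn']
    refine (Finset.sum_le_card_nsmul _ _ 1 fun j _ => ?_).trans_eq (by simp)
    exact Set.indicator_le' (fun _ _ => le_rfl) (fun _ _ => zero_le_one) _
  · rw [RiskGame.edf, Finset.sum_eq_zero, mul_zero]
    intro j _
    refine Set.indicator_of_notMem ?_ _
    have := (abs_le.1 ((hJ i (ξ j)).2 x hx)).1
    simp only [Set.mem_ofPred_eq, not_le]
    linarith
  · rw [RiskGame.edf, Finset.sum_congr rfl (g := fun _ => (1 : ℝ))]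
    · simp [hn'.ne']
    · intro j _
      rw [Set.indicator_of_mem, Pi.one_apply]
      have := (abs_le.1 ((hJ i (ξ j)).2 x hx)).2
      simp only [Set.mem_ofPred_eq]
      linarith

section Trajectory

variable {p : Params N} {x₁ : Profile G.d} {v₀ : Fin N → ℝ} {u : (i : Fin N) → ℕ → Act (G.d i)}
  {ξ : (i : Fin N) → ℕ → ℕ → G.Ξ i} {T : ℕ}

lemma state_x_mem (hS : G.Standing Dx) (hx₁ : ∀ i, x₁ i ∈ shrink (G.X i) p.δ) (t : ℕ) (i : Fin N) :
    (G.state p x₁ v₀ u ξ t).x i ∈ shrink (G.X i) p.δ := by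
  cases t with
  | zero => exact hx₁ i
  | succ t => exact (nearestPoint_spec ⟨_, hx₁ i⟩ (isClosed_shrink (hS.closed i)) _).1

lemma perturb_mem_joint (hS : G.Standing Dx) (hδ : 0 < p.δ) {x : Profile G.d}
    (hx : ∀ i, x i ∈ shrink (G.X i) p.δ) {w : (i : Fin N) → Act (G.d i)} (hw : ∀ i, ‖w i‖ = 1) :
    G.perturb p x w ∈ G.joint := by
  intro i
  refine closedBall_subset_of_mem_shrink (hS.closed i) (hx i) ?_
  rw [mem_closedBall_iff_norm]
  simp [RiskGame.perturb, norm_smul, hw i, abs_of_pos hδ]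

lemma played_mem_joint (hS : G.Standing Dx) (hδ : 0 < p.δ)
    (hx₁ : ∀ i, x₁ i ∈ shrink (G.X i) p.δ) (hu : ∀ i t, ‖u i t‖ = 1) (t : ℕ) :
    G.played p x₁ v₀ u ξ t ∈ G.joint :=
  perturb_mem_joint hS hδ (fun i => state_x_mem hS hx₁ _ i) fun i => hu i t

lemma state_succ_Fbar (t : ℕ) : (G.state p x₁ v₀ u ξ (t + 1)).Fbar =
    G.momentumEdf p (t + 1) (G.state p x₁ v₀ u ξ t) (fun i => u i (t + 1))
      (fun i => ξ i (t + 1)) := rfl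

lemma state_succ_est (t : ℕ) (i : Fin N) : (G.state p x₁ v₀ u ξ (t + 1)).est i =
    cvar (G.α i) ((G.state p x₁ v₀ u ξ (t + 1)).Fbar i) := rfl

/-- Convex combinations preserve the property. It starts at state `1` because the initial dummy
`Fbar`, the zero function, does not have it. -/
lemma isCostCDF_Fbar (hS : G.Standing Dx) (hJ : G.ConvexBounded U) (hδ : 0 < p.δ)
    (hβ0 : 0 ≤ p.β) (hβ1 : p.β ≤ 1) (hn : ∀ t, 1 ≤ t → t ≤ T → 0 < p.n t)
    (hx₁ : ∀ i, x₁ i ∈ shrink (G.X i) p.δ) (hu : ∀ i t, ‖u i t‖ = 1) (i : Fin N) :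
    ∀ t < T, IsCostCDF U ((G.state p x₁ v₀ u ξ (t + 1)).Fbar i) := by
  intro t
  induction t with
  | zero =>
    intro hT
    have := isCostCDF_edf hJ i (hn 1 le_rfl hT)
      (played_mem_joint (v₀ := v₀) (ξ := ξ) hS hδ hx₁ hu 1) (ξ i 1)
    rw [state_succ_Fbar]
    convert this using 1
    funext y
    simp [RiskGame.momentumEdf, RiskGame.played]
  | succ t ih =>
    intro hT
    have h1 := isCostCDF_edf hJ i (hn (t + 1 + 1) (by omega) hT)
      (played_mem_joint (v₀ := v₀) (ξ := ξ) hS hδ hx₁ hu (t + 1 + 1)) (ξ i (t + 1 + 1))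
    have h2 := (ih (by omega)).combination h1 hβ0 hβ1
    rw [state_succ_Fbar]
    convert h2 using 2
    simp [RiskGame.momentumEdf, RiskGame.played]

lemma abs_est_le (hS : G.Standing Dx) (hJ : G.ConvexBounded U) (hδ : 0 < p.δ)
    (hβ0 : 0 ≤ p.β) (hβ1 : p.β ≤ 1) (hn : ∀ t, 1 ≤ t → t ≤ T → 0 < p.n t)
    (hx₁ : ∀ i, x₁ i ∈ shrink (G.X i) p.δ) (hv₀ : ∀ i, |v₀ i| ≤ U) (hu : ∀ i t, ‖u i t‖ = 1)
    (i : Fin N) {t : ℕ} (ht : t ≤ T) : |(G.state p x₁ v₀ u ξ t).est i| ≤ U := by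
  cases t with
  | zero => exact hv₀ i
  | succ t =>
    rw [state_succ_est]
    exact (isCostCDF_Fbar hS hJ hδ hβ0 hβ1 hn hx₁ hu i t ht).abs_cvar_le (hS.level_pos i)
      (hS.level_le_one i)

end Trajectory

end RiskGame

/-- As `2 β ≤ 1`, twice the new term is at most the old term plus `2 k + 2 W`. Keeping one extra
copy of the last term on the left closes the induction. -/
lemma sum_le_of_geometric_recursion {e W : ℕ → ℝ} {β k : ℝ} (hβ : β ≤ 1 / 2)
    (hk : 0 ≤ k) {T : ℕ} (he : ∀ t < T, 0 ≤ e t) (h0 : 0 < T → e 0 ≤ W 0)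
    (hs : ∀ t, t + 1 < T → e (t + 1) ≤ β * e t + k + W (t + 1)) :
    ∑ t ∈ Finset.range T, e t ≤ 2 * ∑ t ∈ Finset.range T, W t + 2 * T * k := by
  have key : ∀ m, m + 1 ≤ T → ∑ t ∈ Finset.range (m + 1), e t + e m ≤
      2 * ∑ t ∈ Finset.range (m + 1), W t + 2 * (m + 1) * k := by
    intro m
    induction m with
    | zero =>
      intro h
      have := h0 h
      simp only [zero_add, Finset.sum_range_one, Nat.cast_zero]
      linarith
    | succ m ih =>
      intro h
      have h1 := ih (by omega)
      have h2 := hs m h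
      have h3 : β * e m ≤ 1 / 2 * e m := mul_le_mul_of_nonneg_right hβ (he m (by omega))
      rw [Finset.sum_range_succ, Finset.sum_range_succ (f := W)]
      push_cast
      linarith
  rcases T with _ | m
  · simp
  · have h1 := key m le_rfl
    have h2 := he m (by omega)
    push_cast
    linarith

lemma sum_Icc_one_eq_sum_range {M : Type*} [AddCommMonoid M] (f : ℕ → M) (T : ℕ) :
    ∑ t ∈ Finset.Icc 1 T, f t = ∑ t ∈ Finset.range T, f (t + 1) := by
  induction T with
  | zero => simp
  | succ T ih => rw [Finset.sum_Icc_succ_top (by omega), Finset.sum_range_succ, ih]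

/-! ### Gradient noise, ghost iterates, tracking error -/

namespace RiskGame

variable {N : ℕ} {G : RiskGame N} {Dx U L₀ C₀ : ℝ}

/-- The `L¹` error of the empirical distribution function. -/
def cdfError (G : RiskGame N) (i : Fin N) (n : ℕ) (x : Profile G.d) (ξ : ℕ → G.Ξ i) : ℝ :=
  ∫ y, |G.edf i n x ξ y - G.cdf i x y|

/-- The gradient estimate in expectation over the direction of agent `i`, at the profile `q`. -/
def smoothGrad (G : RiskGame N) (δ : ℝ) (i : Fin N) (q : Profile G.d) : Act (G.d i) :=
  ((G.d i : ℝ) / δ) •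
    ∫ b, G.C i (G.retract (replaceAction q i (q i + δ • b))) • b ∂uniformSphere (G.d i)

/-- The noise of the gradient estimate with direction `b` and residual `c`. -/
def gradNoise (G : RiskGame N) (δ : ℝ) (i : Fin N) (q : Profile G.d) (c : ℝ) (b : Act (G.d i)) :
    Act (G.d i) :=
  G.smoothGrad δ i q -
    ((G.d i : ℝ) / δ * (G.C i (G.retract (replaceAction q i (q i + δ • b))) - c)) • b

section Trajectory

variable (G) (p : Params N) (x₁ : Profile G.d) (v₀ : Fin N → ℝ)
  (u : (i : Fin N) → ℕ → Act (G.d i)) (ξ : (i : Fin N) → ℕ → ℕ → G.Ξ i)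

/-- The profile of episode `t + 1` before agent `i` perturbs its action. -/
def baseProfile (i : Fin N) (t : ℕ) : Profile G.d :=
  replaceAction (G.played p x₁ v₀ u ξ (t + 1)) i ((G.state p x₁ v₀ u ξ t).x i)

/-- The gradient noise of agent `i` in episode `t + 1`. -/
def noiseAt (i : Fin N) (t : ℕ) : Act (G.d i) :=
  G.gradNoise p.δ i (G.baseProfile p x₁ v₀ u ξ i t) ((G.state p x₁ v₀ u ξ t).est i) (u i (t + 1))

/-- Projected gradient descent driven by the gradient noise instead of the gradient estimates. -/
def ghost (i : Fin N) : ℕ → Act (G.d i)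
  | 0 => x₁ i
  | t + 1 => nearestPoint (shrink (G.X i) p.δ)
      (ghost i t - p.η i • G.noiseAt p x₁ v₀ u ξ i t)

/-- The scalar martingale increment of the gradient noise. -/
def noiseIncrement (i : Fin N) (t : ℕ) : ℝ :=
  inner ℝ (G.noiseAt p x₁ v₀ u ξ i t)
    ((G.state p x₁ v₀ u ξ t).x i - G.ghost p x₁ v₀ u ξ i t)

end Trajectory

section Bounds

variable {p : Params N} {x₁ : Profile G.d} {v₀ : Fin N → ℝ} {u : (i : Fin N) → ℕ → Act (G.d i)}
  {ξ : (i : Fin N) → ℕ → ℕ → G.Ξ i} {T : ℕ}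

lemma nontrivial_act (hS : G.Standing Dx) (i : Fin N) : Nontrivial (Act (G.d i)) := by
  have : Nonempty (Fin (G.d i)) := ⟨⟨0, hS.dim_pos i⟩⟩
  infer_instance

lemma norm_smoothGrad_le (hS : G.Standing Dx) (hne : ∀ i, (G.X i).Nonempty)
    (hJ : G.ConvexBounded U) {δ : ℝ} (hδ : 0 < δ) (i : Fin N) (q : Profile G.d) :
    ‖G.smoothGrad δ i q‖ ≤ G.d i / δ * U := by
  have := nontrivial_act hS i
  rw [smoothGrad, norm_smul, Real.norm_of_nonneg (by positivity)]
  refine mul_le_mul_of_nonneg_left ?_ (by positivity)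
  refine (norm_integral_le_of_norm_le_const (C := U) ?_).trans_eq (by simp)
  filter_upwards [ae_uniformSphere_norm_eq_one] with b hb
  rw [norm_smul, hb, mul_one]
  exact abs_C_le hS hJ i (retract_mem_joint hS hne _)

/-- One `U` comes from the averaged gradient and two from the residual `C - c`. -/
lemma norm_gradNoise_le (hS : G.Standing Dx) (hne : ∀ i, (G.X i).Nonempty)
    (hJ : G.ConvexBounded U) {δ : ℝ} (hδ : 0 < δ) (i : Fin N) (q : Profile G.d) {c : ℝ}
    (hc : |c| ≤ U) {b : Act (G.d i)} (hb : ‖b‖ = 1) :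
    ‖G.gradNoise δ i q c b‖ ≤ G.d i / δ * (3 * U) := by
  refine (norm_sub_le _ _).trans ?_
  have h1 := norm_smoothGrad_le hS hne hJ hδ i q
  have h2 : ‖((G.d i : ℝ) / δ * (G.C i (G.retract (replaceAction q i (q i + δ • b))) - c)) • b‖ ≤
      G.d i / δ * (U + U) := by
    rw [norm_smul, hb, mul_one, norm_mul, Real.norm_of_nonneg (by positivity)]
    refine mul_le_mul_of_nonneg_left ((norm_sub_le _ _).trans ?_) (by positivity)
    exact add_le_add (abs_C_le hS hJ i (retract_mem_joint hS hne _)) hc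
  linarith

lemma ghost_mem (hS : G.Standing Dx) (hx₁ : ∀ i, x₁ i ∈ shrink (G.X i) p.δ) (i : Fin N) (t : ℕ) :
    G.ghost p x₁ v₀ u ξ i t ∈ shrink (G.X i) p.δ := by
  cases t with
  | zero => exact hx₁ i
  | succ t => exact (nearestPoint_spec ⟨_, hx₁ i⟩ (isClosed_shrink (hS.closed i)) _).1

lemma replaceAction_replaceAction {d : Fin N → ℕ} (x : Profile d) (i : Fin N) (y z : Act (d i)) :
    replaceAction (replaceAction x i y) i z = replaceAction x i z := by
  ext k : 1
  by_cases h : k = i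
  · subst h; simp
  · simp [replaceAction_of_ne _ h]

lemma played_apply (t : ℕ) (i : Fin N) : G.played p x₁ v₀ u ξ (t + 1) i =
    (G.state p x₁ v₀ u ξ t).x i + p.δ • u i (t + 1) := by
  simp [RiskGame.played, RiskGame.perturb]

@[simp] lemma baseProfile_apply (t : ℕ) (i : Fin N) :
    G.baseProfile p x₁ v₀ u ξ i t i = (G.state p x₁ v₀ u ξ t).x i := by
  simp [baseProfile]

lemma replaceAction_baseProfile (t : ℕ) (i : Fin N) :
    replaceAction (G.baseProfile p x₁ v₀ u ξ i t) i
      ((G.state p x₁ v₀ u ξ t).x i + p.δ • u i (t + 1)) = G.played p x₁ v₀ u ξ (t + 1) := by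
  rw [baseProfile, replaceAction_replaceAction, ← played_apply, replaceAction_self]

lemma abs_noiseIncrement_le (hS : G.Standing Dx) (hJ : G.ConvexBounded U) (hδ : 0 < p.δ)
    (hβ0 : 0 ≤ p.β) (hβ1 : p.β ≤ 1) (hn : ∀ t, 1 ≤ t → t ≤ T → 0 < p.n t)
    (hx₁ : ∀ i, x₁ i ∈ shrink (G.X i) p.δ) (hv₀ : ∀ i, |v₀ i| ≤ U) (hu : ∀ i t, ‖u i t‖ = 1)
    (i : Fin N) {t : ℕ} (ht : t < T) :
    |G.noiseIncrement p x₁ v₀ u ξ i t| ≤ G.d i / p.δ * (3 * U) * Dx := by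
  refine (abs_real_inner_le_norm _ _).trans ?_
  have h1 : ‖G.noiseAt p x₁ v₀ u ξ i t‖ ≤ G.d i / p.δ * (3 * U) :=
    norm_gradNoise_le hS (fun i => ⟨_, (hx₁ i).1⟩) hJ hδ i _
      (abs_est_le hS hJ hδ hβ0 hβ1 hn hx₁ hv₀ hu i ht.le) (hu i _)
  have h2 := hS.diam_le i _ (state_x_mem (v₀ := v₀) (u := u) (ξ := ξ) hS hx₁ t i).1 _
    (ghost_mem (v₀ := v₀) (u := u) (ξ := ξ) hS hx₁ i t).1
  rw [dist_eq_norm] at h2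
  exact mul_le_mul h1 h2 (norm_nonneg _) ((norm_nonneg _).trans h1)

lemma continuous_replaceAction {d : Fin N → ℕ} (i : Fin N) :
    Continuous fun q : Profile d × Act (d i) => replaceAction q.1 i q.2 := by
  refine (PiLp.continuous_toLp 2 _).comp (Continuous.update ?_ i continuous_snd)
  exact continuous_pi fun k => (PiLp.continuous_apply 2 _ k).comp continuous_fst

lemma continuous_C_perturbed (hS : G.Standing Dx) (hne : ∀ i, (G.X i).Nonempty)
    (hJ : G.ConvexBounded U) (hL0 : 0 ≤ L₀) (hL : G.LipschitzCost L₀) (δ : ℝ) (i : Fin N) :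
    Continuous fun q : Profile G.d × Act (G.d i) =>
      G.C i (G.retract (replaceAction q.1 i (q.1 i + δ • q.2))) := by
  have h1 : Continuous fun q : Profile G.d × Act (G.d i) => q.1 i + δ • q.2 :=
    ((PiLp.continuous_apply 2 _ i).comp continuous_fst).add (continuous_snd.const_smul δ)
  have h2 : Continuous fun q : Profile G.d × Act (G.d i) =>
      replaceAction q.1 i (q.1 i + δ • q.2) :=
    Continuous.comp (g := fun q : Profile G.d × Act (G.d i) => replaceAction q.1 i q.2)
      (f := fun q : Profile G.d × Act (G.d i) => (q.1, q.1 i + δ • q.2))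
      (continuous_replaceAction i) (continuous_fst.prodMk h1)
  exact (continuous_C_retract hS hne hJ hL0 hL i).comp h2

lemma integrable_C_smul (hS : G.Standing Dx) (hne : ∀ i, (G.X i).Nonempty)
    (hJ : G.ConvexBounded U) (hL0 : 0 ≤ L₀) (hL : G.LipschitzCost L₀) (δ : ℝ) (i : Fin N)
    (q : Profile G.d) :
    Integrable (fun b => G.C i (G.retract (replaceAction q i (q i + δ • b))) • b)
      (uniformSphere (G.d i)) := by
  have := nontrivial_act hS i
  have hc : Continuous fun b => G.C i (G.retract (replaceAction q i (q i + δ • b))) :=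
    Continuous.comp (g := fun q : Profile G.d × Act (G.d i) =>
        G.C i (G.retract (replaceAction q.1 i (q.1 i + δ • q.2)))) (f := fun b => (q, b))
      (continuous_C_perturbed hS hne hJ hL0 hL δ i) (Continuous.prodMk_right q)
  refine Integrable.of_bound (hc.smul continuous_id).aestronglyMeasurable U ?_
  filter_upwards [ae_uniformSphere_norm_eq_one] with b hb
  rw [norm_smul, hb, mul_one]
  exact abs_C_le hS hJ i (retract_mem_joint hS hne _)

lemma inner_smoothGrad (hS : G.Standing Dx) (hne : ∀ i, (G.X i).Nonempty)
    (hJ : G.ConvexBounded U) (hL0 : 0 ≤ L₀) (hL : G.LipschitzCost L₀) (δ : ℝ) (i : Fin N)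
    (q : Profile G.d) (w : Act (G.d i)) :
    inner ℝ (G.smoothGrad δ i q) w = G.d i / δ *
      ∫ b, G.C i (G.retract (replaceAction q i (q i + δ • b))) * inner ℝ b w
        ∂uniformSphere (G.d i) := by
  rw [smoothGrad, real_inner_smul_left, real_inner_comm,
    ← integral_inner (integrable_C_smul hS hne hJ hL0 hL δ i q)]
  simp_rw [inner_smul_right, real_inner_comm]

/-- The one-point inequality for agent `i`'s own objective, with the other actions of `q` frozen.
Both actions must carry a ball of radius `δ` inside `G.X i`, which is why comparators are taken from
the shrunken set. -/
lemma C_sub_C_le_inner_smoothGrad (hS : G.Standing Dx) (hJ : G.ConvexBounded U) (hL0 : 0 ≤ L₀)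
    (hL : G.LipschitzCost L₀) {δ : ℝ} (hδ : 0 < δ) (i : Fin N) {q : Profile G.d}
    (hq : q ∈ G.joint) (hqi : q i ∈ shrink (G.X i) δ) {y : Act (G.d i)}
    (hy : y ∈ shrink (G.X i) δ) :
    G.C i q - G.C i (replaceAction q i y) ≤
      inner ℝ (G.smoothGrad δ i q) (q i - y) + 2 * L₀ * δ := by
  have hx := closedBall_subset_of_mem_shrink (hS.closed i) hqi
  have key := sub_le_integral_uniformSphere (hS.dim_pos i) hL0 hδ (convexOn_C hS hJ i hq)
    (fun a ha b hb => by
      rw [← norm_replaceAction_sub q i]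
      exact abs_C_sub_C_le hS hJ hL i (replaceAction_mem_joint hq ha)
        (replaceAction_mem_joint hq hb))
    hx (closedBall_subset_of_mem_shrink (hS.closed i) hy)
  rw [replaceAction_self] at key
  rw [inner_smoothGrad hS (fun i => ⟨_, hq i⟩) hJ hL0 hL]
  have e : ∫ b, G.C i (G.retract (replaceAction q i (q i + δ • b))) * inner ℝ b (q i - y)
        ∂uniformSphere (G.d i) =
      ∫ b, G.C i (replaceAction q i (q i + δ • b)) * inner ℝ b (q i - y)
        ∂uniformSphere (G.d i) := by
    refine integral_congr_ae ?_
    filter_upwards [ae_uniformSphere_norm_eq_one] with b hb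
    rw [retract_eq_self hS]
    refine replaceAction_mem_joint hq (hx ?_)
    simp [norm_smul, hb, abs_of_pos hδ]
  rw [e]
  exact key

/-- The `L¹` error of the distribution estimate of agent `i` after episode `t + 1`. -/
def trackingError (G : RiskGame N) (p : Params N) (x₁ : Profile G.d) (v₀ : Fin N → ℝ)
    (u : (i : Fin N) → ℕ → Act (G.d i)) (ξ : (i : Fin N) → ℕ → ℕ → G.Ξ i) (i : Fin N) (t : ℕ) :
    ℝ :=
  ∫ y, |(G.state p x₁ v₀ u ξ (t + 1)).Fbar i y - G.cdf i (G.played p x₁ v₀ u ξ (t + 1)) y|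

lemma norm_gradEstimate_le (hS : G.Standing Dx) (hJ : G.ConvexBounded U) (hδ : 0 < p.δ)
    (hβ0 : 0 ≤ p.β) (hβ1 : p.β ≤ 1) (hn : ∀ t, 1 ≤ t → t ≤ T → 0 < p.n t)
    (hx₁ : ∀ i, x₁ i ∈ shrink (G.X i) p.δ) (hv₀ : ∀ i, |v₀ i| ≤ U) (hu : ∀ i t, ‖u i t‖ = 1)
    (i : Fin N) {t : ℕ} (ht : t < T) :
    ‖G.gradEstimate p (t + 1) (G.state p x₁ v₀ u ξ t) (fun i => u i (t + 1))
      (fun i => ξ i (t + 1)) i‖ ≤ G.d i / p.δ * (2 * U) := by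
  rw [RiskGame.gradEstimate, norm_smul, hu, mul_one, norm_mul, Real.norm_of_nonneg (by positivity)]
  refine mul_le_mul_of_nonneg_left ((norm_sub_le _ _).trans ?_) (by positivity)
  have h1 := abs_est_le (ξ := ξ) hS hJ hδ hβ0 hβ1 hn hx₁ hv₀ hu i ht.le
  have h2 := abs_est_le (ξ := ξ) hS hJ hδ hβ0 hβ1 hn hx₁ hv₀ hu i (t := t + 1) ht
  rw [two_mul]
  exact add_le_add h2 h1

/-- Each component moves by at most `2 δ` through the change of direction, and by at most the
gradient step, which the projection does not lengthen because the current action already lies in the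
shrunken set. Combining `N` components in the Euclidean norm gives `√N`. -/
lemma norm_played_sub_played_le (hS : G.Standing Dx) (hJ : G.ConvexBounded U) (hδ : 0 < p.δ)
    (hη : ∀ i, 0 < p.η i)
    (hβ0 : 0 ≤ p.β) (hβ1 : p.β ≤ 1) (hn : ∀ t, 1 ≤ t → t ≤ T → 0 < p.n t)
    (hx₁ : ∀ i, x₁ i ∈ shrink (G.X i) p.δ) (hv₀ : ∀ i, |v₀ i| ≤ U) (hu : ∀ i t, ‖u i t‖ = 1)
    {k : ℝ} (hk : ∀ i, p.η i * (G.d i / p.δ * (2 * U)) ≤ k) {t : ℕ} (ht : t + 1 < T) :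
    ‖G.played p x₁ v₀ u ξ (t + 1 + 1) - G.played p x₁ v₀ u ξ (t + 1)‖ ≤
      √N * (2 * p.δ + k) := by
  have hcomp : ∀ i, ‖(G.played p x₁ v₀ u ξ (t + 1 + 1) - G.played p x₁ v₀ u ξ (t + 1)) i‖ ≤
      2 * p.δ + k := by
    intro i
    rw [PiLp.sub_apply, played_apply, played_apply]
    have e : ∀ a b c d : Act (G.d i), a + b - (c + d) = (a - c) + (b - d) := fun a b c d => by abel
    rw [e]
    refine (norm_add_le _ _).trans ?_
    have h1 : ‖p.δ • u i (t + 1 + 1) - p.δ • u i (t + 1)‖ ≤ 2 * p.δ := by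
      refine (norm_sub_le _ _).trans_eq ?_
      rw [norm_smul, norm_smul, hu, hu, Real.norm_of_nonneg hδ.le]
      ring
    have hne : (shrink (G.X i) p.δ).Nonempty := ⟨_, hx₁ i⟩
    have h2 : ‖(G.state p x₁ v₀ u ξ (t + 1)).x i - (G.state p x₁ v₀ u ξ t).x i‖ ≤ k := by
      refine (norm_nearestPoint_sub_le hne (isClosed_shrink (hS.closed i))
        (convex_shrink (hS.convex i) (hS.closed i) hδ) _
        (state_x_mem hS hx₁ t i)).trans (le_trans ?_ (hk i))
      rw [sub_sub_cancel_left, norm_neg, norm_smul, Real.norm_of_nonneg (hη i).le]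
      exact mul_le_mul_of_nonneg_left
        (norm_gradEstimate_le hS hJ hδ hβ0 hβ1 hn hx₁ hv₀ hu i (by omega)) (hη i).le
    linarith
  rw [PiLp.norm_eq_of_L2]
  obtain rfl | hN := Nat.eq_zero_or_pos N
  · simp
  · have hr : 0 ≤ 2 * p.δ + k := (norm_nonneg _).trans (hcomp ⟨0, hN⟩)
    rw [← Real.sqrt_sq hr, ← Real.sqrt_mul (Nat.cast_nonneg _)]
    refine Real.sqrt_le_sqrt ((Finset.sum_le_card_nsmul _ _ ((2 * p.δ + k) ^ 2)
      fun i _ => ?_).trans_eq (by simp))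
    exact pow_le_pow_left₀ (norm_nonneg _) (hcomp i) 2

/-- In one episode the error becomes `β` times the old error, plus `β` times the drift of the true
distribution, plus the fresh sampling error. The drift is at most `C₀ k` pointwise, on an interval
of length `2 U`. -/
lemma sum_trackingError_le (hS : G.Standing Dx) (hU : 0 ≤ U) (hJ : G.ConvexBounded U)
    (hC0 : 0 ≤ C₀) (hC : G.LipschitzCDF C₀) (hδ : 0 < p.δ) (hβ0 : 0 ≤ p.β) (hβ : p.β ≤ 1 / 2)
    (hn : ∀ t, 1 ≤ t → t ≤ T → 0 < p.n t)
    (hx₁ : ∀ i, x₁ i ∈ shrink (G.X i) p.δ) (hu : ∀ i t, ‖u i t‖ = 1)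
    {k : ℝ} (hk0 : 0 ≤ k) (hk : ∀ t, t + 1 < T →
      ‖G.played p x₁ v₀ u ξ (t + 1 + 1) - G.played p x₁ v₀ u ξ (t + 1)‖ ≤ k) (i : Fin N) :
    ∑ t ∈ Finset.range T, G.trackingError p x₁ v₀ u ξ i t ≤
      2 * ∑ t ∈ Finset.range T, G.cdfError i (p.n (t + 1)) (G.played p x₁ v₀ u ξ (t + 1))
        (ξ i (t + 1)) + 2 * T * (p.β * (2 * U * (C₀ * k))) := by
  have hβ1 : p.β ≤ 1 := by linarith
  have hmem := fun t => played_mem_joint (v₀ := v₀) (ξ := ξ) hS hδ hx₁ hu t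
  have hF := fun t => isCostCDF_cdf hS hJ i (hmem t)
  have hE := fun t (ht : t < T) => isCostCDF_edf hJ i (hn (t + 1) (by omega) ht) (hmem (t + 1))
    (ξ i (t + 1))
  have hB := isCostCDF_Fbar (v₀ := v₀) (ξ := ξ) hS hJ hδ hβ0 hβ1 hn hx₁ hu i
  -- The first episode has no momentum, so its tracking error equals its sampling error.
  refine sum_le_of_geometric_recursion hβ (by positivity)
    (fun t _ => integral_nonneg fun y => abs_nonneg _) (fun hT => le_of_eq ?_) fun t ht => ?_
  · simp only [trackingError, cdfError, state_succ_Fbar, RiskGame.momentumEdf]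
    simp [RiskGame.played]
  · have i1 := ((hB t (by omega)).integrable_sub (hF (t + 1))).abs
    have i2 := ((hF (t + 1)).integrable_sub (hF (t + 1 + 1))).abs
    have i3 := ((hE (t + 1) ht).integrable_sub (hF (t + 1 + 1))).abs
    have h2 : ∫ y, |G.cdf i (G.played p x₁ v₀ u ξ (t + 1)) y -
        G.cdf i (G.played p x₁ v₀ u ξ (t + 1 + 1)) y| ≤ 2 * U * (C₀ * k) := by
      refine (hF (t + 1)).integral_abs_sub_le hU (hF (t + 1 + 1)) fun y => ?_
      refine (hC i _ (hmem _) _ (hmem _) y).trans (mul_le_mul_of_nonneg_left ?_ hC0)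
      rw [norm_sub_rev]
      exact hk t ht
    calc G.trackingError p x₁ v₀ u ξ i (t + 1)
        ≤ ∫ y, (p.β * |(G.state p x₁ v₀ u ξ (t + 1)).Fbar i y -
              G.cdf i (G.played p x₁ v₀ u ξ (t + 1)) y| +
            p.β * |G.cdf i (G.played p x₁ v₀ u ξ (t + 1)) y -
              G.cdf i (G.played p x₁ v₀ u ξ (t + 1 + 1)) y| +
            |G.edf i (p.n (t + 1 + 1)) (G.played p x₁ v₀ u ξ (t + 1 + 1)) (ξ i (t + 1 + 1)) y -
              G.cdf i (G.played p x₁ v₀ u ξ (t + 1 + 1)) y|) := by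
          refine integral_mono ((hB (t + 1) ht).integrable_sub (hF _)).abs
            (((i1.const_mul _).add (i2.const_mul _)).add i3) fun y => ?_
          have e : (G.state p x₁ v₀ u ξ (t + 1 + 1)).Fbar i y =
              p.β * (G.state p x₁ v₀ u ξ (t + 1)).Fbar i y + (1 - p.β) *
              G.edf i (p.n (t + 1 + 1)) (G.played p x₁ v₀ u ξ (t + 1 + 1)) (ξ i (t + 1 + 1)) y := by
            rw [state_succ_Fbar]
            simp [RiskGame.momentumEdf, RiskGame.played]
          simp only [e]
          set A := (G.state p x₁ v₀ u ξ (t + 1)).Fbar i y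
          set B := G.cdf i (G.played p x₁ v₀ u ξ (t + 1)) y
          set C := G.cdf i (G.played p x₁ v₀ u ξ (t + 1 + 1)) y
          set E := G.edf i (p.n (t + 1 + 1)) (G.played p x₁ v₀ u ξ (t + 1 + 1))
            (ξ i (t + 1 + 1)) y
          have e2 : p.β * A + (1 - p.β) * E - C =
              p.β * (A - B) + p.β * (B - C) + (1 - p.β) * (E - C) := by ring
          rw [e2]
          refine (abs_add_three _ _ _).trans ?_
          rw [abs_mul, abs_mul, abs_mul, abs_of_nonneg hβ0,
            abs_of_nonneg (show 0 ≤ 1 - p.β by linarith)]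
          have := mul_le_of_le_one_left (abs_nonneg (E - C)) (show 1 - p.β ≤ 1 by linarith)
          linarith
      _ = p.β * (∫ y, |(G.state p x₁ v₀ u ξ (t + 1)).Fbar i y -
              G.cdf i (G.played p x₁ v₀ u ξ (t + 1)) y|) +
            p.β * (∫ y, |G.cdf i (G.played p x₁ v₀ u ξ (t + 1)) y -
              G.cdf i (G.played p x₁ v₀ u ξ (t + 1 + 1)) y|) +
            ∫ y, |G.edf i (p.n (t + 1 + 1)) (G.played p x₁ v₀ u ξ (t + 1 + 1))
              (ξ i (t + 1 + 1)) y - G.cdf i (G.played p x₁ v₀ u ξ (t + 1 + 1)) y| := by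
          rw [integral_add (by exact (i1.const_mul p.β).add (i2.const_mul p.β)) i3,
            integral_add (i1.const_mul _) (i2.const_mul _), integral_const_mul, integral_const_mul]
      _ ≤ _ := by
          have := mul_le_mul_of_nonneg_left h2 hβ0
          simp only [trackingError, cdfError]
          linarith

end Bounds

end RiskGame

/-! ### Pathwise regret bound -/

namespace RiskGame

variable {N : ℕ} {G : RiskGame N} {Dx U L₀ C₀ : ℝ}
variable {p : Params N} {x₁ : Profile G.d} {v₀ : Fin N → ℝ} {u : (i : Fin N) → ℕ → Act (G.d i)}
  {ξ : (i : Fin N) → ℕ → ℕ → G.Ξ i} {T : ℕ}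

/-- Move `y` by the fraction `s = δ ρ / Dx` towards the centre of the inscribed ball: the new point
carries a ball of radius `s Dx / ρ = δ`, and it has moved by at most `s Dx = δ ρ`. -/
lemma exists_shrink_near (hS : G.Standing Dx) {ρ δ : ℝ} (hρ : 0 < ρ) (hDx : 0 < Dx) (hδ : 0 < δ)
    (hδρ : δ * ρ ≤ Dx) {i : Fin N} (hne : (shrink (G.X i) δ).Nonempty)
    (hball : ∃ c, Metric.closedBall c (Dx / ρ) ⊆ G.X i) {y : Act (G.d i)} (hy : y ∈ G.X i) :
    ∃ y' ∈ shrink (G.X i) δ, ‖y' - y‖ ≤ δ * ρ := by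
  obtain ⟨c, hc⟩ := hball
  set s := δ * ρ / Dx
  have hs0 : 0 ≤ s := by positivity
  have hs1 : s ≤ 1 := (div_le_one hDx).2 hδρ
  have hcX : c ∈ G.X i := hc (Metric.mem_closedBall_self (by positivity))
  refine ⟨(1 - s) • y + s • c, ?_, ?_⟩
  · refine mem_shrink_of_closedBall_subset hδ
      (frontier_nonempty_of_mem_shrink hδ hne.some_mem) ?_
    have := closedBall_combination_subset (hS.convex i) le_rfl (by positivity : 0 ≤ Dx / ρ)
      (by simpa using hy) hc (sub_nonneg.2 hs1) hs0 (by ring)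
    have e : (1 - s) * 0 + s * (Dx / ρ) = δ := by
      simp only [s]; field_simp; ring
    rwa [e] at this
  · have e : (1 - s) • y + s • c - y = s • (c - y) := by module
    rw [e, norm_smul, Real.norm_of_nonneg hs0]
    have h1 := hS.diam_le i c hcX y hy
    rw [dist_eq_norm] at h1
    refine (mul_le_mul_of_nonneg_left h1 hs0).trans_eq ?_
    simp only [s]; field_simp

/-- Pass from the played profile to the base profile (cost `L₀ δ`), apply the one-point inequality
there (cost `2 L₀ δ`), and decompose the smoothed gradient into noise, gradient estimate and
estimation error. -/
lemma C_played_sub_le (hS : G.Standing Dx) (hJ : G.ConvexBounded U)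
    (hL0 : 0 ≤ L₀) (hL : G.LipschitzCost L₀) (hδ : 0 < p.δ)
    (hβ0 : 0 ≤ p.β) (hβ1 : p.β ≤ 1) (hn : ∀ t, 1 ≤ t → t ≤ T → 0 < p.n t)
    (hx₁ : ∀ i, x₁ i ∈ shrink (G.X i) p.δ) (hu : ∀ i t, ‖u i t‖ = 1)
    (i : Fin N) {t : ℕ} (ht : t < T) {y : Act (G.d i)} (hy : y ∈ shrink (G.X i) p.δ) :
    G.C i (G.played p x₁ v₀ u ξ (t + 1)) -
        G.C i (replaceAction (G.played p x₁ v₀ u ξ (t + 1)) i y) ≤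
      inner ℝ (G.gradEstimate p (t + 1) (G.state p x₁ v₀ u ξ t) (fun i => u i (t + 1))
        (fun i => ξ i (t + 1)) i) ((G.state p x₁ v₀ u ξ t).x i - y) +
      G.noiseIncrement p x₁ v₀ u ξ i t +
      inner ℝ (G.noiseAt p x₁ v₀ u ξ i t) (G.ghost p x₁ v₀ u ξ i t - y) +
      G.d i / p.δ * Dx * ((G.α i)⁻¹ * G.trackingError p x₁ v₀ u ξ i t) + 3 * (L₀ * p.δ) := by
  set xh := G.played p x₁ v₀ u ξ (t + 1) with hxh
  set x := (G.state p x₁ v₀ u ξ t).x i with hx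
  set q := G.baseProfile p x₁ v₀ u ξ i t with hq
  have hxmem : x ∈ shrink (G.X i) p.δ := state_x_mem hS hx₁ t i
  have hxhmem : xh ∈ G.joint := played_mem_joint hS hδ hx₁ hu (t + 1)
  have hqmem : q ∈ G.joint := replaceAction_mem_joint hxhmem hxmem.1
  have hqi : q i = x := baseProfile_apply t i
  have h1 := C_sub_C_le_inner_smoothGrad hS hJ hL0 hL hδ i hqmem (by rw [hqi]; exact hxmem) hy
  have e1 : replaceAction q i y = replaceAction xh i y := replaceAction_replaceAction _ _ _ _
  rw [hqi, e1] at h1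
  have h2 : G.C i xh - G.C i q ≤ L₀ * p.δ := by
    refine (le_abs_self _).trans ((abs_C_sub_C_le hS hJ hL i hxhmem hqmem).trans_eq ?_)
    congr 1
    have e2 : xh = replaceAction xh i (xh i) := (replaceAction_self _ _).symm
    have e3 : xh i = x + p.δ • u i (t + 1) := played_apply t i
    calc ‖xh - q‖ = ‖replaceAction xh i (xh i) - replaceAction xh i x‖ := by
          rw [replaceAction_self]; rfl
      _ = ‖p.δ • u i (t + 1)‖ := by rw [norm_replaceAction_sub, e3, add_sub_cancel_left]
      _ = p.δ := by rw [norm_smul, hu, mul_one, Real.norm_of_nonneg hδ.le]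
  set c' := (G.state p x₁ v₀ u ξ (t + 1)).est i with hc'
  set c := (G.state p x₁ v₀ u ξ t).est i with hc
  -- The noise carries the true value minus the old estimate, the gradient estimate the new minus
  -- the old one. The old estimate cancels, leaving the error of the new one.
  have e4 : G.smoothGrad p.δ i q = G.noiseAt p x₁ v₀ u ξ i t +
      G.gradEstimate p (t + 1) (G.state p x₁ v₀ u ξ t) (fun i => u i (t + 1))
        (fun i => ξ i (t + 1)) i + ((G.d i : ℝ) / p.δ * (G.C i xh - c')) • u i (t + 1) := by
    have e5 : G.gradEstimate p (t + 1) (G.state p x₁ v₀ u ξ t) (fun i => u i (t + 1))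
        (fun i => ξ i (t + 1)) i = ((G.d i : ℝ) / p.δ * (c' - c)) • u i (t + 1) := rfl
    have e6 : replaceAction q i (q i + p.δ • u i (t + 1)) = xh := by
      rw [hqi]; exact replaceAction_baseProfile t i
    rw [e5, noiseAt, gradNoise, ← hq, e6, retract_eq_self hS hxhmem]
    module
  have h3 : (G.d i : ℝ) / p.δ * (G.C i xh - c') * inner ℝ (u i (t + 1)) (x - y) ≤
      G.d i / p.δ * Dx * ((G.α i)⁻¹ * G.trackingError p x₁ v₀ u ξ i t) := by
    have b1 : |inner ℝ (u i (t + 1)) (x - y)| ≤ Dx := by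
      refine (abs_real_inner_le_norm _ _).trans ?_
      rw [hu, one_mul, ← dist_eq_norm]
      exact hS.diam_le i _ hxmem.1 _ hy.1
    have b2 : |G.C i xh - c'| ≤ (G.α i)⁻¹ * G.trackingError p x₁ v₀ u ξ i t := by
      rw [abs_sub_comm]
      exact (isCostCDF_Fbar hS hJ hδ hβ0 hβ1 hn hx₁ hu i t ht).abs_cvar_sub_cvar_le
        (isCostCDF_cdf hS hJ i hxhmem) (hS.level_pos i) (hS.level_le_one i)
    refine (le_abs_self _).trans ?_
    rw [abs_mul, abs_mul, abs_of_nonneg (show 0 ≤ (G.d i : ℝ) / p.δ by positivity), mul_assoc,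
      mul_assoc]
    refine mul_le_mul_of_nonneg_left ?_ (by positivity)
    rw [mul_comm]
    exact mul_le_mul b1 b2 (abs_nonneg _) ((abs_nonneg _).trans b1)
  rw [e4, inner_add_left, inner_add_left, real_inner_smul_left] at h1
  -- Splitting at the ghost iterate isolates a term that does not involve the comparator.
  have e7 : inner ℝ (G.noiseAt p x₁ v₀ u ξ i t) (x - y) = G.noiseIncrement p x₁ v₀ u ξ i t +
      inner ℝ (G.noiseAt p x₁ v₀ u ξ i t) (G.ghost p x₁ v₀ u ξ i t - y) := by
    rw [noiseIncrement, ← inner_add_right, sub_add_sub_cancel]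
  rw [e7] at h1
  linarith

/-- Pathwise regret bound in terms of the gradient noise and of the errors of the distribution
estimates. -/
lemma regret_le (hS : G.Standing Dx) (hDx : 0 < Dx) (hU : 0 ≤ U) (hJ : G.ConvexBounded U)
    (hL0 : 0 ≤ L₀) (hL : G.LipschitzCost L₀) (hδ : 0 < p.δ) (hη : ∀ i, 0 < p.η i)
    (hβ0 : 0 ≤ p.β) (hβ1 : p.β ≤ 1) (hn : ∀ t, 1 ≤ t → t ≤ T → 0 < p.n t)
    (hx₁ : ∀ i, x₁ i ∈ shrink (G.X i) p.δ) (hv₀ : ∀ i, |v₀ i| ≤ U) (hu : ∀ i t, ‖u i t‖ = 1)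
    {ρ : ℝ} (hρ : 0 < ρ) (hδρ : p.δ * ρ ≤ Dx) (i : Fin N)
    (hball : ∃ c, Metric.closedBall c (Dx / ρ) ⊆ G.X i) :
    G.regret i T (G.played p x₁ v₀ u ξ) ≤
      Dx ^ 2 / p.η i + p.η i * T * (G.d i / p.δ * (3 * U)) ^ 2 +
      ∑ t ∈ Finset.range T, G.noiseIncrement p x₁ v₀ u ξ i t +
      G.d i / p.δ * Dx * ((G.α i)⁻¹ * ∑ t ∈ Finset.range T, G.trackingError p x₁ v₀ u ξ i t) +
      T * ((3 + ρ) * (L₀ * p.δ)) := by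
  have hne : (shrink (G.X i) p.δ).Nonempty := ⟨_, hx₁ i⟩
  have hcl := isClosed_shrink (δ := p.δ) (hS.closed i)
  have hcv := convex_shrink (hS.convex i) (hS.closed i) hδ
  have hmem := fun t => played_mem_joint (v₀ := v₀) (ξ := ξ) hS hδ hx₁ hu t
  rw [RiskGame.regret, sub_le_comm]
  have : Nonempty (G.X i) := ⟨⟨_, (hx₁ i).1⟩⟩
  refine le_ciInf fun ⟨y, hy⟩ => ?_
  -- Replacing the comparator by one in the shrunken set costs `ρ L₀ δ` in each episode.
  obtain ⟨y', hy', hyy⟩ := exists_shrink_near hS hρ hDx hδ hδρ hne hball hy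
  rw [sub_le_comm, ← Finset.sum_sub_distrib, sum_Icc_one_eq_sum_range]
  have hdist : ∀ z ∈ shrink (G.X i) p.δ, ‖z - y'‖ ≤ Dx := fun z hz => by
    rw [← dist_eq_norm]; exact hS.diam_le i _ hz.1 _ hy'.1
  -- The gradient estimates satisfy the bound with `2 U`; `3 U` is used so that both descents share
  -- one bound.
  have ogd := sum_inner_le_of_projected_steps hne hcl hcv (hη i) T
    (x := fun t => (G.state p x₁ v₀ u ξ t).x i)
    (g := fun t => G.gradEstimate p (t + 1) (G.state p x₁ v₀ u ξ t) (fun i => u i (t + 1))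
        (fun i => ξ i (t + 1)) i) (B := G.d i / p.δ * (3 * U)) (D := Dx) (fun t _ => rfl)
    (fun t ht => (norm_gradEstimate_le hS hJ hδ hβ0 hβ1 hn hx₁ hv₀ hu i ht).trans
      (mul_le_mul_of_nonneg_left (by linarith) (by positivity))) hy' (hdist _ (hx₁ i))
  have ogd' := sum_inner_le_of_projected_steps hne hcl hcv (hη i) T
    (x := G.ghost p x₁ v₀ u ξ i) (g := G.noiseAt p x₁ v₀ u ξ i)
    (B := G.d i / p.δ * (3 * U)) (D := Dx) (fun t _ => rfl)
    (fun t ht => norm_gradNoise_le hS (fun i => ⟨_, (hx₁ i).1⟩) hJ hδ i _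
      (abs_est_le hS hJ hδ hβ0 hβ1 hn hx₁ hv₀ hu i ht.le) (hu i _)) hy' (hdist _ (hx₁ i))
  have step : ∀ t ∈ Finset.range T, G.C i (G.played p x₁ v₀ u ξ (t + 1)) -
      G.C i (replaceAction (G.played p x₁ v₀ u ξ (t + 1)) i y) ≤
      inner ℝ (G.gradEstimate p (t + 1) (G.state p x₁ v₀ u ξ t) (fun i => u i (t + 1))
        (fun i => ξ i (t + 1)) i) ((G.state p x₁ v₀ u ξ t).x i - y') +
      G.noiseIncrement p x₁ v₀ u ξ i t +
      inner ℝ (G.noiseAt p x₁ v₀ u ξ i t) (G.ghost p x₁ v₀ u ξ i t - y') +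
      G.d i / p.δ * Dx * ((G.α i)⁻¹ * G.trackingError p x₁ v₀ u ξ i t) +
      (3 + ρ) * (L₀ * p.δ) := by
    intro t ht
    have h1 := C_played_sub_le (v₀ := v₀) (ξ := ξ) hS hJ hL0 hL hδ hβ0 hβ1 hn hx₁ hu i
      (Finset.mem_range.1 ht) hy'
    have h2 := (abs_le.1 (abs_C_sub_C_le hS hJ hL i (replaceAction_mem_joint (hmem (t + 1)) hy'.1)
      (replaceAction_mem_joint (hmem (t + 1)) hy))).2
    rw [norm_replaceAction_sub] at h2
    have h3 := mul_le_mul_of_nonneg_left hyy hL0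
    linarith
  refine (Finset.sum_le_sum step).trans ?_
  simp only [Finset.sum_add_distrib, ← Finset.mul_sum, Finset.sum_const, Finset.card_range,
    nsmul_eq_mul]
  have e : Dx ^ 2 / p.η i = 2 * (Dx ^ 2 / (2 * p.η i)) := by
    have := (hη i).ne'
    field_simp
  rw [e]
  linarith

/-- Valid for every `β`, hence also for the short horizons on which the momentum weight or the
perturbation is too large for the main bound. -/
lemma regret_le_trivial (hS : G.Standing Dx) (hJ : G.ConvexBounded U) (hδ : 0 < p.δ)
    (hx₁ : ∀ i, x₁ i ∈ shrink (G.X i) p.δ) (hu : ∀ i t, ‖u i t‖ = 1) (i : Fin N) :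
    G.regret i T (G.played p x₁ v₀ u ξ) ≤ 2 * U * T := by
  have hmem := fun t => played_mem_joint (v₀ := v₀) (ξ := ξ) hS hδ hx₁ hu t
  rw [RiskGame.regret, sub_le_comm]
  have : Nonempty (G.X i) := ⟨⟨_, (hx₁ i).1⟩⟩
  refine le_ciInf fun ⟨y, hy⟩ => ?_
  rw [sub_le_comm, ← Finset.sum_sub_distrib]
  refine (Finset.sum_le_card_nsmul _ _ (2 * U) fun t _ => ?_).trans_eq
    (by rw [Nat.card_Icc, nsmul_eq_mul, Nat.add_sub_cancel]; ring)
  have h1 := (abs_le.1 (abs_C_le hS hJ i (hmem t))).2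
  have h2 := (abs_le.1 (abs_C_le hS hJ i (replaceAction_mem_joint (hmem t) hy))).1
  simp only
  linarith

end RiskGame

/-! ### Measurability of the run -/

/-- The tail integral decreases in `z`, so passing to a slightly larger rational raises the
objective by at most the shift. A countable infimum is what makes CVaR measurable. -/
lemma cvar_eq_iInf_rat {U α : ℝ} {F : ℝ → ℝ} (hF : IsCostCDF U F) (h0 : 0 < α) (h1 : α ≤ 1) :
    cvar α F = ⨅ q : ℚ, ((q : ℝ) + α⁻¹ * ∫ y in Set.Ioi (q : ℝ), (1 - F y)) := by
  have hbdd := hF.bddBelow_cvar h0 h1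
  have hbdd' : BddBelow (Set.range fun q : ℚ =>
      ((q : ℝ) + α⁻¹ * ∫ y in Set.Ioi (q : ℝ), (1 - F y))) :=
    hbdd.mono (by rintro _ ⟨q, rfl⟩; exact ⟨(q : ℝ), rfl⟩)
  refine le_antisymm (le_ciInf fun q => ciInf_le hbdd (q : ℝ)) (le_ciInf fun z => ?_)
  refine le_of_forall_pos_le_add fun ε hε => ?_
  obtain ⟨q, hq1, hq2⟩ := exists_rat_btwn (show z < z + ε by linarith)
  refine (ciInf_le hbdd' q).trans ?_
  have : ∫ y in Set.Ioi (q : ℝ), (1 - F y) ≤ ∫ y in Set.Ioi z, (1 - F y) :=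
    setIntegral_mono_set (hF.integrableOn_one_sub z)
      (.of_forall fun y => sub_nonneg.2 (hF.le_one y)) (Set.Ioi_subset_Ioi hq1.le).eventuallyLE
  have := mul_le_mul_of_nonneg_left this (inv_nonneg.2 h0.le)
  linarith

lemma measurable_cvar {Ω : Type*} {mΩ : MeasurableSpace Ω} {U α : ℝ} {F : Ω → ℝ → ℝ}
    (hm : Measurable (Function.uncurry F)) (hF : ∀ ω, IsCostCDF U (F ω)) (h0 : 0 < α)
    (h1 : α ≤ 1) : Measurable fun ω => cvar α (F ω) := by
  simp_rw [fun ω => cvar_eq_iInf_rat (hF ω) h0 h1]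
  refine Measurable.iInf fun q => (Measurable.const_mul ?_ _).const_add _
  exact (measurable_const.sub hm).stronglyMeasurable.integral_prod_right.measurable

namespace RiskGame

variable {N : ℕ} {G : RiskGame N} {Dx U L₀ C₀ : ℝ}
variable {p : Params N} {x₁ : Profile G.d} {v₀ : Fin N → ℝ} {T : ℕ}
variable {Ω : Type*} {mΩ : MeasurableSpace Ω} {u : (i : Fin N) → ℕ → Ω → Act (G.d i)}
  {ξ : (i : Fin N) → ℕ → ℕ → Ω → G.Ξ i}

lemma measurable_profile {d : Fin N → ℕ} {f : Ω → (i : Fin N) → Act (d i)}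
    (hf : ∀ i, Measurable fun ω => f ω i) :
    Measurable fun ω => (WithLp.toLp 2 (f ω) : Profile d) :=
  (WithLp.measurable_toLp 2 _).comp (measurable_pi_lambda _ hf)

lemma measurable_profile_apply {d : Fin N → ℕ} {f : Ω → Profile d} (hf : Measurable f)
    (i : Fin N) : Measurable fun ω => f ω i :=
  (PiLp.continuous_apply 2 _ i).measurable.comp hf

lemma measurable_edf (hS : G.Standing Dx) (hL0 : 0 ≤ L₀) (hL : G.LipschitzCost L₀) (i : Fin N)
    (n : ℕ) {x : Ω → Profile G.d} (hx : Measurable x) (hxm : ∀ ω, x ω ∈ G.joint)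
    {ζ : Ω → ℕ → G.Ξ i} (hζ : ∀ j, Measurable fun ω => ζ ω j) :
    Measurable fun q : Ω × ℝ => G.edf i n (x q.1) (ζ q.1) q.2 := by
  unfold RiskGame.edf
  refine (Finset.measurable_fun_sum _ fun j _ => ?_).const_mul _
  have hJm : Measurable fun ω => G.J i (x ω) (ζ ω j) := by
    by_cases hΩ : Nonempty Ω
    · have hne : ∀ i, (G.X i).Nonempty := fun i => ⟨_, hxm hΩ.some i⟩
      have h := (measurable_J_retract hS hne hL0 hL i).comp (hx.prodMk (hζ j))
      have e : (fun ω => G.J i (x ω) (ζ ω j)) = fun ω => G.J i (G.retract (x ω)) (ζ ω j) := by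
        funext ω
        rw [retract_eq_self hS (hxm ω)]
      rw [e]
      exact h
    · have := not_nonempty_iff.1 hΩ
      exact measurable_of_empty _
  have e : (fun q : Ω × ℝ => Set.indicator {c : ℝ | c ≤ q.2} (1 : ℝ → ℝ)
      (G.J i (x q.1) (ζ q.1 j))) =
      Set.indicator {q : Ω × ℝ | G.J i (x q.1) (ζ q.1 j) ≤ q.2} 1 := by
    funext q
    simp [Set.indicator_apply]
  rw [e]
  exact measurable_one.indicator
    (measurableSet_le (hJm.comp measurable_fst) measurable_snd)

lemma measurable_perturb {x : Ω → Profile G.d} (hx : Measurable x)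
    {w : Ω → (i : Fin N) → Act (G.d i)} (hw : ∀ i, Measurable fun ω => w ω i) :
    Measurable fun ω => G.perturb p (x ω) (w ω) :=
  measurable_profile fun i => (measurable_profile_apply hx i).add ((hw i).const_smul p.δ)

/-- Measurability of the state in the directions and samples used so far. -/
lemma measurable_state (hS : G.Standing Dx) (hJ : G.ConvexBounded U) (hL0 : 0 ≤ L₀)
    (hL : G.LipschitzCost L₀) (hδ : 0 < p.δ) (hβ0 : 0 ≤ p.β) (hβ1 : p.β ≤ 1)
    (hn : ∀ t, 1 ≤ t → t ≤ T → 0 < p.n t)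
    (hx₁ : ∀ i, x₁ i ∈ shrink (G.X i) p.δ) (hu : ∀ i t ω, ‖u i t ω‖ = 1) :
    ∀ t ≤ T, (∀ i, ∀ s ≤ t, Measurable (u i s)) → (∀ i, ∀ s ≤ t, ∀ j, Measurable (ξ i s j)) →
      Measurable (fun ω => (G.state p x₁ v₀ (fun i t => u i t ω) (fun i t j => ξ i t j ω) t).x) ∧
      (∀ i, Measurable fun q : Ω × ℝ =>
        (G.state p x₁ v₀ (fun i t => u i t q.1) (fun i t j => ξ i t j q.1) t).Fbar i q.2) ∧
      ∀ i, Measurable fun ω =>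
        (G.state p x₁ v₀ (fun i t => u i t ω) (fun i t j => ξ i t j ω) t).est i := by
  intro t
  induction t with
  | zero => exact fun _ _ _ => ⟨measurable_const, fun i => measurable_const,
      fun i => measurable_const⟩
  | succ t ih =>
    intro ht hmu hmξ
    obtain ⟨h1, h2, h3⟩ := ih (by omega) (fun i s hs => hmu i s (by omega))
      (fun i s hs => hmξ i s (by omega))
    have hplayed : Measurable fun ω => G.perturb p
        (G.state p x₁ v₀ (fun i t => u i t ω) (fun i t j => ξ i t j ω) t).x
        (fun i => u i (t + 1) ω) := measurable_perturb h1 fun i => hmu i (t + 1) le_rfl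
    have hF : ∀ i, Measurable fun q : Ω × ℝ =>
        (G.state p x₁ v₀ (fun i t => u i t q.1) (fun i t j => ξ i t j q.1) (t + 1)).Fbar i q.2 := by
      intro i
      have he := measurable_edf hS hL0 hL i (p.n (t + 1)) hplayed (fun ω =>
        perturb_mem_joint hS hδ (fun i => state_x_mem hS hx₁ t i) fun i => hu i (t + 1) ω)
        (ζ := fun ω j => ξ i (t + 1) j ω) fun j => hmξ i (t + 1) le_rfl j
      simp only [state_succ_Fbar, RiskGame.momentumEdf]
      split_ifs
      · exact he
      · exact ((h2 i).const_mul _).add (he.const_mul _)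
    have hE : ∀ i, Measurable fun ω =>
        (G.state p x₁ v₀ (fun i t => u i t ω) (fun i t j => ξ i t j ω) (t + 1)).est i := fun i =>
      measurable_cvar (hF i) (fun ω => isCostCDF_Fbar hS hJ hδ hβ0 hβ1 hn hx₁
        (fun i t => hu i t ω) i t ht) (hS.level_pos i) (hS.level_le_one i)
    refine ⟨measurable_profile fun i => ?_, hF, hE⟩
    refine (continuous_nearestPoint ⟨_, hx₁ i⟩ (isClosed_shrink (hS.closed i))
      (convex_shrink (hS.convex i) (hS.closed i) hδ)).measurable.comp ?_
    have hg : Measurable fun ω => G.gradEstimate p (t + 1)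
        (G.state p x₁ v₀ (fun i t => u i t ω) (fun i t j => ξ i t j ω) t)
        (fun i => u i (t + 1) ω) (fun i j => ξ i (t + 1) j ω) i :=
      (((hE i).sub (h3 i)).const_mul _).smul (hmu i (t + 1) le_rfl)
    exact (measurable_profile_apply h1 i).sub (hg.const_smul (p.η i))

lemma measurable_smoothGrad (hS : G.Standing Dx) (hne : ∀ i, (G.X i).Nonempty)
    (hJ : G.ConvexBounded U) (hL0 : 0 ≤ L₀) (hL : G.LipschitzCost L₀) (δ : ℝ) (i : Fin N) :
    Measurable (G.smoothGrad δ i) := by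
  have := nontrivial_act hS i
  have h : Measurable fun q : Profile G.d × Act (G.d i) =>
      G.C i (G.retract (replaceAction q.1 i (q.1 i + δ • q.2))) • q.2 :=
    (continuous_C_perturbed hS hne hJ hL0 hL δ i).measurable.smul measurable_snd
  have h2 := h.stronglyMeasurable.integral_prod_right' (ν := uniformSphere (G.d i))
  exact h2.measurable.const_smul ((G.d i : ℝ) / δ)

lemma measurable_gradNoise (hS : G.Standing Dx) (hne : ∀ i, (G.X i).Nonempty)
    (hJ : G.ConvexBounded U) (hL0 : 0 ≤ L₀) (hL : G.LipschitzCost L₀) (δ : ℝ) (i : Fin N)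
    {q : Ω → Profile G.d} (hq : Measurable q) {c : Ω → ℝ} (hc : Measurable c)
    {b : Ω → Act (G.d i)} (hb : Measurable b) :
    Measurable fun ω => G.gradNoise δ i (q ω) (c ω) (b ω) := by
  have h1 : Measurable fun ω =>
      G.C i (G.retract (replaceAction (q ω) i (q ω i + δ • b ω))) :=
    Measurable.comp (g := fun q : Profile G.d × Act (G.d i) =>
        G.C i (G.retract (replaceAction q.1 i (q.1 i + δ • q.2)))) (f := fun ω => (q ω, b ω))
      (continuous_C_perturbed hS hne hJ hL0 hL δ i).measurable (hq.prodMk hb)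
  exact ((measurable_smoothGrad hS hne hJ hL0 hL δ i).comp hq).sub
    (((h1.sub hc).const_mul _).smul hb)

lemma measurable_baseProfile {i : Fin N} {t : ℕ}
    (hx : Measurable fun ω =>
      (G.state p x₁ v₀ (fun i t => u i t ω) (fun i t j => ξ i t j ω) t).x)
    (hu : ∀ k, k ≠ i → Measurable (u k (t + 1))) :
    Measurable fun ω => G.baseProfile p x₁ v₀ (fun i t => u i t ω) (fun i t j => ξ i t j ω) i t := by
  refine measurable_profile fun k => ?_
  by_cases h : k = i
  · subst h
    simpa using measurable_profile_apply hx k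
  · simp only [ne_eq, h, not_false_eq_true, Function.update_of_ne, played_apply]
    exact (measurable_profile_apply hx k).add ((hu k h).const_smul p.δ)

lemma measurable_noiseAt (hS : G.Standing Dx) (hJ : G.ConvexBounded U) (hL0 : 0 ≤ L₀)
    (hL : G.LipschitzCost L₀) (hδ : 0 < p.δ) (hβ0 : 0 ≤ p.β) (hβ1 : p.β ≤ 1)
    (hn : ∀ t, 1 ≤ t → t ≤ T → 0 < p.n t)
    (hx₁ : ∀ i, x₁ i ∈ shrink (G.X i) p.δ) (hu : ∀ i t ω, ‖u i t ω‖ = 1) (i : Fin N)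
    {t : ℕ} (ht : t < T) (hmu : ∀ i, ∀ s ≤ t + 1, Measurable (u i s))
    (hmξ : ∀ i, ∀ s ≤ t, ∀ j, Measurable (ξ i s j)) :
    Measurable fun ω => G.noiseAt p x₁ v₀ (fun i t => u i t ω) (fun i t j => ξ i t j ω) i t := by
  obtain ⟨h1, -, h3⟩ := measurable_state (v₀ := v₀) hS hJ hL0 hL hδ hβ0 hβ1 hn hx₁ hu t ht.le
    (fun i s hs => hmu i s (by omega)) hmξ
  exact measurable_gradNoise hS (fun i => ⟨_, (hx₁ i).1⟩) hJ hL0 hL p.δ i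
    (measurable_baseProfile h1 fun k _ => hmu k (t + 1) le_rfl) (h3 i) (hmu i (t + 1) le_rfl)

lemma measurable_ghost (hS : G.Standing Dx) (hJ : G.ConvexBounded U) (hL0 : 0 ≤ L₀)
    (hL : G.LipschitzCost L₀) (hδ : 0 < p.δ) (hβ0 : 0 ≤ p.β) (hβ1 : p.β ≤ 1)
    (hn : ∀ t, 1 ≤ t → t ≤ T → 0 < p.n t)
    (hx₁ : ∀ i, x₁ i ∈ shrink (G.X i) p.δ) (hu : ∀ i t ω, ‖u i t ω‖ = 1) (i : Fin N) :
    ∀ t ≤ T, (∀ i, ∀ s ≤ t, Measurable (u i s)) → (∀ i, ∀ s ≤ t, ∀ j, Measurable (ξ i s j)) →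
    Measurable fun ω => G.ghost p x₁ v₀ (fun i t => u i t ω) (fun i t j => ξ i t j ω) i t := by
  intro t
  induction t with
  | zero => exact fun _ _ _ => measurable_const
  | succ t ih =>
    intro ht hmu hmξ
    have h1 := ih (by omega) (fun i s hs => hmu i s (by omega)) (fun i s hs => hmξ i s (by omega))
    have h2 := measurable_noiseAt (v₀ := v₀) hS hJ hL0 hL hδ hβ0 hβ1 hn hx₁ hu i ht hmu
      (fun i s hs => hmξ i s (by omega))
    exact (continuous_nearestPoint ⟨_, hx₁ i⟩ (isClosed_shrink (hS.closed i))
      (convex_shrink (hS.convex i) (hS.closed i) hδ)).measurable.comp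
        (h1.sub (h2.const_smul (p.η i)))

lemma measurable_noiseIncrement (hS : G.Standing Dx) (hJ : G.ConvexBounded U) (hL0 : 0 ≤ L₀)
    (hL : G.LipschitzCost L₀) (hδ : 0 < p.δ) (hβ0 : 0 ≤ p.β) (hβ1 : p.β ≤ 1)
    (hn : ∀ t, 1 ≤ t → t ≤ T → 0 < p.n t)
    (hx₁ : ∀ i, x₁ i ∈ shrink (G.X i) p.δ) (hu : ∀ i t ω, ‖u i t ω‖ = 1) (i : Fin N)
    {t : ℕ} (ht : t < T) (hmu : ∀ i, ∀ s ≤ t + 1, Measurable (u i s))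
    (hmξ : ∀ i, ∀ s ≤ t, ∀ j, Measurable (ξ i s j)) :
    Measurable fun ω =>
      G.noiseIncrement p x₁ v₀ (fun i t => u i t ω) (fun i t j => ξ i t j ω) i t := by
  have hmu' := fun i s (hs : s ≤ t) => hmu i s (by omega)
  obtain ⟨h1, -, -⟩ := measurable_state (v₀ := v₀) hS hJ hL0 hL hδ hβ0 hβ1 hn hx₁ hu t ht.le
    hmu' hmξ
  exact (measurable_noiseAt hS hJ hL0 hL hδ hβ0 hβ1 hn hx₁ hu i ht hmu hmξ).inner
    ((measurable_profile_apply h1 i).sub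
      (measurable_ghost hS hJ hL0 hL hδ hβ0 hβ1 hn hx₁ hu i t ht.le hmu' hmξ))

lemma measurable_cdf (hS : G.Standing Dx) (hL0 : 0 ≤ L₀) (hL : G.LipschitzCost L₀) (i : Fin N)
    (hne : ∀ i, (G.X i).Nonempty) :
    Measurable fun q : Profile G.d × ℝ => G.cdf i (G.retract q.1) q.2 := by
  have := hS.law_prob i
  have hJm := measurable_J_retract hS hne hL0 hL i
  have hs : MeasurableSet {w : (Profile G.d × ℝ) × G.Ξ i | G.J i (G.retract w.1.1) w.2 ≤ w.1.2} :=
    measurableSet_le (Measurable.comp (g := fun q : Profile G.d × G.Ξ i =>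
        G.J i (G.retract q.1) q.2) (f := fun w : (Profile G.d × ℝ) × G.Ξ i => (w.1.1, w.2)) hJm
      ((measurable_fst.comp measurable_fst).prodMk measurable_snd))
      (measurable_snd.comp measurable_fst)
  exact (measurable_measure_prodMk_left hs).ennreal_toReal

/-- Joint measurability of the error of the empirical distribution function. -/
lemma measurable_cdfError (hS : G.Standing Dx) (hL0 : 0 ≤ L₀) (hL : G.LipschitzCost L₀)
    (i : Fin N) (n : ℕ) (hne : ∀ i, (G.X i).Nonempty) :
    Measurable fun q : Profile G.d × (ℕ → G.Ξ i) => G.cdfError i n (G.retract q.1) q.2 := by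
  have h1 := measurable_edf (Ω := Profile G.d × (ℕ → G.Ξ i)) hS hL0 hL i n
    (x := fun q => G.retract q.1) (ζ := fun q => q.2)
    ((continuous_retract hS hne).measurable.comp measurable_fst)
    (fun q => retract_mem_joint hS hne _) fun j => (measurable_pi_apply j).comp measurable_snd
  have h2 : Measurable fun w : (Profile G.d × (ℕ → G.Ξ i)) × ℝ =>
      G.cdf i (G.retract w.1.1) w.2 :=
    Measurable.comp (g := fun q : Profile G.d × ℝ => G.cdf i (G.retract q.1) q.2)
      (f := fun w : (Profile G.d × (ℕ → G.Ξ i)) × ℝ => (w.1.1, w.2))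
      (measurable_cdf hS hL0 hL i hne)
      ((measurable_fst.comp measurable_fst).prodMk measurable_snd)
  have h3 := (h1.sub h2).norm
  exact h3.stronglyMeasurable.integral_prod_right'.measurable

end RiskGame

/-! ### Centring of the noise and mean sampling error -/

/-- The spherical inequality for a constant function, with Lipschitz constant `0`, makes the
integral nonnegative for every vector; apply this to `w` and to `-w`. -/
lemma integral_inner_uniformSphere {n : ℕ} [Nontrivial (Act n)] (w : Act n) :
    ∫ b, inner ℝ b w ∂uniformSphere n = 0 := by
  have key : ∀ v : Act n, 0 ≤ ∫ b, inner ℝ b v ∂uniformSphere n := by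
    intro v
    have h := sub_le_integral_sphere_of_convex_segment (K := 0) (h := fun _ : Act n => (1 : ℝ))
      (v := v) (LipschitzWith.const 1) (fun w _ s _ => by linarith)
    simp only [sub_self, NNReal.coe_zero, mul_zero, mul_one] at h
    refine nonneg_of_mul_nonneg_right h ?_
    have hn : n ≠ 0 := by
      rintro rfl
      exact not_subsingleton (Act 0) inferInstance
    exact_mod_cast Nat.pos_of_ne_zero hn
  refine le_antisymm ?_ (key w)
  have := key (-w)
  simp only [inner_neg_right, integral_neg] at this
  linarith

namespace RiskGame

variable {N : ℕ} {G : RiskGame N} {Dx U L₀ C₀ : ℝ}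
variable {p : Params N} {x₁ : Profile G.d} {v₀ : Fin N → ℝ} {T : ℕ}

/-- The smoothed gradient is the mean of the cost part, and the residual `c` does not depend on the
direction, whose mean is zero. -/
lemma integral_inner_gradNoise (hS : G.Standing Dx) (hne : ∀ i, (G.X i).Nonempty)
    (hJ : G.ConvexBounded U) (hL0 : 0 ≤ L₀) (hL : G.LipschitzCost L₀) (δ : ℝ) (i : Fin N)
    (q : Profile G.d) (c : ℝ) (w : Act (G.d i)) :
    ∫ b, inner ℝ (G.gradNoise δ i q c b) w ∂uniformSphere (G.d i) = 0 := by
  have := nontrivial_act hS i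
  set k : ℝ := (G.d i : ℝ) / δ
  have i1 : Integrable (fun b => G.C i (G.retract (replaceAction q i (q i + δ • b))) *
      inner ℝ b w) (uniformSphere (G.d i)) := by
    refine ((integrable_C_smul hS hne hJ hL0 hL δ i q).inner_const w).congr (.of_forall fun b => ?_)
    simp [real_inner_smul_left]
  have i2 : Integrable (fun b => inner ℝ b w) (uniformSphere (G.d i)) := by
    refine Integrable.of_bound (by fun_prop) ‖w‖ ?_
    filter_upwards [ae_uniformSphere_norm_eq_one] with b hb
    have := abs_real_inner_le_norm b w
    rwa [hb, one_mul] at this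
  have e : ∀ b, inner ℝ (G.gradNoise δ i q c b) w = inner ℝ (G.smoothGrad δ i q) w -
      k * (G.C i (G.retract (replaceAction q i (q i + δ • b))) * inner ℝ b w) +
      k * c * inner ℝ b w := fun b => by
    rw [gradNoise, inner_sub_left, real_inner_smul_left]
    ring
  simp_rw [e]
  rw [integral_add (by exact (integrable_const _).sub (i1.const_mul k)) (i2.const_mul _),
    integral_sub (integrable_const _) (i1.const_mul k), integral_const_mul, integral_const_mul,
    integral_inner_uniformSphere, inner_smoothGrad hS hne hJ hL0 hL, integral_const]
  simp [k]

variable {Ω : Type*} {mΩ : MeasurableSpace Ω} {μ : Measure Ω}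
  {u : (i : Fin N) → ℕ → Ω → Act (G.d i)} {ξ : (i : Fin N) → ℕ → ℕ → Ω → G.Ξ i}

/-- The σ-algebras generated by the single directions and by the noise vectors. -/
abbrev sources (G : RiskGame N) (u : (i : Fin N) → ℕ → Ω → Act (G.d i))
    (ξ : (i : Fin N) → ℕ → ℕ → Ω → G.Ξ i) : (Fin N × ℕ) ⊕ (ℕ × ℕ) → MeasurableSpace Ω :=
  Sum.elim (fun k => MeasurableSpace.comap (u k.1 k.2) inferInstance)
    (fun q => MeasurableSpace.comap (fun ω i => ξ i q.1 q.2 ω) inferInstance)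

lemma sources_le (h : G.IsSampling μ u ξ) (k : (Fin N × ℕ) ⊕ (ℕ × ℕ)) :
    sources G u ξ k ≤ mΩ := by
  rcases k with k | q
  · exact (h.measurable_dir k.1 k.2).comap_le
  · exact (measurable_pi_lambda _ fun i => h.measurable_noise i q.1 q.2).comap_le

variable [IsProbabilityMeasure μ]

lemma iIndep_sources (h : G.IsSampling μ u ξ) : iIndep (sources G u ξ) μ := by
  refine iIndep_sumElim ((iIndepFun_iff_iIndep _ _ _).1 h.indep_dir)
    ((iIndepFun_iff_iIndep _ _ _).1 h.indep_noise) ?_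
  have hi := (IndepFun_iff_Indep _ _ _).1 h.indep_dir_noise
  refine indep_of_indep_of_le_left (indep_of_indep_of_le_right hi (iSup_le fun q => ?_))
    (iSup_le fun k => ?_)
  · have : (fun ω i => ξ i q.1 q.2 ω) = (fun f : (ℕ × ℕ) → (i : Fin N) → G.Ξ i => f q) ∘
      (fun ω (q : ℕ × ℕ) (i : Fin N) => ξ i q.1 q.2 ω) := rfl
    rw [this, ← MeasurableSpace.comap_comp]
    exact MeasurableSpace.comap_mono (measurable_pi_apply q).comap_le
  · have : u k.1 k.2 = (fun f : (k : Fin N × ℕ) → Act (G.d k.1) => f k) ∘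
      (fun ω (k : Fin N × ℕ) => u k.1 k.2 ω) := rfl
    rw [this, ← MeasurableSpace.comap_comp]
    exact MeasurableSpace.comap_mono (measurable_pi_apply k).comap_le

lemma measurable_dir_sources {S : Set ((Fin N × ℕ) ⊕ (ℕ × ℕ))} {i : Fin N} {t : ℕ}
    (h : .inl (i, t) ∈ S) : Measurable[⨆ k ∈ S, sources G u ξ k] (u i t) := by
  refine Measurable.mono (comap_measurable (u i t)) ?_ le_rfl
  exact le_iSup₂_of_le (f := fun k (_ : k ∈ S) => sources G u ξ k) (.inl (i, t)) h le_rfl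

lemma measurable_noise_sources {S : Set ((Fin N × ℕ) ⊕ (ℕ × ℕ))} {t j : ℕ}
    (h : .inr (t, j) ∈ S) (i : Fin N) : Measurable[⨆ k ∈ S, sources G u ξ k] (ξ i t j) := by
  have h1 : Measurable[MeasurableSpace.comap (fun ω i => ξ i t j ω) inferInstance] (ξ i t j) :=
    (measurable_pi_apply i).comp (comap_measurable fun ω i => ξ i t j ω)
  refine Measurable.mono h1 ?_ le_rfl
  exact le_iSup₂_of_le (f := fun k (_ : k ∈ S) => sources G u ξ k) (.inr (t, j)) h le_rfl

/-- All ingredients except `u i (t + 1)` are functions of sources independent of it. With these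
frozen, integrating over the direction gives `0`. -/
lemma integral_exp_mul_noiseIncrement_nonpos (hS : G.Standing Dx)
    (hJ : G.ConvexBounded U)
    (hL0 : 0 ≤ L₀) (hL : G.LipschitzCost L₀) (hδ : 0 < p.δ) (hβ0 : 0 ≤ p.β) (hβ1 : p.β ≤ 1)
    (hn : ∀ t, 1 ≤ t → t ≤ T → 0 < p.n t)
    (hx₁ : ∀ i, x₁ i ∈ shrink (G.X i) p.δ) (hv₀ : ∀ i, |v₀ i| ≤ U)
    (hs : G.IsSampling μ u ξ) (hu : ∀ i t ω, ‖u i t ω‖ = 1) (i : Fin N)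
    {t : ℕ} (ht : t < T) {l : ℝ} (hl : 0 < l) :
    ∫ ω, Real.exp (l * ∑ s ∈ Finset.range t,
        G.noiseIncrement p x₁ v₀ (fun i t => u i t ω) (fun i t j => ξ i t j ω) i s) *
      G.noiseIncrement p x₁ v₀ (fun i t => u i t ω) (fun i t j => ξ i t j ω) i t ∂μ ≤ 0 := by
  have hne : ∀ i, (G.X i).Nonempty := fun i => ⟨_, (hx₁ i).1⟩
  -- The base profile contains the other agents' perturbations of episode `t + 1`, so their
  -- directions belong to `S`. The samples of that episode do not enter, since the noise is built
  -- from the true objective.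
  let S : Set ((Fin N × ℕ) ⊕ (ℕ × ℕ)) := {k | Sum.elim (fun k : Fin N × ℕ => k.2 ≤ t ∨
    (k.2 = t + 1 ∧ k.1 ≠ i)) (fun q : ℕ × ℕ => q.1 ≤ t) k}
  let S' : Set ((Fin N × ℕ) ⊕ (ℕ × ℕ)) := {.inl (i, t + 1)}
  have hd : Disjoint S S' := by
    rw [Set.disjoint_singleton_right]
    simp [S]
  have hmu : ∀ k, ∀ s ≤ t, Measurable[⨆ k ∈ S, sources G u ξ k] (u k s) := fun k s hs' =>
    measurable_dir_sources (by simp [S, hs'])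
  have hmu' : ∀ k, k ≠ i → Measurable[⨆ k ∈ S, sources G u ξ k] (u k (t + 1)) := fun k hk =>
    measurable_dir_sources (by simp [S, hk])
  have hmξ : ∀ k, ∀ s ≤ t, ∀ j, Measurable[⨆ k ∈ S, sources G u ξ k] (ξ k s j) :=
    fun k s hs' j => measurable_noise_sources (by simp [S, hs']) k
  -- The measurability lemmas hold for any σ-algebra on `Ω`; here it is the one generated by the
  -- sources in `S`, as the independence argument requires.
  obtain ⟨m1, -, m3⟩ := measurable_state (mΩ := ⨆ k ∈ S, sources G u ξ k) (v₀ := v₀) hS hJ hL0 hL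
    hδ hβ0 hβ1 hn hx₁ hu t ht.le hmu hmξ
  have m4 := measurable_ghost (mΩ := ⨆ k ∈ S, sources G u ξ k) (v₀ := v₀) hS hJ hL0 hL hδ hβ0 hβ1
    hn hx₁ hu i t ht.le hmu hmξ
  have m5 := measurable_baseProfile (mΩ := ⨆ k ∈ S, sources G u ξ k) m1 hmu'
  have m6 := Finset.measurable_fun_sum (m := ⨆ k ∈ S, sources G u ξ k) (Finset.range t)
    fun s hs' =>
    measurable_noiseIncrement (mΩ := ⨆ k ∈ S, sources G u ξ k) (v₀ := v₀) hS hJ hL0 hL hδ hβ0 hβ1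
      hn hx₁ hu i ((Finset.mem_range.1 hs').trans ht)
      (fun k r hr => hmu k r (by have := Finset.mem_range.1 hs'; omega))
      (fun k r hr => hmξ k r (by have := Finset.mem_range.1 hs'; omega))
  let A : Ω → ℝ × Profile G.d × ℝ × Act (G.d i) := fun ω =>
    (∑ s ∈ Finset.range t,
      G.noiseIncrement p x₁ v₀ (fun i t => u i t ω) (fun i t j => ξ i t j ω) i s,
    G.baseProfile p x₁ v₀ (fun i t => u i t ω) (fun i t j => ξ i t j ω) i t,
    (G.state p x₁ v₀ (fun i t => u i t ω) (fun i t j => ξ i t j ω) t).est i,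
    G.ghost p x₁ v₀ (fun i t => u i t ω) (fun i t j => ξ i t j ω) i t)
  have hA : Measurable[⨆ k ∈ S, sources G u ξ k] A := m6.prodMk (m5.prodMk ((m3 i).prodMk m4))
  have hind : IndepFun A (u i (t + 1)) μ :=
    indepFun_of_iIndep_of_measurable (sources_le hs) (iIndep_sources hs) hd hA
      (measurable_dir_sources rfl)
  have hAm : Measurable A := hA.mono (iSup₂_le fun k _ => sources_le hs k) le_rfl
  let f : ℝ × Profile G.d × ℝ × Act (G.d i) → Act (G.d i) → ℝ := fun a b =>
    Real.exp (l * a.1) * inner ℝ (G.gradNoise p.δ i a.2.1 a.2.2.1 b) (a.2.1 i - a.2.2.2)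
  have hf : Measurable (Function.uncurry f) := by
    have q1 : Measurable fun w : (ℝ × Profile G.d × ℝ × Act (G.d i)) × Act (G.d i) => w.1.2.1 := by
      fun_prop
    refine ((by fun_prop : Measurable fun w :
      (ℝ × Profile G.d × ℝ × Act (G.d i)) × Act (G.d i) => Real.exp (l * w.1.1))).mul
      (Measurable.inner ?_ ?_)
    · exact measurable_gradNoise hS hne hJ hL0 hL p.δ i q1 (by fun_prop) (by fun_prop)
    · exact (measurable_profile_apply q1 i).sub (by fun_prop)
  have e : ∀ ω, Real.exp (l * ∑ s ∈ Finset.range t,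
        G.noiseIncrement p x₁ v₀ (fun i t => u i t ω) (fun i t j => ξ i t j ω) i s) *
      G.noiseIncrement p x₁ v₀ (fun i t => u i t ω) (fun i t j => ξ i t j ω) i t =
      f (A ω) (u i (t + 1) ω) := fun ω => by
    simp only [f, A, baseProfile_apply]
    rfl
  simp_rw [e]
  set c := (G.d i : ℝ) / p.δ * (3 * U) * Dx
  have hc : ∀ s ≤ t, ∀ ω,
      |G.noiseIncrement p x₁ v₀ (fun i t => u i t ω) (fun i t j => ξ i t j ω) i s| ≤ c :=
    fun s hs' ω => abs_noiseIncrement_le hS hJ hδ hβ0 hβ1 hn hx₁ hv₀ (fun i t => hu i t ω) i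
      (hs'.trans_lt ht)
  refine integral_nonpos_of_indepFun hAm (hs.measurable_dir i (t + 1)) hind hf ?_ fun ω => ?_
  · refine Integrable.of_bound
      (hf.comp (hAm.prodMk (hs.measurable_dir i (t + 1)))).aestronglyMeasurable
      (Real.exp (l * (t * c)) * c) (.of_forall fun ω => ?_)
    change ‖f (A ω) (u i (t + 1) ω)‖ ≤ _
    rw [← e, norm_mul, Real.norm_of_nonneg (Real.exp_pos _).le]
    refine mul_le_mul (Real.exp_le_exp.2 (mul_le_mul_of_nonneg_left ?_ hl.le)) (hc t le_rfl ω)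
      (norm_nonneg _) (Real.exp_pos _).le
    refine (Finset.sum_le_card_nsmul _ _ c fun s hs' => ?_).trans_eq (by simp)
    exact (le_abs_self _).trans (hc s (Finset.mem_range.1 hs').le ω)
  · have hfa : Measurable (f (A ω)) := hf.comp measurable_prodMk_left
    refine le_of_eq ?_
    calc ∫ ω', f (A ω) (u i (t + 1) ω') ∂μ = ∫ b, f (A ω) b ∂(μ.map (u i (t + 1))) :=
          (integral_map (hs.measurable_dir i (t + 1)).aemeasurable
            hfa.aestronglyMeasurable).symm
      _ = 0 := by
          rw [hs.law_dir]
          simp only [f]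
          rw [integral_const_mul, integral_inner_gradNoise hS hne hJ hL0 hL, mul_zero]

/-- The indicators are pairwise independent with variance at most `1`, so the error `Z` has second
moment at most `1/n`. The inequality `|Z| ≤ √n/2 * Z² + 1/(2√n)` passes to the first moment. -/
lemma integral_abs_edf_sub_cdf_le (hS : G.Standing Dx) (hs : G.IsSampling μ u ξ) (i : Fin N)
    (t : ℕ) {n : ℕ} (hn : 0 < n) {x : Profile G.d} (hx : x ∈ G.joint) (y : ℝ) :
    ∫ ω, |G.edf i n x (fun j => ξ i t j ω) y - G.cdf i x y| ∂μ ≤ 1 / √n := by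
  have hn' : (0 : ℝ) < n := by exact_mod_cast hn
  let g : G.Ξ i → ℝ := fun ζ => Set.indicator {c : ℝ | c ≤ y} (1 : ℝ → ℝ) (G.J i x ζ)
  have hg : Measurable g := (measurable_one.indicator measurableSet_Iic).comp
    (hS.measurable_cost i x hx)
  have hgb : ∀ ζ, |g ζ| ≤ 1 := fun ζ => by
    simp only [g, Set.indicator_apply]
    split_ifs <;> simp
  let X : ℕ → Ω → ℝ := fun j ω => g (ξ i t j ω)
  have hX : ∀ j, Measurable (X j) := fun j => hg.comp (hs.measurable_noise i t j)
  have hXL : ∀ j, MemLp (X j) 2 μ := fun j =>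
    MemLp.of_bound (hX j).aestronglyMeasurable 1 (.of_forall fun ω => hgb _)
  have hmean : ∀ j, ∫ ω, X j ω ∂μ = G.cdf i x y := fun j => by
    have h1 : ∫ ω, X j ω ∂μ = ∫ ζ, g ζ ∂(μ.map (ξ i t j)) :=
      (integral_map (hs.measurable_noise i t j).aemeasurable hg.aestronglyMeasurable).symm
    have h2 : g = Set.indicator {ζ | G.J i x ζ ≤ y} 1 := by
      funext ζ; simp [g, Set.indicator_apply]
    rw [h1, hs.law_noise, h2, integral_indicator_one
      (measurableSet_le (hS.measurable_cost i x hx) measurable_const), RiskGame.cdf]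
  have hindep : Set.Pairwise (↑(Finset.range n) : Set ℕ) fun j k => IndepFun (X j) (X k) μ := by
    intro j _ k _ hjk
    have h := hs.indep_noise.indepFun (i := (t, j)) (j := (t, k)) (by simpa using hjk)
    exact h.comp (φ := fun v : (i : Fin N) → G.Ξ i => g (v i))
      (ψ := fun v : (i : Fin N) → G.Ξ i => g (v i)) (hg.comp (measurable_pi_apply i))
      (hg.comp (measurable_pi_apply i))
  have hvar : variance (∑ j ∈ Finset.range n, X j) μ ≤ n := by
    rw [IndepFun.variance_sum (fun j _ => hXL j) hindep]
    refine (Finset.sum_le_card_nsmul _ _ 1 fun j _ => ?_).trans_eq (by simp)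
    refine (variance_le_expectation_sq (hX j).aestronglyMeasurable).trans ?_
    have : ∫ ω, (X j ^ 2) ω ∂μ ≤ ∫ _, (1 : ℝ) ∂μ := by
      refine integral_mono_of_nonneg (.of_forall fun ω => sq_nonneg _) (integrable_const _)
        (.of_forall fun ω => ?_)
      have := hgb (ξ i t j ω)
      simpa [X] using this
    simpa using this
  let Z : Ω → ℝ := fun ω => G.edf i n x (fun j => ξ i t j ω) y - G.cdf i x y
  have hsum : Measurable (∑ j ∈ Finset.range n, X j) := by
    rw [show ∑ j ∈ Finset.range n, X j = fun ω => ∑ j ∈ Finset.range n, X j ω from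
      funext fun ω => Finset.sum_apply _ _ _]
    exact Finset.measurable_fun_sum _ fun j _ => hX j
  have hZ : ∀ ω, Z ω = (1 / n) * ((∑ j ∈ Finset.range n, X j) ω -
      ∫ ω, (∑ j ∈ Finset.range n, X j) ω ∂μ) := by
    intro ω
    have h1 : ∫ ω, (∑ j ∈ Finset.range n, X j) ω ∂μ = n * G.cdf i x y := by
      simp only [Finset.sum_apply]
      rw [integral_finsetSum _ fun j _ => (hXL j).integrable one_le_two]
      simp [hmean]
    rw [h1, Finset.sum_apply, mul_sub]
    simp only [Z, RiskGame.edf, X, g]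
    field_simp
  have hZm : Measurable Z := by
    have : Z = fun ω => (1 / n) * ((∑ j ∈ Finset.range n, X j) ω -
      ∫ ω, (∑ j ∈ Finset.range n, X j) ω ∂μ) := funext hZ
    rw [this]
    exact (hsum.sub_const _).const_mul _
  have hZL : MemLp Z 2 μ := by
    have : Z = fun ω => (1 / n) * ((∑ j ∈ Finset.range n, X j) ω -
      ∫ ω, (∑ j ∈ Finset.range n, X j) ω ∂μ) := funext hZ
    rw [this]
    exact ((memLp_finsetSum' _ fun j _ => hXL j).sub (memLp_const _)).const_mul _
  have hZ2 : ∫ ω, Z ω ^ 2 ∂μ ≤ 1 / n := by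
    simp_rw [hZ, mul_pow]
    rw [integral_const_mul, ← variance_eq_integral hsum.aemeasurable]
    refine (mul_le_mul_of_nonneg_left hvar (by positivity)).trans_eq ?_
    field_simp
  have hsq : 0 < √(n : ℝ) := Real.sqrt_pos.2 hn'
  calc ∫ ω, |Z ω| ∂μ ≤ ∫ ω, (√n / 2 * Z ω ^ 2 + 1 / (2 * √n)) ∂μ := by
        refine integral_mono (hZL.integrable one_le_two).abs
          ((hZL.integrable_sq.const_mul _).add (integrable_const _)) fun ω => ?_
        have h0 : 0 ≤ (√n * |Z ω| - 1) ^ 2 := sq_nonneg _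
        have h1 : |Z ω| ^ 2 = Z ω ^ 2 := sq_abs _
        simp only
        rw [← sub_nonneg]
        have e : √n / 2 * Z ω ^ 2 + 1 / (2 * √n) - |Z ω| = (√n * |Z ω| - 1) ^ 2 / (2 * √n) := by
          rw [← h1]; field_simp; ring
        rw [e]
        positivity
    _ = √n / 2 * (∫ ω, Z ω ^ 2 ∂μ) + 1 / (2 * √n) := by
        rw [integral_add (hZL.integrable_sq.const_mul _) (integrable_const _), integral_const_mul]
        simp
    _ ≤ √n / 2 * (1 / n) + 1 / (2 * √n) := by gcongr
    _ = 1 / √n := by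
        nth_rewrite 2 [← Real.sq_sqrt hn'.le]
        field_simp
        norm_num

/-- By Fubini, integrate the pointwise bound `1/√n` over `[-U, U]`, outside which the error
vanishes. A bound on the mean is enough, because Azuma handles the fluctuations. -/
lemma integral_cdfError_le (hS : G.Standing Dx) (hU : 0 ≤ U) (hJ : G.ConvexBounded U)
    (hL0 : 0 ≤ L₀) (hL : G.LipschitzCost L₀) (hs : G.IsSampling μ u ξ) (i : Fin N)
    (t : ℕ) {n : ℕ} (hn : 0 < n) {x : Profile G.d} (hx : x ∈ G.joint) :
    ∫ ω, G.cdfError i n x (fun j => ξ i t j ω) ∂μ ≤ 2 * U / √n := by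
  have hE := fun ω => isCostCDF_edf hJ i hn hx (fun j => ξ i t j ω)
  have hF := isCostCDF_cdf hS hJ i hx
  have hm : Measurable fun q : Ω × ℝ =>
      |G.edf i n x (fun j => ξ i t j q.1) q.2 - G.cdf i x q.2| :=
    ((measurable_edf hS hL0 hL i n (x := fun _ => x) measurable_const (fun _ => hx)
      (ζ := fun ω j => ξ i t j ω) fun j => hs.measurable_noise i t j).sub
      (hF.measurable.comp measurable_snd)).norm
  have hzero : ∀ ω y, y ∉ Set.Icc (-U) U →
      |G.edf i n x (fun j => ξ i t j ω) y - G.cdf i x y| = 0 := by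
    intro ω y hy
    rcases lt_or_ge y (-U) with h | h
    · simp [(hE ω).eq_zero y h, hF.eq_zero y h]
    · have : U ≤ y := (not_le.1 fun h' => hy ⟨h, h'⟩).le
      simp [(hE ω).eq_one y this, hF.eq_one y this]
  have hic : ∀ c : ℝ, Integrable ((Set.Icc (-U) U).indicator fun _ => c) := fun c =>
    (integrable_indicator_iff measurableSet_Icc).2 (integrableOn_const measure_Icc_lt_top.ne)
  have h_int : Integrable (fun q : Ω × ℝ =>
      |G.edf i n x (fun j => ξ i t j q.1) q.2 - G.cdf i x q.2|) (μ.prod volume) := by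
    have h1 : Integrable (fun q : Ω × ℝ => (Set.Icc (-U) U).indicator (fun _ => (1 : ℝ)) q.2)
      (μ.prod volume) := (hic 1).comp_snd μ
    refine h1.mono' hm.aestronglyMeasurable (.of_forall fun q => ?_)
    rw [Real.norm_of_nonneg (abs_nonneg _)]
    by_cases hy : q.2 ∈ Set.Icc (-U) U
    · rw [Set.indicator_of_mem hy]; exact (hE q.1).abs_sub_le_one hF q.2
    · rw [Set.indicator_of_notMem hy, hzero _ _ hy]
  calc ∫ ω, G.cdfError i n x (fun j => ξ i t j ω) ∂μ
      = ∫ y, ∫ ω, |G.edf i n x (fun j => ξ i t j ω) y - G.cdf i x y| ∂μ :=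
        integral_integral_swap h_int
    _ ≤ ∫ y, (Set.Icc (-U) U).indicator (fun _ => 1 / √n) y := by
        refine integral_mono h_int.integral_prod_right (hic _) fun y => ?_
        by_cases hy : y ∈ Set.Icc (-U) U
        · rw [Set.indicator_of_mem hy]
          exact integral_abs_edf_sub_cdf_le hS hs i t hn hx y
        · rw [Set.indicator_of_notMem hy]
          simp [hzero _ _ hy]
    _ = 2 * U / √n := by
        rw [integral_indicator measurableSet_Icc, setIntegral_const, Real.volume_real_Icc,
          smul_eq_mul, max_eq_left (by linarith)]
        ring

/-- The centred error of the empirical distribution function of agent `i` in episode `t + 1`. -/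
def errorIncrement (G : RiskGame N) (U : ℝ) (p : Params N) (x₁ : Profile G.d) (v₀ : Fin N → ℝ)
    (u : (i : Fin N) → ℕ → Act (G.d i)) (ξ : (i : Fin N) → ℕ → ℕ → G.Ξ i) (i : Fin N) (t : ℕ) :
    ℝ :=
  G.cdfError i (p.n (t + 1)) (G.played p x₁ v₀ u ξ (t + 1)) (ξ i (t + 1)) -
    2 * U / √(p.n (t + 1))

lemma measurable_errorIncrement {mΩ : MeasurableSpace Ω} (hS : G.Standing Dx)
    (hJ : G.ConvexBounded U) (hL0 : 0 ≤ L₀)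
    (hL : G.LipschitzCost L₀) (hδ : 0 < p.δ) (hβ0 : 0 ≤ p.β) (hβ1 : p.β ≤ 1)
    (hn : ∀ t, 1 ≤ t → t ≤ T → 0 < p.n t)
    (hx₁ : ∀ i, x₁ i ∈ shrink (G.X i) p.δ) (hu : ∀ i t ω, ‖u i t ω‖ = 1) (i : Fin N)
    {t : ℕ} (ht : t < T) (hmu : ∀ i, ∀ s ≤ t + 1, Measurable (u i s))
    (hmξ : ∀ i, ∀ s ≤ t + 1, ∀ j, Measurable (ξ i s j)) :
    Measurable fun ω =>
      G.errorIncrement U p x₁ v₀ (fun i t => u i t ω) (fun i t j => ξ i t j ω) i t := by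
  have hne : ∀ i, (G.X i).Nonempty := fun i => ⟨_, (hx₁ i).1⟩
  obtain ⟨h1, -, -⟩ := measurable_state (v₀ := v₀) hS hJ hL0 hL hδ hβ0 hβ1 hn hx₁ hu t ht.le
    (fun i s hs => hmu i s (by omega)) (fun i s hs => hmξ i s (by omega))
  have h2 : Measurable fun ω => G.played p x₁ v₀ (fun i t => u i t ω) (fun i t j => ξ i t j ω)
      (t + 1) := measurable_perturb h1 fun i => hmu i (t + 1) le_rfl
  have h3 := (measurable_cdfError hS hL0 hL i (p.n (t + 1)) hne).comp
    (h2.prodMk (measurable_pi_lambda _ fun j => hmξ i (t + 1) le_rfl j))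
  refine Measurable.sub_const ?_ _
  convert h3 using 2 with ω
  simp only [Function.comp]
  rw [retract_eq_self hS (played_mem_joint hS hδ hx₁ (fun i t => hu i t ω) (t + 1))]

lemma abs_errorIncrement_le (hS : G.Standing Dx) (hU : 0 ≤ U) (hJ : G.ConvexBounded U)
    (hδ : 0 < p.δ) (hn : ∀ t, 1 ≤ t → t ≤ T → 0 < p.n t)
    (hx₁ : ∀ i, x₁ i ∈ shrink (G.X i) p.δ) {u : (i : Fin N) → ℕ → Act (G.d i)}
    {ξ : (i : Fin N) → ℕ → ℕ → G.Ξ i} (hu : ∀ i t, ‖u i t‖ = 1) (i : Fin N) {t : ℕ}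
    (ht : t < T) : |G.errorIncrement U p x₁ v₀ u ξ i t| ≤ 2 * U := by
  have hmem := played_mem_joint (v₀ := v₀) (ξ := ξ) hS hδ hx₁ hu (t + 1)
  have hn1 := hn (t + 1) (by omega) ht
  have h1 : 0 ≤ G.cdfError i (p.n (t + 1)) (G.played p x₁ v₀ u ξ (t + 1)) (ξ i (t + 1)) :=
    integral_nonneg fun y => abs_nonneg _
  have hE := isCostCDF_edf hJ i hn1 hmem (ξ i (t + 1))
  have hF := isCostCDF_cdf hS hJ i hmem
  have h2 : G.cdfError i (p.n (t + 1)) (G.played p x₁ v₀ u ξ (t + 1)) (ξ i (t + 1)) ≤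
      2 * U * 1 := hE.integral_abs_sub_le hU hF fun y => hE.abs_sub_le_one hF y
  have h3 : 1 ≤ √(p.n (t + 1) : ℝ) := by
    rw [Real.one_le_sqrt]
    exact_mod_cast hn1
  have h4 : 2 * U / √(p.n (t + 1) : ℝ) ≤ 2 * U := div_le_self (by positivity) h3
  have h5 : 0 ≤ 2 * U / √(p.n (t + 1) : ℝ) := by positivity
  rw [errorIncrement, abs_le]
  constructor <;> linarith

/-- The samples of episode `t + 1` are independent of the profile played in it and of the earlier
errors. With these frozen, the mean error is at most the subtracted `2U/√n`, so the sums form a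
supermartingale. -/
lemma integral_exp_mul_errorIncrement_nonpos (hS : G.Standing Dx) (hU : 0 ≤ U)
    (hJ : G.ConvexBounded U)
    (hL0 : 0 ≤ L₀) (hL : G.LipschitzCost L₀) (hδ : 0 < p.δ) (hβ0 : 0 ≤ p.β) (hβ1 : p.β ≤ 1)
    (hn : ∀ t, 1 ≤ t → t ≤ T → 0 < p.n t)
    (hx₁ : ∀ i, x₁ i ∈ shrink (G.X i) p.δ)
    (hs : G.IsSampling μ u ξ) (hu : ∀ i t ω, ‖u i t ω‖ = 1) (i : Fin N)
    {t : ℕ} (ht : t < T) {l : ℝ} (hl : 0 < l) :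
    ∫ ω, Real.exp (l * ∑ s ∈ Finset.range t,
        G.errorIncrement U p x₁ v₀ (fun i t => u i t ω) (fun i t j => ξ i t j ω) i s) *
      G.errorIncrement U p x₁ v₀ (fun i t => u i t ω) (fun i t j => ξ i t j ω) i t ∂μ ≤ 0 := by
  have hne : ∀ i, (G.X i).Nonempty := fun i => ⟨_, (hx₁ i).1⟩
  let S : Set ((Fin N × ℕ) ⊕ (ℕ × ℕ)) := {k | Sum.elim (fun k : Fin N × ℕ => k.2 ≤ t + 1)
    (fun q : ℕ × ℕ => q.1 ≤ t) k}
  let S' : Set ((Fin N × ℕ) ⊕ (ℕ × ℕ)) := {k | Sum.elim (fun _ : Fin N × ℕ => False)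
    (fun q : ℕ × ℕ => q.1 = t + 1) k}
  have hd : Disjoint S S' := by
    rw [Set.disjoint_left]
    rintro (k | q)
    · simp [S']
    · simp only [S, S', Set.mem_ofPred_eq, Sum.elim_inr]
      omega
  have hmu : ∀ k, ∀ s ≤ t + 1, Measurable[⨆ k ∈ S, sources G u ξ k] (u k s) := fun k s hs' =>
    measurable_dir_sources (by simp [S, hs'])
  have hmξ : ∀ k, ∀ s ≤ t, ∀ j, Measurable[⨆ k ∈ S, sources G u ξ k] (ξ k s j) :=
    fun k s hs' j => measurable_noise_sources (by simp [S, hs']) k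
  obtain ⟨m1, -, -⟩ := measurable_state (mΩ := ⨆ k ∈ S, sources G u ξ k) (v₀ := v₀) hS hJ hL0 hL
    hδ hβ0 hβ1 hn hx₁ hu t ht.le (fun k s hs' => hmu k s (by omega)) hmξ
  have m2 := measurable_perturb (mΩ := ⨆ k ∈ S, sources G u ξ k) (p := p) m1
    (w := fun ω i => u i (t + 1) ω) fun k => hmu k (t + 1) le_rfl
  have m6 := Finset.measurable_fun_sum (m := ⨆ k ∈ S, sources G u ξ k) (Finset.range t)
    fun s hs' =>
    measurable_errorIncrement (mΩ := ⨆ k ∈ S, sources G u ξ k) (v₀ := v₀) hS hJ hL0 hL hδ hβ0 hβ1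
      hn hx₁ hu i ((Finset.mem_range.1 hs').trans ht)
      (fun k r hr => hmu k r (by have := Finset.mem_range.1 hs'; omega))
      (fun k r hr => hmξ k r (by have := Finset.mem_range.1 hs'; omega))
  let A : Ω → ℝ × Profile G.d := fun ω =>
    (∑ s ∈ Finset.range t,
      G.errorIncrement U p x₁ v₀ (fun i t => u i t ω) (fun i t j => ξ i t j ω) i s,
    G.played p x₁ v₀ (fun i t => u i t ω) (fun i t j => ξ i t j ω) (t + 1))
  let B : Ω → ℕ → G.Ξ i := fun ω j => ξ i (t + 1) j ω
  have hA : Measurable[⨆ k ∈ S, sources G u ξ k] A := m6.prodMk m2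
  have hB : Measurable[⨆ k ∈ S', sources G u ξ k] B :=
    @measurable_pi_lambda _ _ _ (⨆ k ∈ S', sources G u ξ k) _ _
      fun j => measurable_noise_sources (by simp [S']) i
  have hind : IndepFun A B μ :=
    indepFun_of_iIndep_of_measurable (sources_le hs) (iIndep_sources hs) hd hA hB
  have hAm : Measurable A := hA.mono (iSup₂_le fun k _ => sources_le hs k) le_rfl
  have hBm : Measurable B := hB.mono (iSup₂_le fun k _ => sources_le hs k) le_rfl
  let f : ℝ × Profile G.d → (ℕ → G.Ξ i) → ℝ := fun a b =>
    Real.exp (l * a.1) * (G.cdfError i (p.n (t + 1)) (G.retract a.2) b - 2 * U / √(p.n (t + 1)))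
  have hf : Measurable (Function.uncurry f) := by
    refine ((by fun_prop : Measurable fun w :
      (ℝ × Profile G.d) × (ℕ → G.Ξ i) => Real.exp (l * w.1.1))).mul (Measurable.sub_const ?_ _)
    exact Measurable.comp (g := fun q : Profile G.d × (ℕ → G.Ξ i) =>
        G.cdfError i (p.n (t + 1)) (G.retract q.1) q.2)
      (f := fun w : (ℝ × Profile G.d) × (ℕ → G.Ξ i) => (w.1.2, w.2))
      (measurable_cdfError hS hL0 hL i (p.n (t + 1)) hne) (by fun_prop)
  have hmem := fun ω => played_mem_joint (v₀ := v₀) (ξ := fun i t j => ξ i t j ω) hS hδ hx₁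
    (fun i t => hu i t ω) (t + 1)
  have e : ∀ ω, Real.exp (l * ∑ s ∈ Finset.range t,
        G.errorIncrement U p x₁ v₀ (fun i t => u i t ω) (fun i t j => ξ i t j ω) i s) *
      G.errorIncrement U p x₁ v₀ (fun i t => u i t ω) (fun i t j => ξ i t j ω) i t =
      f (A ω) (B ω) := fun ω => by
    simp only [f, A, retract_eq_self hS (hmem ω)]
    rfl
  simp_rw [e]
  have hc : ∀ s ≤ t, ∀ ω,
      |G.errorIncrement U p x₁ v₀ (fun i t => u i t ω) (fun i t j => ξ i t j ω) i s| ≤ 2 * U :=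
    fun s hs' ω => abs_errorIncrement_le hS hU hJ hδ hn hx₁ (fun i t => hu i t ω) i
      (hs'.trans_lt ht)
  refine integral_nonpos_of_indepFun hAm hBm hind hf ?_ fun ω => ?_
  · refine Integrable.of_bound (hf.comp (hAm.prodMk hBm)).aestronglyMeasurable
      (Real.exp (l * (t * (2 * U))) * (2 * U)) (.of_forall fun ω => ?_)
    change ‖f (A ω) (B ω)‖ ≤ _
    rw [← e, norm_mul, Real.norm_of_nonneg (Real.exp_pos _).le]
    refine mul_le_mul (Real.exp_le_exp.2 (mul_le_mul_of_nonneg_left ?_ hl.le)) (hc t le_rfl ω)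
      (norm_nonneg _) (Real.exp_pos _).le
    refine (Finset.sum_le_card_nsmul _ _ (2 * U) fun s hs' => ?_).trans_eq (by simp)
    exact (le_abs_self _).trans (hc s (Finset.mem_range.1 hs').le ω)
  · have hn1 := hn (t + 1) (by omega) ht
    have hr := retract_mem_joint hS hne (A ω).2
    simp only [f]
    rw [integral_const_mul]
    refine mul_nonpos_of_nonneg_of_nonpos (Real.exp_pos _).le ?_
    have hi : Integrable (fun ω' => G.cdfError i (p.n (t + 1)) (G.retract (A ω).2) (B ω')) μ := by
      have hm : Measurable fun ω' => G.cdfError i (p.n (t + 1)) (G.retract (A ω).2) (B ω') :=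
        Measurable.comp (g := fun q : Profile G.d × (ℕ → G.Ξ i) =>
            G.cdfError i (p.n (t + 1)) (G.retract q.1) q.2) (f := fun ω' => ((A ω).2, B ω'))
          (measurable_cdfError hS hL0 hL i (p.n (t + 1)) hne) (measurable_const.prodMk hBm)
      refine Integrable.of_bound hm.aestronglyMeasurable (2 * U * 1) (.of_forall fun ω' => ?_)
      rw [cdfError, Real.norm_of_nonneg (integral_nonneg fun y => abs_nonneg _)]
      have hE := isCostCDF_edf hJ i hn1 hr (B ω')
      have hF := isCostCDF_cdf hS hJ i hr
      exact hE.integral_abs_sub_le hU hF fun y => hE.abs_sub_le_one hF y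
    rw [integral_sub hi (integrable_const _), integral_const]
    have := integral_cdfError_le hS hU hJ hL0 hL hs i (t + 1) hn1 hr
    simp only [probReal_univ, one_smul, B] at this ⊢
    linarith

end RiskGame

/-! ### The sum of powers behind the sample sizes -/

section Numerics

/-- After reversing the sum, Bernoulli's inequality bounds the increment of `m ^ (1 - a/2)` below by
`(1 - a/2) (m + 1) ^ (-a/2)`; since `1 - a/2 ≥ 1/2`, the factor `2` suffices. -/
lemma sum_range_rpow_neg_le {a : ℝ} (ha₀ : 0 < a) (ha₁ : a < 1) (T : ℕ) :
    ∑ t ∈ Finset.range T, ((T : ℝ) - t) ^ (-(a / 2)) ≤ 2 * (T : ℝ) ^ (1 - a / 2) := by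
  have key : ∀ m : ℕ, ∑ k ∈ Finset.range m, ((k : ℝ) + 1) ^ (-(a / 2)) ≤
      2 * (m : ℝ) ^ (1 - a / 2) := by
    intro m
    induction m with
    | zero => simp; positivity
    | succ m ih =>
      rw [Finset.sum_range_succ]
      push_cast
      have hm : (0 : ℝ) < (m : ℝ) + 1 := by positivity
      have hm0 : (0 : ℝ) ≤ m := Nat.cast_nonneg m
      have hx : ((m : ℝ) / (m + 1)) ^ (1 - a / 2) ≤ 1 + (1 - a / 2) * ((m : ℝ) / (m + 1) - 1) := by
        have := rpow_one_add_le_one_add_mul_self (s := (m : ℝ) / (m + 1) - 1)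
          (p := 1 - a / 2) (by have : 0 ≤ (m : ℝ) / (m + 1) := by positivity
                               linarith) (by linarith) (by linarith)
        simpa using this
      rw [Real.div_rpow hm0 hm.le] at hx
      have e1 : ((m : ℝ) + 1) ^ (1 - a / 2) = ((m : ℝ) + 1) * ((m : ℝ) + 1) ^ (-(a / 2)) := by
        rw [show (1 - a / 2 : ℝ) = 1 + (-(a / 2)) by ring, Real.rpow_add hm, Real.rpow_one]
      set P := ((m : ℝ) + 1) ^ (-(a / 2)) with hP
      have hPpos : 0 < P := Real.rpow_pos_of_pos hm _
      have e2 : (m : ℝ) / (m + 1) - 1 = -(1 / (m + 1)) := by field_simp; ring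
      rw [e2, e1, div_le_iff₀ (by positivity)] at hx
      have e3 : (1 + (1 - a / 2) * -(1 / ((m : ℝ) + 1))) * (((m : ℝ) + 1) * P) =
          ((m : ℝ) + 1) * P - (1 - a / 2) * P := by field_simp; ring
      rw [e3] at hx
      rw [e1]
      have : P / 2 ≤ (1 - a / 2) * P := by nlinarith
      linarith
  refine le_of_eq_of_le ?_ (key T)
  rw [← Finset.sum_range_reflect]
  refine Finset.sum_congr rfl fun t ht => ?_
  have := Finset.mem_range.1 ht
  rw [Nat.cast_sub (by omega), Nat.cast_sub (by omega)]
  congr 1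
  push_cast
  ring

end Numerics

/-! ### Concentration for all agents simultaneously -/

namespace RiskGame

variable {N : ℕ} {G : RiskGame N} {Dx U L₀ C₀ : ℝ}
variable {p : Params N} {x₁ : Profile G.d} {v₀ : Fin N → ℝ} {T : ℕ}
  {Ω : Type*} {mΩ : MeasurableSpace Ω} {μ : Measure Ω}
  {u : (i : Fin N) → ℕ → Ω → Act (G.d i)} {ξ : (i : Fin N) → ℕ → ℕ → Ω → G.Ξ i}

/-- With high probability, the noise sums of all agents are small simultaneously. -/
lemma measure_exists_large_noise_le [IsProbabilityMeasure μ] (hS : G.Standing Dx) (hDx : 0 < Dx)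
    (hU : 0 < U) (hJ : G.ConvexBounded U) (hL0 : 0 ≤ L₀) (hL : G.LipschitzCost L₀) (hδ : 0 < p.δ)
    (hβ0 : 0 ≤ p.β) (hβ1 : p.β ≤ 1) (hn : ∀ t, 1 ≤ t → t ≤ T → 0 < p.n t) (hT : 0 < T)
    (hx₁ : ∀ i, x₁ i ∈ shrink (G.X i) p.δ) (hv₀ : ∀ i, |v₀ i| ≤ U)
    (hs : G.IsSampling μ u ξ) (hu : ∀ i t ω, ‖u i t ω‖ = 1) (hN : 0 < N) {γ : ℝ} (hγ : 0 < γ)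
    (hγ1 : γ < 1) :
    μ {ω | ¬ ∀ i,
      ∑ t ∈ Finset.range T,
        G.noiseIncrement p x₁ v₀ (fun i t => u i t ω) (fun i t j => ξ i t j ω) i t ≤
        G.d i / p.δ * (3 * U) * Dx * √(2 * T * Real.log (1 / (γ / (2 * N)))) ∧
      ∑ t ∈ Finset.range T,
        G.errorIncrement U p x₁ v₀ (fun i t => u i t ω) (fun i t j => ξ i t j ω) i t ≤
        2 * U * √(2 * T * Real.log (1 / (γ / (2 * N))))} ≤ ENNReal.ofReal γ := by
  have hN' : (0 : ℝ) < N := by exact_mod_cast hN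
  have hN1 : (1 : ℝ) ≤ N := by exact_mod_cast hN
  -- Two sums for each of `N` agents share the failure probability.
  set γ' := γ / (2 * N)
  have hγ' : 0 < γ' := by positivity
  have hγ'1 : γ' < 1 := by
    rw [div_lt_one (by positivity)]; linarith
  set R := √(2 * T * Real.log (1 / γ'))
  let B₁ : Fin N → Set Ω := fun i => {ω | G.d i / p.δ * (3 * U) * Dx * R <
    ∑ t ∈ Finset.range T,
      G.noiseIncrement p x₁ v₀ (fun i t => u i t ω) (fun i t j => ξ i t j ω) i t}
  let B₂ : Fin N → Set Ω := fun i => {ω | 2 * U * R <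
    ∑ t ∈ Finset.range T,
      G.errorIncrement U p x₁ v₀ (fun i t => u i t ω) (fun i t j => ξ i t j ω) i t}
  have h1 : ∀ i, μ (B₁ i) ≤ ENNReal.ofReal γ' := fun i => by
    have hd : (0 : ℝ) < G.d i := by exact_mod_cast hS.dim_pos i
    exact measure_sum_gt_le_of_bounded_increments (V := fun t ω =>
        G.noiseIncrement p x₁ v₀ (fun i t => u i t ω) (fun i t j => ξ i t j ω) i t)
      (by positivity) hT hγ' hγ'1
      (fun t ht => measurable_noiseIncrement hS hJ hL0 hL hδ hβ0 hβ1 hn hx₁ hu i ht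
        (fun i s _ => hs.measurable_dir i s) (fun i s _ j => hs.measurable_noise i s j))
      (fun t ht ω => abs_noiseIncrement_le hS hJ hδ hβ0 hβ1 hn hx₁ hv₀ (fun i t => hu i t ω) i ht)
      (fun t ht l hl => integral_exp_mul_noiseIncrement_nonpos hS hJ hL0 hL hδ hβ0 hβ1 hn hx₁ hv₀
        hs hu i ht hl)
  have h2 : ∀ i, μ (B₂ i) ≤ ENNReal.ofReal γ' := fun i =>
    measure_sum_gt_le_of_bounded_increments (V := fun t ω =>
        G.errorIncrement U p x₁ v₀ (fun i t => u i t ω) (fun i t j => ξ i t j ω) i t)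
      (by positivity) hT hγ' hγ'1
      (fun t ht => measurable_errorIncrement hS hJ hL0 hL hδ hβ0 hβ1 hn hx₁ hu i ht
        (fun i s _ => hs.measurable_dir i s) (fun i s _ j => hs.measurable_noise i s j))
      (fun t ht ω => abs_errorIncrement_le hS hU.le hJ hδ hn hx₁ (fun i t => hu i t ω) i ht)
      (fun t ht l hl => integral_exp_mul_errorIncrement_nonpos hS hU.le hJ hL0 hL hδ hβ0 hβ1 hn hx₁
        hs hu i ht hl)
  calc _ ≤ μ (⋃ i, (B₁ i ∪ B₂ i)) := by
        refine measure_mono fun ω hω => ?_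
        rw [Set.mem_ofPred_eq] at hω
        push Not at hω
        obtain ⟨i, hi⟩ := hω
        rw [Set.mem_iUnion]
        refine ⟨i, ?_⟩
        by_cases h : ω ∈ B₁ i
        · exact Or.inl h
        · exact Or.inr (hi (not_lt.1 h))
    _ ≤ ∑ i : Fin N, μ (B₁ i ∪ B₂ i) := measure_iUnion_fintype_le _ _
    _ ≤ ∑ _i : Fin N, (ENNReal.ofReal γ' + ENNReal.ofReal γ') :=
        Finset.sum_le_sum fun i _ => (measure_union_le _ _).trans (add_le_add (h1 i) (h2 i))
    _ = ENNReal.ofReal γ := by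
        rw [← ENNReal.ofReal_add hγ'.le hγ'.le, Finset.sum_const, Finset.card_univ,
          Fintype.card_fin, nsmul_eq_mul, ← ENNReal.ofReal_natCast, ← ENNReal.ofReal_mul hN'.le]
        congr 1
        simp only [γ']
        field_simp
        norm_num

open Classical in
/-- The vector `v` if it has norm `1`, and otherwise the default `e`. -/
def toUnit {n : ℕ} (e v : Act n) : Act n := if ‖v‖ = 1 then v else e

lemma measurable_toUnit {n : ℕ} (e : Act n) : Measurable (toUnit e) :=
  Measurable.ite (measurableSet_eq_fun measurable_norm measurable_const) measurable_id
    measurable_const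

lemma norm_toUnit {n : ℕ} {e : Act n} (he : ‖e‖ = 1) (v : Act n) : ‖toUnit e v‖ = 1 := by
  unfold toUnit
  split_ifs with h
  · exact h
  · exact he

lemma toUnit_of_norm_eq_one {n : ℕ} (e : Act n) {v : Act n} (hv : ‖v‖ = 1) : toUnit e v = v :=
  if_pos hv

/-- Directions are unit vectors only almost surely, while measurability with respect to subfamilies
of sources is argued for every `ω`. A fixed measurable map of each direction, equal to the identity
almost everywhere, keeps laws and independence. -/
lemma IsSampling.toUnit (hs : G.IsSampling μ u ξ) (e : (i : Fin N) → Act (G.d i)) :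
    G.IsSampling μ (fun i t ω => RiskGame.toUnit (e i) (u i t ω)) ξ where
  measurable_dir i t := (measurable_toUnit _).comp (hs.measurable_dir i t)
  measurable_noise := hs.measurable_noise
  law_dir i t := by
    have h := Measure.map_map (μ := μ) (measurable_toUnit (e i)) (hs.measurable_dir i t)
    rw [hs.law_dir] at h
    refine h.symm.trans ?_
    have h2 : RiskGame.toUnit (e i) =ᵐ[uniformSphere (G.d i)] id := by
      filter_upwards [ae_uniformSphere_norm_eq_one] with v hv
      exact toUnit_of_norm_eq_one _ hv
    rw [Measure.map_congr h2, Measure.map_id]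
  law_noise := hs.law_noise
  indep_dir := hs.indep_dir.comp (fun k => RiskGame.toUnit (e k.1)) fun k => measurable_toUnit _
  indep_noise := hs.indep_noise
  indep_dir_noise := by
    have hφ : Measurable fun (v : (k : Fin N × ℕ) → Act (G.d k.1)) (k : Fin N × ℕ) =>
        RiskGame.toUnit (e k.1) (v k) :=
      measurable_pi_lambda _ fun k => (measurable_toUnit _).comp (measurable_pi_apply k)
    have h := hs.indep_dir_noise.comp hφ measurable_id
    exact h

lemma IsSampling.ae_norm_eq_one (hs : G.IsSampling μ u ξ) : ∀ᵐ ω ∂μ, ∀ i t, ‖u i t ω‖ = 1 := by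
  rw [ae_all_iff]
  intro i
  rw [ae_all_iff]
  intro t
  refine ae_of_ae_map (p := fun v => ‖v‖ = 1) (hs.measurable_dir i t).aemeasurable ?_
  rw [hs.law_dir]
  exact ae_uniformSphere_norm_eq_one

end RiskGame

/-! ### Numerical bounds for the tuned parameters -/

section Numerics

lemma noise_bound_le {M L g : ℝ} (hM : 0 ≤ M) (hL : 1 ≤ L) (hg : g ≤ 2 * L) :
    √(2 * M ^ 2 * g) ≤ 2 * M * L := by
  refine Real.sqrt_le_iff.2 ⟨by positivity, ?_⟩
  have h1 : g ≤ 2 * L ^ 2 := by nlinarith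
  nlinarith [mul_le_mul_of_nonneg_left h1 (sq_nonneg M)]

variable {D d L₀ n S L M τ c η δ α ℓ U b C₀ ρ Q κ : ℝ}

/-- Notation here and below: `n` is the number of agents, `c = N^(1/6)`, `τ = T^(a/4)`, `M = √T`, `L
= log (T/γ)`, `Q = T^(1 - a/4)`, and `S` is the sum of the `α_i⁻²`. The step is `2 U c / (L₀ n τ²)`,
which `c² ≤ n` and `ℓ² ≤ D L₀` compare with `δ = D / (c τ)`: gradient steps are no longer than a
constant times the perturbation. -/
lemma step_bound_le (hℓ : 0 < ℓ) (hD : ℓ ≤ D) (hL₀ : ℓ ≤ L₀) (hU : 0 < U) (hd : 1 ≤ d)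
    (hn : 1 ≤ n) (hτ : 1 ≤ τ) (hc : 1 ≤ c) (hcn : c ^ 2 ≤ n)
    (hη : η = D / (d * L₀ * n) / τ ^ 3) (hδ : δ = D / (c * τ)) :
    η * (d / δ * (2 * U)) ≤ 2 * U / ℓ ^ 2 * δ := by
  have hD0 : 0 < D := hℓ.trans_le hD
  have hL0 : 0 < L₀ := hℓ.trans_le hL₀
  have h1 : η * (d / δ * (2 * U)) = 2 * U * (c / (L₀ * n * τ ^ 2)) := by
    rw [hη, hδ]; field_simp
  rw [h1, hδ, div_mul_div_comm, mul_div_assoc]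
  refine mul_le_mul_of_nonneg_left ?_ (by positivity)
  rw [div_le_div_iff₀ (by positivity) (by positivity)]
  have h2 : ℓ ^ 2 ≤ D * L₀ := by nlinarith
  calc c * (ℓ ^ 2 * (c * τ)) = ℓ ^ 2 * c ^ 2 * τ := by ring
    _ ≤ (D * L₀) * n * τ ^ 2 := by gcongr; nlinarith
    _ = D * (L₀ * n * τ ^ 2) := by ring

set_option maxHeartbeats 1600000 in
-- Each term is compared with the target `R`. The powers of `T` fit because `τ² ≤ M`, the powers of
-- `N` because `c² ≤ n` and `√n ≤ n`; missing factors `D` and `L₀` are paid for with powers of `ℓ`.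
lemma regret_terms_le (hℓ : 0 < ℓ) (hD : ℓ ≤ D) (hL₀ : ℓ ≤ L₀) (hU : 0 < U) (hb : 0 < b)
    (hC₀ : 0 < C₀) (hρ : 0 < ρ) (hd : 1 ≤ d) (hn : 1 ≤ n) (hτ : 1 ≤ τ) (hc : 1 ≤ c)
    (hcn : c ^ 2 ≤ n) (hS : 1 ≤ S) (hαS : α⁻¹ ≤ S) (hL : 1 ≤ L) (hM : τ ^ 2 ≤ M)
    (hη : η = D / (d * L₀ * n) / τ ^ 3) (hδ : δ = D / (c * τ)) (hκ : 0 ≤ κ) (hQ : Q = M ^ 2 / τ) :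
    D ^ 2 / η + η * M ^ 2 * (d / δ * (3 * U)) ^ 2 + d / δ * (3 * U) * D * (2 * M * L) +
      d / δ * D * (α⁻¹ * (2 * (2 * U * (2 * M * L) + 4 / √b * (M ^ 2 / τ ^ 2)) +
        2 * M ^ 2 * (1 / (U ^ 2 * τ) * (2 * U * (C₀ * (√n * (κ * δ))))))) +
      M ^ 2 * ((3 + ρ) * (L₀ * δ)) ≤
    (1 + 9 * U ^ 2 / ℓ ^ 4 + 6 * U / ℓ ^ 2 + (8 * U + 8 / √b) / ℓ ^ 2 + 4 * C₀ * κ / (U * ℓ) +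
      (3 + ρ)) * (D * d * L₀ * n * S * L * Q) := by
  have hD0 : 0 < D := hℓ.trans_le hD
  have hL0 : 0 < L₀ := hℓ.trans_le hL₀
  have hM0 : 0 < M := lt_of_lt_of_le (by positivity) hM
  have hS0 : 0 < S := by linarith
  have hd0 : 0 < d := by linarith
  have hn0 : 0 < n := by linarith
  have hτ0 : 0 < τ := by linarith
  have hc0 : 0 < c := by linarith
  have hLpos : 0 < L := by linarith
  have hQ0 : 0 < Q := by rw [hQ]; positivity
  have hbs : 0 < √b := Real.sqrt_pos.2 hb
  have hcn1 : c ≤ n := by nlinarith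
  have hsn : √n ≤ n := by
    refine Real.sqrt_le_iff.2 ⟨hn0.le, ?_⟩; nlinarith
  have hsn1 : 1 ≤ √n := Real.one_le_sqrt.2 hn
  have hℓ2 : ℓ ^ 2 ≤ D * L₀ := by nlinarith
  have hSL : 1 ≤ S * L := by nlinarith
  -- This is `τ² ≤ M`, which encodes `a ≤ 1`; it places both the noise term and `τ³` below `Q`.
  have hτM : τ * M ≤ Q := by
    rw [hQ, le_div_iff₀ hτ0]; nlinarith
  obtain ⟨R, hR⟩ : ∃ R, R = D * d * L₀ * n * S * L * Q := ⟨_, rfl⟩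
  rw [← hR]
  have hbase : d * n * S * L * Q ≤ R / ℓ ^ 2 := by
    rw [le_div_iff₀ (by positivity)]
    calc d * n * S * L * Q * ℓ ^ 2 ≤ d * n * S * L * Q * (D * L₀) := by gcongr
      _ = R := by rw [hR]; ring
  have t1 : D ^ 2 / η ≤ R := by
    have e : D ^ 2 / η = D * d * L₀ * n * 1 * (τ ^ 3) := by rw [hη]; field_simp
    have h3 : τ ^ 3 ≤ Q := by
      calc τ ^ 3 = τ * τ ^ 2 := by ring
        _ ≤ τ * M := by gcongr
        _ ≤ Q := hτM
    rw [e, hR, mul_assoc _ S L]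
    gcongr
  have t2 : η * M ^ 2 * (d / δ * (3 * U)) ^ 2 ≤ 9 * U ^ 2 / ℓ ^ 4 * R := by
    have e : η * M ^ 2 * (d / δ * (3 * U)) ^ 2 =
        9 * U ^ 2 * (d * (c ^ 2 / n) * 1 * Q / (D * L₀)) := by
      rw [hη, hδ, hQ]; field_simp; ring
    have h1 : c ^ 2 / n ≤ n := by
      rw [div_le_iff₀ hn0]; nlinarith
    have h2 : d * (c ^ 2 / n) * 1 * Q / (D * L₀) ≤ (d * n * S * L * Q) / ℓ ^ 2 := by
      rw [mul_assoc _ S L]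
      gcongr
    calc _ = 9 * U ^ 2 * (d * (c ^ 2 / n) * 1 * Q / (D * L₀)) := e
      _ ≤ 9 * U ^ 2 * (R / ℓ ^ 2 / ℓ ^ 2) := by
          refine mul_le_mul_of_nonneg_left (h2.trans ?_) (by positivity)
          gcongr
      _ = _ := by field_simp
  have hdD : d / δ * D = d * c * τ := by rw [hδ]; field_simp
  have hcore : d * c * τ * M * L ≤ R / ℓ ^ 2 := by
    refine le_trans ?_ hbase
    calc d * c * τ * M * L = d * c * 1 * L * (τ * M) := by ring
      _ ≤ d * n * S * L * Q := by gcongr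
  have t3 : d / δ * (3 * U) * D * (2 * M * L) ≤ 6 * U / ℓ ^ 2 * R := by
    calc d / δ * (3 * U) * D * (2 * M * L) = 6 * U * (d * c * τ * M * L) := by
          rw [← hdD]; ring
      _ ≤ 6 * U * (R / ℓ ^ 2) := by gcongr
      _ = _ := by ring
  have hcoreS : S * (d * c * τ * M * L) ≤ R / ℓ ^ 2 := by
    refine le_trans ?_ hbase
    calc S * (d * c * τ * M * L) = d * c * S * L * (τ * M) := by ring
      _ ≤ d * n * S * L * Q := by gcongr
  -- In the drift term `δ` cancels against `1/δ`, and the decay `1/τ` comes from `β`.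
  have t4 : d / δ * D * (α⁻¹ * (2 * (2 * U * (2 * M * L) + 4 / √b * (M ^ 2 / τ ^ 2)) +
        2 * M ^ 2 * (1 / (U ^ 2 * τ) * (2 * U * (C₀ * (√n * (κ * δ))))))) ≤
      (8 * U + 8 / √b) / ℓ ^ 2 * R + 4 * C₀ * κ / (U * ℓ) * R := by
    have hδ0 : 0 < δ := by rw [hδ]; positivity
    have h5 : S * (d * c * Q) ≤ R / ℓ ^ 2 := by
      refine le_trans ?_ hbase
      calc S * (d * c * Q) = d * c * S * 1 * Q := by ring
        _ ≤ d * n * S * L * Q := by gcongr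
    have h6 : S * d * √n * D * Q ≤ R / ℓ := by
      rw [le_div_iff₀ hℓ]
      calc S * d * √n * D * Q * ℓ = D * d * ℓ * √n * S * 1 * Q := by ring
        _ ≤ R := by rw [hR]; gcongr
    calc _ ≤ d / δ * D * (S * (2 * (2 * U * (2 * M * L) + 4 / √b * (M ^ 2 / τ ^ 2)) +
        2 * M ^ 2 * (1 / (U ^ 2 * τ) * (2 * U * (C₀ * (√n * (κ * δ))))))) := by
          gcongr
      _ = 8 * U * (S * (d * c * τ * M * L)) + 8 / √b * (S * (d * c * Q)) +
          4 * C₀ * κ / U * (S * d * √n * D * Q) := by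
          rw [hdD, hδ, hQ]; field_simp; ring
      _ ≤ 8 * U * (R / ℓ ^ 2) + 8 / √b * (R / ℓ ^ 2) + 4 * C₀ * κ / U * (R / ℓ) := by gcongr
      _ = _ := by field_simp
  have t5 : M ^ 2 * ((3 + ρ) * (L₀ * δ)) ≤ (3 + ρ) * R := by
    have e : M ^ 2 * ((3 + ρ) * (L₀ * δ)) = (3 + ρ) * (D * (1 / c) * L₀ * 1 * 1 * Q) := by
      rw [hδ, hQ]; field_simp
    rw [e, hR, mul_assoc _ S L]
    have : 1 / c ≤ d := ((div_le_one hc0).2 hc).trans hd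
    gcongr
  have e : (1 + 9 * U ^ 2 / ℓ ^ 4 + 6 * U / ℓ ^ 2 + (8 * U + 8 / √b) / ℓ ^ 2 +
      4 * C₀ * κ / (U * ℓ) + (3 + ρ)) * R = R + 9 * U ^ 2 / ℓ ^ 4 * R + 6 * U / ℓ ^ 2 * R +
      ((8 * U + 8 / √b) / ℓ ^ 2 * R + 4 * C₀ * κ / (U * ℓ) * R) + (3 + ρ) * R := by ring
  rw [e]
  linarith

/-- Since `M² = τ Q`, a bounded `τ` makes the trivial bound of order `Q`. -/
lemma trivial_terms_le (hℓ : 0 < ℓ) (hD : ℓ ≤ D) (hL₀ : ℓ ≤ L₀) (hU : 0 < U)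
    (hd : 1 ≤ d) (hn : 1 ≤ n) (hτ : 1 ≤ τ) (hS : 1 ≤ S) (hL : 1 ≤ L)
    (hQ : Q = M ^ 2 / τ) (hκ : τ ≤ κ) :
    2 * U * M ^ 2 ≤ 2 * U * κ / ℓ ^ 2 * (D * d * L₀ * n * S * L * Q) := by
  have hD0 : 0 < D := hℓ.trans_le hD
  have hL0 : 0 < L₀ := hℓ.trans_le hL₀
  have hτ0 : 0 < τ := by linarith
  have hQ0 : 0 ≤ Q := by rw [hQ]; positivity
  have e : M ^ 2 = τ * Q := by rw [hQ]; field_simp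
  have hκ0 : 0 < κ := hτ0.trans_le hκ
  have h : ℓ ^ 2 * Q ≤ D * d * L₀ * n * S * L * Q := by
    calc ℓ ^ 2 * Q = ℓ * 1 * ℓ * 1 * 1 * 1 * Q := by ring
      _ ≤ _ := by gcongr
  calc 2 * U * M ^ 2 = 2 * U * τ / ℓ ^ 2 * (ℓ ^ 2 * Q) := by rw [e]; field_simp
    _ ≤ _ := by gcongr

lemma sampleSize_pos {a : ℝ} (hb : 0 < b) (hU : 0 < U) {T t : ℕ} (ht : t ≤ T) :
    0 < sampleSize a b U T t := by
  have h : (0 : ℝ) < (T : ℝ) - t + 1 := by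
    have : (t : ℝ) ≤ T := by exact_mod_cast ht
    linarith
  exact Nat.ceil_pos.2 (by positivity)

lemma sum_div_sqrt_sampleSize_le {a : ℝ} (ha₀ : 0 < a) (ha₁ : a < 1) (hb : 0 < b) (hU : 0 < U)
    (T : ℕ) : ∑ t ∈ Finset.range T, 2 * U / √(sampleSize a b U T (t + 1)) ≤
      4 / √b * (T : ℝ) ^ (1 - a / 2) := by
  have hbs : 0 < √b := Real.sqrt_pos.2 hb
  have h : ∀ t ∈ Finset.range T, 2 * U / √(sampleSize a b U T (t + 1)) ≤
      2 / √b * ((T : ℝ) - t) ^ (-(a / 2)) := by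
    intro t ht
    have ht' : (t : ℝ) < T := by exact_mod_cast Finset.mem_range.1 ht
    have hpos : (0 : ℝ) < (T : ℝ) - t := by linarith
    have h1 : b * U ^ 2 * ((T : ℝ) - t) ^ a ≤ sampleSize a b U T (t + 1) := by
      have := Nat.le_ceil (b * U ^ 2 * ((T : ℝ) - ((t + 1 : ℕ) : ℝ) + 1) ^ a)
      have e : (T : ℝ) - ((t + 1 : ℕ) : ℝ) + 1 = T - t := by push_cast; ring
      rw [e] at this
      rwa [sampleSize, e]
    have h2 : √b * U * ((T : ℝ) - t) ^ (a / 2) ≤ √(sampleSize a b U T (t + 1)) := by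
      refine Real.le_sqrt_of_sq_le (le_of_eq_of_le ?_ h1)
      rw [mul_pow, mul_pow, Real.sq_sqrt hb.le, ← Real.rpow_natCast (_ ^ (a / 2)),
        ← Real.rpow_mul hpos.le]
      norm_num
    have h3 : 0 < ((T : ℝ) - t) ^ (a / 2) := Real.rpow_pos_of_pos hpos _
    calc _ ≤ 2 * U / (√b * U * ((T : ℝ) - t) ^ (a / 2)) := by gcongr
      _ = _ := by rw [Real.rpow_neg hpos.le]; field_simp
  calc _ ≤ _ := Finset.sum_le_sum h
    _ = 2 / √b * ∑ t ∈ Finset.range T, ((T : ℝ) - t) ^ (-(a / 2)) := by rw [Finset.mul_sum]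
    _ ≤ 2 / √b * (2 * (T : ℝ) ^ (1 - a / 2)) := by
        gcongr
        exact sum_range_rpow_neg_le ha₀ ha₁ T
    _ = _ := by ring

/-- What the lower bound on the horizon `T` gives. -/
lemma horizon_bounds {a γ : ℝ} {N T : ℕ} (ha₀ : 0 < a) (ha₁ : a < 1) (hN : 0 < N)
    (hT : (8 * (N : ℝ) ^ (2 / 3 : ℝ)) ^ (1 / a) ≤ (T : ℝ)) (hγ : 0 < γ) (hγ1 : γ < 1) :
    1 ≤ (T : ℝ) ∧ 1 ≤ Real.log (T / γ) ∧
      Real.log (1 / (γ / (2 * N))) ≤ 2 * Real.log (T / γ) := by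
  have hN1 : (1 : ℝ) ≤ N := by exact_mod_cast hN
  -- From `8 q ≤ T` follows `exp 1 ≤ T / γ`; with `N ≤ q²` it also gives `2 N ≤ T²`, so that `log
  -- (2N/γ)` is at most `log ((T/γ)²)`.
  set q := (N : ℝ) ^ (2 / 3 : ℝ)
  have hq : 1 ≤ q := Real.one_le_rpow hN1 (by norm_num)
  have hT8 : 8 * q ≤ T := by
    refine le_trans ?_ hT
    exact Real.self_le_rpow_of_one_le (by linarith) ((one_le_div ha₀).2 ha₁.le)
  have hT0 : (0 : ℝ) < T := by linarith
  have hNq : (N : ℝ) ≤ q ^ 2 := by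
    have : q ^ 2 = (N : ℝ) ^ (4 / 3 : ℝ) := by
      rw [← Real.rpow_natCast, ← Real.rpow_mul (by positivity)]; norm_num
    rw [this]
    exact Real.self_le_rpow_of_one_le hN1 (by norm_num)
  refine ⟨by linarith, ?_, ?_⟩
  · rw [Real.le_log_iff_exp_le (by positivity), le_div_iff₀ hγ]
    have := Real.exp_one_lt_d9
    nlinarith [Real.exp_pos 1]
  · have e : 2 * Real.log (T / γ) = Real.log ((T / γ) ^ 2) := by
      rw [Real.log_pow]; norm_num
    rw [e]
    refine Real.log_le_log (by positivity) ?_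
    rw [one_div_div, div_pow, div_le_div_iff₀ hγ (by positivity)]
    have h1 : 2 * (N : ℝ) ≤ T ^ 2 := by nlinarith
    calc 2 * (N : ℝ) * γ ^ 2 ≤ T ^ 2 * γ ^ 2 := by gcongr
      _ ≤ T ^ 2 * γ := by gcongr; nlinarith

end Numerics

/-! ### Assembly of the regret bound -/

namespace RiskGame

variable {N : ℕ} {G : RiskGame N} {Dx U L₀ C₀ a b ℓ ρ : ℝ}

lemma inv_level_le_S (hS : G.Standing Dx) (i : Fin N) : 1 ≤ G.S ∧ (G.α i)⁻¹ ≤ G.S := by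
  have h0 := hS.level_pos i
  have h1 : 1 ≤ (G.α i)⁻¹ := (one_le_inv₀ h0).2 (hS.level_le_one i)
  have h2 : (G.α i)⁻¹ ≤ 1 / G.α i ^ 2 := by
    rw [one_div, ← inv_pow]
    nlinarith
  have h3 : 1 / G.α i ^ 2 ≤ G.S :=
    Finset.single_le_sum (f := fun i => 1 / G.α i ^ 2) (fun i _ => by positivity)
      (Finset.mem_univ i)
  exact ⟨by linarith, by linarith⟩

/-- The constant of the regret bound. -/
def regretConstant (b U C₀ ℓ ρ : ℝ) : ℝ :=
  (1 + 9 * U ^ 2 / ℓ ^ 4 + 6 * U / ℓ ^ 2 + (8 * U + 8 / √b) / ℓ ^ 2 +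
    4 * C₀ * (2 + 2 * U / ℓ ^ 2) / (U * ℓ) + (3 + ρ)) + 2 * U * (2 / U ^ 2 + ρ) / ℓ ^ 2

lemma tunedParams_eq {d : Fin N → ℕ} {T : ℕ} (hT : (0 : ℝ) < T) :
    (∀ i, (tunedParams d a b U L₀ Dx T).η i = Dx / (d i * L₀ * N) / ((T : ℝ) ^ (a / 4)) ^ 3) ∧
    (tunedParams d a b U L₀ Dx T).δ = Dx / ((N : ℝ) ^ (1 / 6 : ℝ) * (T : ℝ) ^ (a / 4)) := by
  refine ⟨fun i => ?_, ?_⟩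
  · change Dx / ((d i : ℝ) * L₀ * N) * (T : ℝ) ^ (-(3 * a / 4)) = _
    rw [Real.rpow_neg hT.le, ← div_eq_mul_inv, ← Real.rpow_natCast, ← Real.rpow_mul hT.le]
    congr 2
    push_cast
    ring
  · change Dx / (N : ℝ) ^ (1 / 6 : ℝ) * (T : ℝ) ^ (-(a / 4)) = _
    rw [Real.rpow_neg hT.le, ← div_eq_mul_inv, div_div]

variable {T : ℕ} {γ : ℝ} {x₁ : Profile G.d} {v₀ : Fin N → ℝ}

section Unit

variable {Ω : Type*} {mΩ : MeasurableSpace Ω} {μ : Measure Ω} [IsProbabilityMeasure μ]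
  {u : (i : Fin N) → ℕ → Ω → Act (G.d i)} {ξ : (i : Fin N) → ℕ → ℕ → Ω → G.Ξ i}

/-- The regret bound when all the directions, and not just almost all, are unit vectors. -/
lemma measure_exists_large_regret_le_of_norm_eq_one (ha₀ : 0 < a) (ha₁ : a < 1) (hb : 0 < b)
    (hU : 0 < U) (hC₀ : 0 < C₀) (hℓ : 0 < ℓ) (hρ : 0 < ρ) (hL₀ : ℓ ≤ L₀) (hDx : ℓ ≤ Dx)
    (hS : G.Standing Dx) (hball : ∀ i, ∃ c, Metric.closedBall c (Dx / ρ) ⊆ G.X i)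
    (hJ : G.ConvexBounded U) (hL : G.LipschitzCost L₀) (hC : G.LipschitzCDF C₀)
    (hT : (8 * (N : ℝ) ^ (2 / 3 : ℝ)) ^ (1 / a) ≤ (T : ℝ)) (hγ : 0 < γ) (hγ1 : γ < 1)
    (hx₁ : ∀ i, x₁ i ∈ shrink (G.X i) (tunedParams G.d a b U L₀ Dx T).δ)
    (hv₀ : ∀ i, |v₀ i| ≤ U) (hs : G.IsSampling μ u ξ) (hu : ∀ i t ω, ‖u i t ω‖ = 1)
    (hN : 0 < N) :
    μ {ω | ¬ ∀ i,
      G.regret i T (G.played (tunedParams G.d a b U L₀ Dx T) x₁ v₀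
        (fun i t => u i t ω) (fun i t j => ξ i t j ω)) ≤
      regretConstant b U C₀ ℓ ρ *
        (Dx * G.d i * L₀ * N * G.S * Real.log (T / γ) * (T : ℝ) ^ (1 - a / 4))} ≤
      ENNReal.ofReal γ := by
  obtain ⟨hT1, hlog, hlog2⟩ := horizon_bounds ha₀ ha₁ hN hT hγ hγ1
  have hT0 : (0 : ℝ) < T := by linarith
  have hTpos : 0 < T := by exact_mod_cast hT0
  have hN1 : (1 : ℝ) ≤ N := by exact_mod_cast hN
  have hD0 : 0 < Dx := hℓ.trans_le hDx
  have hL0 : 0 < L₀ := hℓ.trans_le hL₀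
  obtain ⟨hη, hδ⟩ := tunedParams_eq (d := G.d) (a := a) (b := b) (U := U) (L₀ := L₀) (Dx := Dx) hT0
  have hβ : (tunedParams G.d a b U L₀ Dx T).β = 1 / (U ^ 2 * (T : ℝ) ^ (a / 4)) := rfl
  have hn : ∀ t, 1 ≤ t → t ≤ T → 0 < (tunedParams G.d a b U L₀ Dx T).n t := fun t _ ht =>
    sampleSize_pos hb hU ht
  have hsum : ∑ t ∈ Finset.range T, 2 * U / √((tunedParams G.d a b U L₀ Dx T).n (t + 1)) ≤
      4 / √b * (T : ℝ) ^ (1 - a / 2) := sum_div_sqrt_sampleSize_le ha₀ ha₁ hb hU T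
  -- From here on only the recorded relations between the parameters matter.
  generalize tunedParams G.d a b U L₀ Dx T = p at *
  have hτ : 1 ≤ (T : ℝ) ^ (a / 4) := Real.one_le_rpow hT1 (by linarith)
  have hM : ((T : ℝ) ^ (a / 4)) ^ 2 ≤ √T := by
    rw [Real.sqrt_eq_rpow, ← Real.rpow_natCast, ← Real.rpow_mul hT0.le]
    refine Real.rpow_le_rpow_of_exponent_le hT1 ?_
    push_cast
    linarith
  have hMT : √(T : ℝ) ^ 2 = T := Real.sq_sqrt hT0.le
  have hQ : (T : ℝ) ^ (1 - a / 4) = √(T : ℝ) ^ 2 / (T : ℝ) ^ (a / 4) := by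
    rw [hMT, Real.rpow_sub hT0, Real.rpow_one]
  have hQ2 : (T : ℝ) ^ (1 - a / 2) = √(T : ℝ) ^ 2 / ((T : ℝ) ^ (a / 4)) ^ 2 := by
    rw [hMT, Real.rpow_sub hT0, Real.rpow_one, ← Real.rpow_natCast (_ ^ (a / 4)),
      ← Real.rpow_mul hT0.le]
    congr 2
    push_cast
    ring
  have hc : 1 ≤ (N : ℝ) ^ (1 / 6 : ℝ) := Real.one_le_rpow hN1 (by norm_num)
  have hcn : ((N : ℝ) ^ (1 / 6 : ℝ)) ^ 2 ≤ N := by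
    rw [← Real.rpow_natCast, ← Real.rpow_mul (by positivity)]
    refine (Real.rpow_le_rpow_of_exponent_le hN1 (y := _) (z := 1) (by norm_num)).trans_eq ?_
    exact Real.rpow_one _
  rw [hQ2] at hsum
  rw [hQ]
  generalize (T : ℝ) ^ (a / 4) = τ at *
  generalize (N : ℝ) ^ (1 / 6 : ℝ) = c at *
  generalize Real.log (T / γ) = L at *
  have hc0 : 0 < c := by linarith
  have hτ0 : 0 < τ := by linarith
  have hδ0 : 0 < p.δ := by rw [hδ]; positivity
  have hd : ∀ i, (1 : ℝ) ≤ G.d i := fun i => by exact_mod_cast hS.dim_pos i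
  have hη0 : ∀ i, 0 < p.η i := fun i => by
    have := hd i
    rw [hη]; positivity
  have hβ0 : 0 ≤ p.β := by rw [hβ]; positivity
  have hR0 : ∀ i, 0 ≤ Dx * G.d i * L₀ * N * G.S * L * (√T ^ 2 / τ) := fun i => by
    have := (inv_level_le_S hS i).1
    positivity
  have hbs : 0 < √b := Real.sqrt_pos.2 hb
  -- On long horizons the momentum weight is at most `1/2` and the inscribed ball allows shrinking
  -- by `δ`. Otherwise `τ` is bounded by a constant.
  by_cases hmain : p.β ≤ 1 / 2 ∧ p.δ * ρ ≤ Dx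
  · obtain ⟨hβ2, hδρ⟩ := hmain
    have hβ1 : p.β ≤ 1 := by linarith
    -- The regret bound holds at every `ω` outside the bad noise event, so monotonicity of the outer
    -- measure suffices and measurability of the regret is never needed.
    refine le_trans (measure_mono fun ω hω => ?_) (measure_exists_large_noise_le (v₀ := v₀) hS hD0
      hU hJ hL0.le hL hδ0 hβ0 hβ1 hn hTpos hx₁ hv₀ hs hu hN hγ hγ1)
    refine mt (fun hgood => ?_) hω
    intro i
    obtain ⟨h1, h2⟩ := hgood i
    have huω := fun i t => hu i t ω
    obtain ⟨hS1, hαS⟩ := inv_level_le_S hS i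
    have hroot : √(2 * T * Real.log (1 / (γ / (2 * N)))) ≤ 2 * √T * L := by
      have := noise_bound_le (Real.sqrt_nonneg (T : ℝ)) hlog hlog2
      rwa [hMT] at this
    have hdi := hd i
    have hα := hS.level_pos i
    have h1' := h1.trans (mul_le_mul_of_nonneg_left hroot (by positivity))
    have h2' := h2.trans (mul_le_mul_of_nonneg_left hroot (by positivity))
    simp only [errorIncrement, Finset.sum_sub_distrib] at h2'
    have hstep : ∀ i, p.η i * (G.d i / p.δ * (2 * U)) ≤ 2 * U / ℓ ^ 2 * p.δ := fun i =>
      step_bound_le hℓ hDx hL₀ hU (hd i) hN1 hτ hc hcn (hη i) hδ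
    have htr := sum_trackingError_le (v₀ := v₀) (ξ := fun i t j => ξ i t j ω) hS hU.le hJ hC₀.le hC
      hδ0 hβ0 hβ2 hn hx₁ huω (k := √N * ((2 + 2 * U / ℓ ^ 2) * p.δ)) (by positivity)
      (fun t ht => (norm_played_sub_played_le hS hJ hδ0 hη0 hβ0 hβ1 hn hx₁ hv₀ huω hstep
        ht).trans_eq (by ring)) i
    have hreg := regret_le (ξ := fun i t j => ξ i t j ω) hS hD0 hU.le hJ hL0.le hL hδ0 hη0 hβ0 hβ1
      hn hx₁ hv₀ huω hρ hδρ i (hball i)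
    have hterms := regret_terms_le (S := G.S) (κ := 2 + 2 * U / ℓ ^ 2) hℓ hDx hL₀ hU hb hC₀ hρ hdi
      hN1 hτ hc hcn hS1 hαS hlog hM (hη i) hδ (by positivity) rfl
    rw [← hβ] at hterms
    have htr' := htr.trans (add_le_add_left (mul_le_mul_of_nonneg_left
      ((sub_le_iff_le_add.1 h2').trans (add_le_add_right hsum _)) zero_le_two) _)
    have htr'' := mul_le_mul_of_nonneg_left (mul_le_mul_of_nonneg_left htr' (inv_nonneg.2 hα.le))
      (by positivity : 0 ≤ G.d i / p.δ * Dx)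
    rw [hMT] at hterms htr''
    refine hreg.trans ?_
    have hKR : 0 ≤ 2 * U * (2 / U ^ 2 + ρ) / ℓ ^ 2 *
        (Dx * G.d i * L₀ * N * G.S * L * (√T ^ 2 / τ)) := mul_nonneg (by positivity) (hR0 i)
    rw [hMT] at hKR ⊢
    rw [regretConstant, add_mul _ (2 * U * (2 / U ^ 2 + ρ) / ℓ ^ 2)]
    linarith
  · have hτκ : τ ≤ 2 / U ^ 2 + ρ := by
      by_contra! hlt
      refine hmain ⟨?_, ?_⟩
      · have : 2 / U ^ 2 < τ := by linarith
        rw [div_lt_iff₀ (by positivity)] at this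
        rw [hβ, div_le_div_iff₀ (by positivity) two_pos]
        linarith
      · have h1 : ρ ≤ τ := by
          have : 0 < 2 / U ^ 2 := by positivity
          linarith
        rw [hδ, div_mul_eq_mul_div, div_le_iff₀ (by positivity)]
        calc Dx * ρ ≤ Dx * (1 * τ) := by gcongr; linarith
          _ ≤ Dx * (c * τ) := by gcongr
    refine le_of_eq_of_le ?_ zero_le
    convert measure_empty (μ := μ)
    refine Set.eq_empty_of_forall_notMem fun ω hω => hω fun i => ?_
    have hS1 := (inv_level_le_S hS i).1
    have h := regret_le_trivial (v₀ := v₀) (ξ := fun i t j => ξ i t j ω) (T := T) hS hJ hδ0 hx₁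
      (fun i t => hu i t ω) i
    refine h.trans ?_
    have ht := trivial_terms_le (M := √T) hℓ hDx hL₀ hU (hd i) hN1 hτ hS1 hlog rfl hτκ
    rw [hMT] at ht
    have hKR := mul_nonneg (a := 1 + 9 * U ^ 2 / ℓ ^ 4 + 6 * U / ℓ ^ 2 + (8 * U + 8 / √b) / ℓ ^ 2 +
      4 * C₀ * (2 + 2 * U / ℓ ^ 2) / (U * ℓ) + (3 + ρ)) (by positivity) (hR0 i)
    rw [hMT] at hKR ⊢
    rw [regretConstant, add_mul _ (2 * U * (2 / U ^ 2 + ρ) / ℓ ^ 2)]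
    linarith

end Unit

end RiskGame

end

theorem theorem1 (a b U C₀ ℓ ρ : ℝ) (ha₀ : 0 < a) (ha₁ : a < 1) (hb : 0 < b) (hU : 0 < U)
    (hC₀ : 0 < C₀) (hℓ : 0 < ℓ) (hρ : 0 < ρ) :
    ∃ K : ℝ, 0 < K ∧
      ∀ (L₀ Dx : ℝ), ℓ ≤ L₀ → ℓ ≤ Dx →
      ∀ (N : ℕ) (G : RiskGame N),
        G.Standing Dx →
        (∀ i, ∃ c, Metric.closedBall c (Dx / ρ) ⊆ G.X i) →
        G.ConvexBounded U → G.LipschitzCost L₀ → G.LipschitzCDF C₀ →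
      ∀ (T : ℕ), (8 * (N : ℝ) ^ (2 / 3 : ℝ)) ^ (1 / a) ≤ (T : ℝ) →
      ∀ (γ : ℝ), 0 < γ → γ < 1 →
      ∀ (x₁ : Profile G.d),
        (∀ i, x₁ i ∈ shrink (G.X i) (tunedParams G.d a b U L₀ Dx T).δ) →
      ∀ (v₀ : Fin N → ℝ), (∀ i, |v₀ i| ≤ U) →
      ∀ (Ω : Type*) [MeasurableSpace Ω] (μ : Measure Ω) [IsProbabilityMeasure μ]
        (u : (i : Fin N) → ℕ → Ω → Act (G.d i)) (ξ : (i : Fin N) → ℕ → ℕ → Ω → G.Ξ i),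
        G.IsSampling μ u ξ →
        μ {ω | ¬ ∀ i,
            G.regret i T (G.played (tunedParams G.d a b U L₀ Dx T) x₁ v₀
              (fun i t => u i t ω) (fun i t j => ξ i t j ω)) ≤
            K * (Dx * G.d i * L₀ * N * G.S * Real.log (T / γ) * (T : ℝ) ^ (1 - a / 4))}
          ≤ ENNReal.ofReal γ := by
  refine ⟨RiskGame.regretConstant b U C₀ ℓ ρ, ?_, ?_⟩
  · have hbs : 0 < √b := Real.sqrt_pos.2 hb
    unfold RiskGame.regretConstant
    positivity
  intro L₀ Dx hL₀ hDx N G hS hball hJ hL hC T hT γ hγ hγ1 x₁ hx₁ v₀ hv₀ Ω _ μ _ u ξ hs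
  -- Without agents the bad event is empty.
  rcases Nat.eq_zero_or_pos N with rfl | hN
  · refine le_of_eq_of_le ?_ zero_le
    convert measure_empty (μ := μ)
    exact Set.eq_empty_of_forall_notMem fun ω hω => hω fun i => i.elim0
  have he : ∀ i, ∃ e : Act (G.d i), ‖e‖ = 1 := fun i =>
    ⟨EuclideanSpace.single ⟨0, hS.dim_pos i⟩ 1, by simp⟩
  choose e he using he
  refine le_trans (measure_mono_ae ?_)
    (RiskGame.measure_exists_large_regret_le_of_norm_eq_one ha₀ ha₁ hb hU hC₀ hℓ hρ hL₀ hDx hS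
      hball hJ hL hC hT hγ hγ1 hx₁ hv₀ (hs.toUnit e) (fun i t ω => RiskGame.norm_toUnit (he i) _)
      hN)
  -- Almost surely the normalised directions are the original ones, so the original bad event is
  -- contained in the normalised one up to a null set.
  filter_upwards [hs.ae_norm_eq_one] with ω hω
  have hu : (fun i t => RiskGame.toUnit (e i) (u i t ω)) = fun i t => u i t ω := by
    funext i t
    exact RiskGame.toUnit_of_norm_eq_one _ (hω i t)
  intro h
  change ¬ _ at h ⊢
  rw [hu]
  exact h
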